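/- Superfields. Let $U\subseteq\mathbb C^2$ be open, with coordinates $(x,t)$, and let superfields be the elements of $\mathcal O(U)\otimes\Lambda$, where $\mathcal O(U)$ is the algebra of holomorphic functions on $U$ and $\Lambda$ is the complex Grassmann algebra generated by the odd variable $\vartheta$ and any further odd constants. Write $\partial=\partial/\partial x$, $\partial_t=\partial/\partial t$, $D=\partial_\vartheta+\vartheta\partial$ (left derivative), and $D\ln f:=f^{-1}Df$ for an invertible even superfield $f$; accordingly $D^3\ln f:=D^2(f^{-1}Df)$. The Manin–Radul super KdV (MRSKdV) system for an odd superfield $\alpha$ and an even superfield $u$ is $$\partial_t\alpha=\tfrac14\partial(\partial^2\alpha+3\alpha D\alpha+6\alpha u),\qquad \partial_tu=\tfrac14\partial(\partial^2u+3u^2+3\alpha Du),$$ and its linear system with parameter $\lambda\in\mathbb C$ is $$\partial^2\psi+\alpha D\psi+u\psi=\lambda\psi,\qquad \partial_t\psi=\tfrac12\alpha\,\partial D\psi+\lambda\partial\psi+\tfrac12u\,\partial\psi-\tfrac14(\partial\alpha)D\psi-\tfrac14(\partial u)\psi .$$ For a block supermatrix put $\operatorname{sdet}\begin{pmatrix}A&B\\C&E\end{pmatrix}=\det(A-BE^{-1}C)/\det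 E$. Theorem. Let $(\alpha,u)$ be a solution of the MRSKdV system on $U$, and let $\theta_0,\dots,\theta_{n-1}$ be solutions of its linear system with parameters $\lambda=k_0,\dots,k_{n-1}\in\mathbb C$ and parities $p(\theta_j)=(-1)^j$ ($\theta_j$ is even for even $j$ and odd for odd $j$). Let $\boldsymbol\theta^{(0)}=(\theta_0,\theta_2,\dots)$ and $\boldsymbol\theta^{(1)}=(\theta_1,\theta_3,\dots)$ be the rows of the even and of the odd ones among $\theta_0,\dots,\theta_{n-1}$. (i) Let $n=2k$. For $i=0,1$ let $W^{(i)}$ have the rows $\boldsymbol\theta^{(i)},\partial\boldsymbol\theta^{(i)},\dots,\partial^{k-1}\boldsymbol\theta^{(i)}$, let $\hat W^{(i)}$ be $W^{(i)}$ with the last row replaced by $\partial^k\boldsymbol\theta^{(i)}$, and put $$\mathcal W=\begin{pmatrix}W^{(0)}&W^{(1)}\\DW^{(0)}&DW^{(1)}\end{pmatrix},\qquad \hat{\mathcal W}=\begin{pmatrix}\hat W^{(0)}&\hat W^{(1)}\\DW^{(0)}&DW^{(1)}\end{pmatrix}.$$ If $\mathcal W$ is invertible, then $$\hat\alpha=\alpha-2D^3\ln\operatorname{sdet}\mathcal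 W,\qquad \hat u=u+2\partial\Big(\frac{\operatorname{sdet}\hat{\mathcal W}}{\operatorname{sdet}\mathcal W}\Big)+(\alpha+\hat\alpha)\,D\ln\operatorname{sdet}\mathcal W$$ are respectively odd and even and again solve the MRSKdV system. (ii) Let $n=2k+1$. For $i=0,1$ let $W^{(i)}$ have the rows $\boldsymbol\theta^{(i)},\partial\boldsymbol\theta^{(i)},\dots,\partial^{k}\boldsymbol\theta^{(i)}$, let $\tilde W^{(i)}$ and $\check W^{(i)}$ be $W^{(i)}$ with the last, respectively the second to last, row removed (for $k=0$ both are empty), let $\hat W^{(i)}$ be $W^{(i)}$ with the last row replaced by $D^{2k+1}\boldsymbol\theta^{(i)}$, and put $$\mathcal W=\begin{pmatrix}W^{(0)}&W^{(1)}\\D\tilde W^{(0)}&D\tilde W^{(1)}\end{pmatrix},\quad \check{\mathcal W}=\begin{pmatrix}W^{(0)}&W^{(1)}\\D\check W^{(0)}&D\check W^{(1)}\end{pmatrix},\quad R=\frac{\det\big(\hat W^{(0)}-\hat W^{(1)}(D\tilde W^{(1)})^{-1}D\tilde W^{(0)}\big)}{\det\big(W^{(0)}-W^{(1)}(D\tilde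 W^{(1)})^{-1}D\tilde W^{(0)}\big)} .$$ If $\mathcal W$ and $\check{\mathcal W}$ are invertible, then $$\hat\alpha=-\alpha+2\partial R,\qquad \hat u=u+2\partial\Big(\frac{\operatorname{sdet}\mathcal W}{\operatorname{sdet}\check{\mathcal W}}\Big)+D\alpha+(\alpha-\hat\alpha)R$$ are respectively odd and even and again solve the MRSKdV system. -/

import Mathlib

open scoped TensorProduct

noncomputable section

namespace SuperKdV

/-! ### Superfields

`Hol U` is the algebra of holomorphic functions on an open set `U` of the `(x, t)`-plane `ℂ²`.
Superfields on `U` are elements of `Hol U ⊗ Λ(ℂ ⊕ V)`: the exterior algebra is generated by the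
Grassmann odd variable `ϑ` (first summand) and the odd constants (the elements of `V`). -/

/-- Extension by zero of a function on `U` to `ℂ²`. -/
def extendZero {U : TopologicalSpace.Opens (ℂ × ℂ)} (f : U → ℂ) : ℂ × ℂ → ℂ :=
  Function.extend Subtype.val f 0

theorem extendZero_apply {U : TopologicalSpace.Opens (ℂ × ℂ)} (f : U → ℂ) (p : U) :
    extendZero f p = f p :=
  Subtype.val_injective.extend_apply f 0 p

theorem analyticAt_extendZero_iff {U : TopologicalSpace.Opens (ℂ × ℂ)} {f : U → ℂ}
    {F : ℂ × ℂ → ℂ} (h : ∀ p : U, f p = F p) {q : ℂ × ℂ} (hq : q ∈ U) :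
    AnalyticAt ℂ (extendZero f) q ↔ AnalyticAt ℂ F q := by
  refine analyticAt_congr ?_
  filter_upwards [U.isOpen.mem_nhds hq] with r hr
  exact (extendZero_apply f ⟨r, hr⟩).trans (h ⟨r, hr⟩)

/-- The algebra of holomorphic functions on `U`. -/
def Hol (U : TopologicalSpace.Opens (ℂ × ℂ)) : Subalgebra ℂ (U → ℂ) where
  carrier := {f | AnalyticOnNhd ℂ (extendZero f) U}
  mul_mem' {f g} hf hg q hq :=
    (analyticAt_extendZero_iff (F := extendZero f * extendZero g)
      (fun p => by simp [extendZero_apply]) hq).2 ((hf q hq).mul (hg q hq))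
  add_mem' {f g} hf hg q hq :=
    (analyticAt_extendZero_iff (F := extendZero f + extendZero g)
      (fun p => by simp [extendZero_apply]) hq).2 ((hf q hq).add (hg q hq))
  algebraMap_mem' c q hq :=
    (analyticAt_extendZero_iff (F := fun _ => c) (fun _ => rfl) hq).2 analyticAt_const

theorem differentiableAt_extendZero {U : TopologicalSpace.Opens (ℂ × ℂ)} (f : Hol U) (p : U) :
    DifferentiableAt ℂ (extendZero f.1) p :=
  (f.2 p p.2).differentiableAt

/-- The derivative of a holomorphic function in the direction `v`. -/
def dirDeriv (U : TopologicalSpace.Opens (ℂ × ℂ)) (v : ℂ × ℂ) : Hol U →ₗ[ℂ] Hol U where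
  toFun f := ⟨fun p => fderiv ℂ (extendZero f.1) p v, fun q hq =>
    (analyticAt_extendZero_iff (F := fun r => fderiv ℂ (extendZero f.1) r v)
      (fun _ => rfl) hq).2 (((ContinuousLinearMap.apply ℂ ℂ v).analyticAt _).comp (f.2 q hq).fderiv)⟩
  map_add' f g := by
    ext p
    have h : extendZero (f + g).1 = extendZero f.1 + extendZero g.1 := by
      funext q
      by_cases hq : q ∈ U
      · exact (extendZero_apply _ (⟨q, hq⟩ : U)).trans (congrArg₂ (· + ·)
          (extendZero_apply f.1 (⟨q, hq⟩ : U)).symm (extendZero_apply g.1 (⟨q, hq⟩ : U)).symm)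
      · simp [extendZero, Function.extend_apply', hq]
    change fderiv ℂ (extendZero (f + g).1) p v = _
    rw [h, fderiv_add (differentiableAt_extendZero f p) (differentiableAt_extendZero g p)]
    rfl
  map_smul' c f := by
    ext p
    have h : extendZero (c • f).1 = c • extendZero f.1 := by
      funext q
      by_cases hq : q ∈ U
      · exact (extendZero_apply _ (⟨q, hq⟩ : U)).trans
          (congrArg (c • ·) (extendZero_apply f.1 (⟨q, hq⟩ : U)).symm)
      · simp [extendZero, Function.extend_apply', hq]
    change fderiv ℂ (extendZero (c • f).1) p v = _
    rw [h, fderiv_const_smul (differentiableAt_extendZero f p)]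
    rfl

/-- Superfields on `U` with odd constants `V`. -/
def Superfield (U : TopologicalSpace.Opens (ℂ × ℂ)) (V : Type*) [AddCommGroup V]
    [Module ℂ V] : Type _ :=
  Hol U ⊗[ℂ] ExteriorAlgebra ℂ (ℂ × V)

section Calculus

variable {U : TopologicalSpace.Opens (ℂ × ℂ)} {V : Type*} [AddCommGroup V] [Module ℂ V]

instance : Ring (Superfield U V) :=
  inferInstanceAs (Ring (Hol U ⊗[ℂ] ExteriorAlgebra ℂ (ℂ × V)))

instance : Algebra ℂ (Superfield U V) :=
  inferInstanceAs (Algebra ℂ (Hol U ⊗[ℂ] ExteriorAlgebra ℂ (ℂ × V)))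

/-- The Grassmann odd variable `ϑ`. -/
def vartheta : Superfield U V :=
  (1 : Hol U) ⊗ₜ[ℂ] ExteriorAlgebra.ι ℂ ((1, 0) : ℂ × V)

/-- `∂ = ∂/∂x`. -/
def dX : Superfield U V →ₗ[ℂ] Superfield U V :=
  (dirDeriv U (1, 0)).rTensor (ExteriorAlgebra ℂ (ℂ × V))

/-- `∂ₜ = ∂/∂t`. -/
def dT : Superfield U V →ₗ[ℂ] Superfield U V :=
  (dirDeriv U (0, 1)).rTensor (ExteriorAlgebra ℂ (ℂ × V))

/-- The left derivative `∂/∂ϑ`: contraction with the linear form that is `1` at `ϑ` and `0` at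
the odd constants. -/
def dVartheta : Superfield U V →ₗ[ℂ] Superfield U V :=
  (CliffordAlgebra.contractLeft (Q := (0 : QuadraticForm ℂ (ℂ × V)))
    (LinearMap.fst ℂ ℂ V)).lTensor (Hol U)

/-- The super derivation `D = ∂/∂ϑ + ϑ ∂`. -/
def superD : Superfield U V →ₗ[ℂ] Superfield U V :=
  dVartheta + LinearMap.mulLeft ℂ vartheta ∘ₗ dX

/-- The parity automorphism, `1` on even and `-1` on odd superfields. -/
def parity : Superfield U V →ₗ[ℂ] Superfield U V :=
  (CliffordAlgebra.involute (Q := (0 : QuadraticForm ℂ (ℂ × V)))).toLinearMap.lTensor (Hol U)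

def IsEven (f : Superfield U V) : Prop := parity f = f

def IsOdd (f : Superfield U V) : Prop := parity f = -f

/-- `(α, u)`, with `α` odd and `u` even, solves the Manin-Radul super KdV system on `U`. -/
structure IsMRSolution (α u : Superfield U V) : Prop where
  odd : IsOdd α
  even : IsEven u
  eq_alpha : dT α = (1 / 4 : ℂ) •
    dX (dX (dX α) + (3 : ℂ) • (α * superD α) + (6 : ℂ) • (α * u))
  eq_u : dT u = (1 / 4 : ℂ) • dX (dX (dX u) + (3 : ℂ) • u ^ 2 + (3 : ℂ) • (α * superD u))

/-- `ψ` solves the linear system `L ψ = lam ψ`, `∂ₜ ψ = M ψ` with potentials `α, u` and spectral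
parameter `lam`. -/
structure IsLinearSolution (α u : Superfield U V) (lam : ℂ) (ψ : Superfield U V) : Prop where
  eq_L : dX (dX ψ) + α * superD ψ + u * ψ = lam • ψ
  eq_M : dT ψ = (1 / 2 : ℂ) • (α * dX (superD ψ)) + lam • dX ψ + (1 / 2 : ℂ) • (u * dX ψ)
    - (1 / 4 : ℂ) • (dX α * superD ψ) - (1 / 4 : ℂ) • (dX u * ψ)

/-- `D ln f = f⁻¹ D f`, for an invertible even superfield `f`. -/
def superDlog (f : Superfield U V) : Superfield U V := Ring.inverse f * superD f

end Calculus

/-! ### Superdeterminants -/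

section Determinants

variable {A : Type*} [Ring A]

/-- The determinant by the Leibniz formula, each product being taken in the order of the rows.
It is used for matrices whose entries are even except possibly for those of one row, so that the
entries in each product commute. -/
def rowDet {n : ℕ} (M : Matrix (Fin n) (Fin n) A) : A :=
  ∑ σ : Equiv.Perm (Fin n), (Equiv.Perm.sign σ : ℤ) • (List.ofFn fun i => M i (σ i)).prod

/-- The block supermatrix `M` is invertible: an even supermatrix is so if and only if both of
its diagonal blocks are. -/
def IsSuperInvertible {p q : ℕ} (M : Matrix (Fin p ⊕ Fin q) (Fin p ⊕ Fin q) A) : Prop :=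
  IsUnit M.toBlocks₁₁ ∧ IsUnit M.toBlocks₂₂

/-- The Schur complement `A - B D⁻¹ C`. -/
def schur {p q : ℕ} (M : Matrix (Fin p ⊕ Fin q) (Fin p ⊕ Fin q) A) :
    Matrix (Fin p) (Fin p) A :=
  M.toBlocks₁₁ - M.toBlocks₁₂ * Ring.inverse M.toBlocks₂₂ * M.toBlocks₂₁

/-- The superdeterminant (Berezinian) `det (A - B D⁻¹ C) / det D`. -/
def sdet {p q : ℕ} (M : Matrix (Fin p ⊕ Fin q) (Fin p ⊕ Fin q) A) : A :=
  rowDet (schur M) * Ring.inverse (rowDet M.toBlocks₂₂)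

end Determinants

/-! ### Wronski type supermatrices

The even functions are `θ₀, θ₂, …`, the odd ones `θ₁, θ₃, …`; rows are numbered from `0`. -/

section Wronski

variable {U : TopologicalSpace.Opens (ℂ × ℂ)} {V : Type*} [AddCommGroup V] [Module ℂ V]

/-- The `p + q` by `p + q` supermatrix whose row `r` is `R r` applied to the `θ`'s in the upper
blocks, and `S r` applied to them in the lower blocks; its columns are `θ₀, θ₂, …, θ_{2p-2}`
followed by `θ₁, θ₃, …, θ_{2q-1}`. -/
def wronskiBlocks (p q : ℕ) (R S : ℕ → Superfield U V → Superfield U V)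
    (θ : ℕ → Superfield U V) :
    Matrix (Fin p ⊕ Fin q) (Fin p ⊕ Fin q) (Superfield U V) :=
  Matrix.fromBlocks
    (Matrix.of fun (r : Fin p) (c : Fin p) => R r (θ (2 * c)))
    (Matrix.of fun (r : Fin p) (c : Fin q) => R r (θ (2 * c + 1)))
    (Matrix.of fun (r : Fin q) (c : Fin p) => S r (θ (2 * c)))
    (Matrix.of fun (r : Fin q) (c : Fin q) => S r (θ (2 * c + 1)))

/-- `∂ʳ f`. -/
def rowX (r : ℕ) (f : Superfield U V) : Superfield U V := (dX ^ r) f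

/-- `D ∂ʳ f`. -/
def rowDX (r : ℕ) (f : Superfield U V) : Superfield U V := superD ((dX ^ r) f)

/-- The supermatrix `𝒲` for `n = 2k`. -/
def evenW (k : ℕ) (θ : ℕ → Superfield U V) :
    Matrix (Fin k ⊕ Fin k) (Fin k ⊕ Fin k) (Superfield U V) :=
  wronskiBlocks k k rowX rowDX θ

/-- The supermatrix `𝒲̂` for `n = 2k`: the last row `∂^(k-1) θ` of the upper blocks is replaced
by `∂^k θ`. -/
def evenWhat (k : ℕ) (θ : ℕ → Superfield U V) :
    Matrix (Fin k ⊕ Fin k) (Fin k ⊕ Fin k) (Superfield U V) :=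
  wronskiBlocks k k (fun r => if r + 1 = k then rowX k else rowX r) rowDX θ

/-- The supermatrix `𝒲` for `n = 2k+1`. -/
def oddW (k : ℕ) (θ : ℕ → Superfield U V) :
    Matrix (Fin (k + 1) ⊕ Fin k) (Fin (k + 1) ⊕ Fin k) (Superfield U V) :=
  wronskiBlocks (k + 1) k rowX rowDX θ

/-- The supermatrix `𝒲̌` for `n = 2k+1`: the rows of the lower blocks are `D ∂ʳ θ` with
`r = 0, …, k - 2, k`. -/
def oddWcheck (k : ℕ) (θ : ℕ → Superfield U V) :
    Matrix (Fin (k + 1) ⊕ Fin k) (Fin (k + 1) ⊕ Fin k) (Superfield U V) :=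
  wronskiBlocks (k + 1) k rowX (fun r => if r + 1 = k then rowDX k else rowDX r) θ

/-- The block matrix for `n = 2k+1` obtained from `𝒲` by replacing the last row `∂^k θ` of the
upper blocks by `D^(2k+1) θ`. -/
def oddWhat (k : ℕ) (θ : ℕ → Superfield U V) :
    Matrix (Fin (k + 1) ⊕ Fin k) (Fin (k + 1) ⊕ Fin k) (Superfield U V) :=
  wronskiBlocks (k + 1) k
    (fun r => if r = k then fun f => (superD ^ (2 * k + 1)) f else rowX r) rowDX θ

/-- The ratio of the determinants of the Schur complements of `oddWhat` and `oddW`,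
`det (Ŵ⁰ - Ŵ¹ (D W̃¹)⁻¹ D W̃⁰) / det (W⁰ - W¹ (D W̃¹)⁻¹ D W̃⁰)`. -/
def oddRatio (k : ℕ) (θ : ℕ → Superfield U V) : Superfield U V :=
  rowDet (schur (oddWhat k θ)) * Ring.inverse (rowDet (schur (oddW k θ)))

end Wronski

end SuperKdV

end

open scoped TensorProduct

noncomputable section

namespace SuperKdV

/-! The theorem is a Darboux transformation, proved by dressing a Lax pair. Put `K = αD + u`, `L =
∂² + K` and `M = 4∂³ + 6K∂ + 3[∂, K]`. The MRSKdV system is the Lax equation `[4∂ₜ - M, L] = 0`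
(`lax_eq_zero_iff`), and its linear system says `Lψ = λψ`, `4∂ₜψ = Mψ` (`act_laxM`).

All orders are counted in `D`, where `D² = ∂`. Invertibility of `𝒲` has two consequences
(`wronski_data`): there is a monic operator `T = Dⁿ + ∑ aᵢDⁱ` with `Tθⱼ = 0` for all `j < n`, and an
operator of order less than `n` that kills every `θⱼ` is zero. The latter is the source of all
operator identities. The potentials `α'`, `u'` are chosen so that `TL - L'T` has order less than
`n`; it kills the `θⱼ`, hence `TL = L'T`. Next, `M'T - TM` has order less than `n`, because `M² -
16L³` has low order and `TL³ = L'³T` (`laxM_intertwine_mem`). So `M'T - TM - 4[∂ₜ, T]` has order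
less than `n` and kills the `θⱼ`, hence vanishes. Now `4∂ₜ - M` and `L` are both intertwined by `T`,
so `[4∂ₜ - M', L']T = T[4∂ₜ - M, L] = 0`, and the monic `T` cancels (`dressing`).

It remains to express the top coefficients of `T` by superdeterminants. Cramer's rule on the Schur
complement gives those of even index (`rowDet_schur_updateRow`). For even `n`, `aₙ₋₁ = D ln sdet 𝒲`
is a super version of Liouville's formula (`dlog_sdet`). For odd `n`, `aₙ₋₂` is minus a quotient of
two Berezinians that differ in one lower row (`lower_coefficient`).

Everything up to the last section uses only the Leibniz and sign rules, so it is carried out in an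
abstract supercommutative differential algebra. -/

/-- A supercommutative algebra with parity automorphism `par`, an odd derivation `D` and an even
derivation `dt` that commute. -/
class SuperDiffAlgebra (A : Type*) [Ring A] [Algebra ℂ A] where
  par : A →ₐ[ℂ] A
  D : A →ₗ[ℂ] A
  dt : A →ₗ[ℂ] A
  par_par (a : A) : par (par a) = a
  D_mul (a b : A) : D (a * b) = D a * b + par a * D b
  D_par (a : A) : D (par a) = -par (D a)
  dt_mul (a b : A) : dt (a * b) = dt a * b + a * dt b
  dt_par (a : A) : dt (par a) = par (dt a)
  dt_D (a : A) : dt (D a) = D (dt a)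
  even_comm (a b : A) : par a = a → a * b = b * a
  odd_anticomm (a b : A) : par a = -a → par b = -b → a * b = -(b * a)

/-! ### Sign rules in the exterior algebra -/

section Exterior

variable {M : Type*} [AddCommGroup M] [Module ℂ M]

theorem ι_mul_eq_involute_mul (v : M) (x : ExteriorAlgebra ℂ M) :
    ExteriorAlgebra.ι ℂ v * x
      = CliffordAlgebra.involute (Q := (0 : QuadraticForm ℂ M)) x * ExteriorAlgebra.ι ℂ v := by
  induction x using ExteriorAlgebra.induction with
  | algebraMap r => rw [AlgHom.commutes, Algebra.commutes]
  | ι w =>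
    have h : CliffordAlgebra.involute (Q := (0 : QuadraticForm ℂ M)) (ExteriorAlgebra.ι ℂ w)
      = -ExteriorAlgebra.ι ℂ w := CliffordAlgebra.involute_ι w
    rw [h, neg_mul, ← add_eq_zero_iff_eq_neg]
    exact ExteriorAlgebra.ι_add_mul_swap v w
  | mul a b ha hb => rw [map_mul, ← mul_assoc, ha, mul_assoc, hb, mul_assoc]
  | add a b ha hb => rw [map_add, mul_add, add_mul, ha, hb]

/-- Contraction anticommutes past each generator up to a scalar, so induction on the left factor
collects the sign `involute x`. This is what makes `∂/∂ϑ` an odd derivation. -/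
theorem contractLeft_mul (d : Module.Dual ℂ M) (x y : ExteriorAlgebra ℂ M) :
    CliffordAlgebra.contractLeft (Q := (0 : QuadraticForm ℂ M)) d (x * y)
      = CliffordAlgebra.contractLeft (Q := (0 : QuadraticForm ℂ M)) d x * y
        + CliffordAlgebra.involute (Q := (0 : QuadraticForm ℂ M)) x
          * CliffordAlgebra.contractLeft (Q := (0 : QuadraticForm ℂ M)) d y := by
  induction x using CliffordAlgebra.left_induction generalizing y with
  | algebraMap r =>
    rw [CliffordAlgebra.contractLeft_algebraMap_mul, CliffordAlgebra.contractLeft_algebraMap,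
      AlgHom.commutes, zero_mul, zero_add]
  | add a b ha hb => simp only [add_mul, map_add, ha, hb]; abel
  | ι_mul x m hx =>
    rw [mul_assoc, CliffordAlgebra.contractLeft_ι_mul, CliffordAlgebra.contractLeft_ι_mul, hx,
      map_mul, CliffordAlgebra.involute_ι]
    simp only [sub_mul, mul_add, smul_mul_assoc, neg_mul, mul_assoc]
    abel

theorem contractLeft_involute (d : Module.Dual ℂ M) (x : ExteriorAlgebra ℂ M) :
    CliffordAlgebra.contractLeft (Q := (0 : QuadraticForm ℂ M)) d
        (CliffordAlgebra.involute (Q := (0 : QuadraticForm ℂ M)) x)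
      = -CliffordAlgebra.involute (Q := (0 : QuadraticForm ℂ M))
          (CliffordAlgebra.contractLeft (Q := (0 : QuadraticForm ℂ M)) d x) := by
  induction x using CliffordAlgebra.left_induction with
  | algebraMap r =>
    rw [AlgHom.commutes, CliffordAlgebra.contractLeft_algebraMap, map_zero, neg_zero]
  | add a b ha hb => simp only [map_add, ha, hb]; abel
  | ι_mul x m hx =>
    rw [map_mul, CliffordAlgebra.involute_ι, neg_mul, map_neg, CliffordAlgebra.contractLeft_ι_mul,
      CliffordAlgebra.contractLeft_ι_mul, hx, map_sub, map_smul, map_mul,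
      CliffordAlgebra.involute_ι]
    simp only [mul_neg, neg_mul, sub_neg_eq_add]

end Exterior

/-! ### Directional derivatives of holomorphic functions -/

section Holomorphic

variable {U : TopologicalSpace.Opens (ℂ × ℂ)}

theorem dirDeriv_mul (v : ℂ × ℂ) (f g : Hol U) :
    dirDeriv U v (f * g) = dirDeriv U v f * g + f * dirDeriv U v g := by
  ext p
  have h : extendZero (f * g).1 = extendZero f.1 * extendZero g.1 := by
    funext q
    by_cases hq : q ∈ U
    · exact (extendZero_apply _ (⟨q, hq⟩ : U)).trans (congrArg₂ (· * ·)
        (extendZero_apply f.1 (⟨q, hq⟩ : U)).symm (extendZero_apply g.1 (⟨q, hq⟩ : U)).symm)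
    · simp [extendZero, Function.extend_apply', hq]
  change fderiv ℂ (extendZero (f * g).1) p v = fderiv ℂ (extendZero f.1) p v * g.1 p
    + f.1 p * fderiv ℂ (extendZero g.1) p v
  rw [h, fderiv_mul (differentiableAt_extendZero f p) (differentiableAt_extendZero g p),
    ← extendZero_apply f.1 p, ← extendZero_apply g.1 p]
  simp only [add_apply, smul_apply, smul_eq_mul]
  ring

/-- Both iterated derivatives are values of the second Fréchet derivative, which is symmetric for an
analytic function. The extension by zero does no harm, since only the germ at a point of the open
set `U` matters. -/
theorem dirDeriv_comm (v w : ℂ × ℂ) (f : Hol U) :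
    dirDeriv U v (dirDeriv U w f) = dirDeriv U w (dirDeriv U v f) := by
  have key (v w : ℂ × ℂ) (p : U) : (dirDeriv U v (dirDeriv U w f)).1 p
      = fderiv ℂ (fderiv ℂ (extendZero f.1)) p v w := by
    have hloc : extendZero (dirDeriv U w f).1
        =ᶠ[nhds (p : ℂ × ℂ)] fun r => fderiv ℂ (extendZero f.1) r w := by
      filter_upwards [U.isOpen.mem_nhds p.2] with r hr
      exact extendZero_apply _ (⟨r, hr⟩ : U)
    change fderiv ℂ (extendZero (dirDeriv U w f).1) p v = _
    rw [hloc.fderiv_eq, fderiv_clm_apply (f.2 p p.2).fderiv.differentiableAt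
      (differentiableAt_const w)]
    simp
  ext p
  rw [key, key]
  have hs : IsSymmSndFDerivAt ℂ (extendZero f.1) (p : ℂ × ℂ) :=
    (f.2 p p.2).contDiffAt.isSymmSndFDerivAt_of_omega
  exact hs v w

end Holomorphic

/-! ### Superfields as a supercommutative differential algebra -/

section Instance

variable {U : TopologicalSpace.Opens (ℂ × ℂ)} {V : Type*} [AddCommGroup V] [Module ℂ V]

/-- The superfield `h ⊗ x`. -/
def tmulField (h : Hol U) (x : ExteriorAlgebra ℂ (ℂ × V)) : Superfield U V := h ⊗ₜ[ℂ] x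

theorem superfield_induction {C : Superfield U V → Prop} (f : Superfield U V)
    (h0 : C 0) (htmul : ∀ h x, C (tmulField h x)) (hadd : ∀ f g, C f → C g → C (f + g)) : C f :=
  TensorProduct.induction_on (motive := C) f h0 htmul hadd

theorem tmulField_mul (h k : Hol U) (x y : ExteriorAlgebra ℂ (ℂ × V)) :
    tmulField h x * tmulField k y = tmulField (h * k) (x * y) :=
  Algebra.TensorProduct.tmul_mul_tmul h k x y

theorem tmulField_add (h : Hol U) (x y : ExteriorAlgebra ℂ (ℂ × V)) :
    tmulField h (x + y) = tmulField h x + tmulField h y :=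
  TensorProduct.tmul_add h x y

theorem add_tmulField (h k : Hol U) (x : ExteriorAlgebra ℂ (ℂ × V)) :
    tmulField (h + k) x = tmulField h x + tmulField k x :=
  TensorProduct.add_tmul h k x

theorem tmulField_neg (h : Hol U) (x : ExteriorAlgebra ℂ (ℂ × V)) :
    tmulField h (-x) = -tmulField h x :=
  TensorProduct.tmul_neg h x

theorem tmulField_zero (h : Hol U) :
    tmulField h (0 : ExteriorAlgebra ℂ (ℂ × V)) = 0 :=
  TensorProduct.tmul_zero _ h

theorem zero_tmulField (x : ExteriorAlgebra ℂ (ℂ × V)) : tmulField (0 : Hol U) x = 0 :=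
  TensorProduct.zero_tmul _ x

theorem dX_tmulField (h : Hol U) (x : ExteriorAlgebra ℂ (ℂ × V)) :
    dX (tmulField h x) = tmulField (dirDeriv U (1, 0) h) x := rfl

theorem dT_tmulField (h : Hol U) (x : ExteriorAlgebra ℂ (ℂ × V)) :
    dT (tmulField h x) = tmulField (dirDeriv U (0, 1) h) x := rfl

theorem dVartheta_tmulField (h : Hol U) (x : ExteriorAlgebra ℂ (ℂ × V)) :
    dVartheta (tmulField h x) = tmulField h
      (CliffordAlgebra.contractLeft (Q := (0 : QuadraticForm ℂ (ℂ × V)))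
        (LinearMap.fst ℂ ℂ V) x) := rfl

theorem parity_tmulField (h : Hol U) (x : ExteriorAlgebra ℂ (ℂ × V)) :
    parity (tmulField h x) = tmulField h
      (CliffordAlgebra.involute (Q := (0 : QuadraticForm ℂ (ℂ × V))) x) := rfl

theorem dX_mul (f g : Superfield U V) : dX (f * g) = dX f * g + f * dX g := by
  induction f using superfield_induction with
  | h0 => simp
  | hadd f f' hf hf' => simp only [add_mul, map_add, hf, hf']; abel
  | htmul h x =>
    induction g using superfield_induction with
    | h0 => simp
    | hadd f f' hf hf' => simp only [mul_add, map_add, hf, hf']; abel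
    | htmul k y =>
      simp only [tmulField_mul, dX_tmulField, dirDeriv_mul, add_tmulField]

theorem dT_mul (f g : Superfield U V) : dT (f * g) = dT f * g + f * dT g := by
  induction f using superfield_induction with
  | h0 => simp
  | hadd f f' hf hf' => simp only [add_mul, map_add, hf, hf']; abel
  | htmul h x =>
    induction g using superfield_induction with
    | h0 => simp
    | hadd f f' hf hf' => simp only [mul_add, map_add, hf, hf']; abel
    | htmul k y =>
      simp only [tmulField_mul, dT_tmulField, dirDeriv_mul, add_tmulField]

theorem dVartheta_mul (f g : Superfield U V) :
    dVartheta (f * g) = dVartheta f * g + parity f * dVartheta g := by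
  induction f using superfield_induction with
  | h0 => simp
  | hadd f f' hf hf' => simp only [add_mul, map_add, hf, hf']; abel
  | htmul h x =>
    induction g using superfield_induction with
    | h0 => simp
    | hadd f f' hf hf' => simp only [mul_add, map_add, hf, hf']; abel
    | htmul k y =>
      simp only [tmulField_mul, dVartheta_tmulField, parity_tmulField, contractLeft_mul,
        tmulField_add]

theorem parity_mul (f g : Superfield U V) : parity (f * g) = parity f * parity g := by
  induction f using superfield_induction with
  | h0 => simp
  | hadd f f' hf hf' => simp only [add_mul, map_add, hf, hf']
  | htmul h x =>
    induction g using superfield_induction with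
    | h0 => simp
    | hadd f f' hf hf' => simp only [mul_add, map_add, hf, hf']
    | htmul k y => simp only [tmulField_mul, parity_tmulField, map_mul]

theorem one_eq_tmulField : (1 : Superfield U V) = tmulField 1 1 := rfl

theorem parity_one : parity (1 : Superfield U V) = 1 := by
  rw [one_eq_tmulField, parity_tmulField, map_one]

theorem vartheta_eq : (vartheta : Superfield U V) =
    tmulField 1 (ExteriorAlgebra.ι ℂ ((1, 0) : ℂ × V)) := rfl

theorem odd_generator_mul (v : ℂ × V) (f : Superfield U V) :
    tmulField 1 (ExteriorAlgebra.ι ℂ v) * f = parity f * tmulField 1 (ExteriorAlgebra.ι ℂ v) := by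
  induction f using superfield_induction with
  | h0 => simp
  | hadd f f' hf hf' => simp only [add_mul, mul_add, map_add, hf, hf']
  | htmul h x =>
    rw [parity_tmulField, tmulField_mul, tmulField_mul, one_mul, mul_one, ι_mul_eq_involute_mul]

theorem tmulField_one_mul (h : Hol U) (f : Superfield U V) :
    tmulField h 1 * f = f * tmulField h 1 := by
  induction f using superfield_induction with
  | h0 => simp
  | hadd f f' hf hf' => simp only [add_mul, mul_add, hf, hf']
  | htmul k x => rw [tmulField_mul, tmulField_mul, one_mul, mul_one, mul_comm]

theorem tmulField_eq_mul (h : Hol U) (x : ExteriorAlgebra ℂ (ℂ × V)) :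
    tmulField h x = tmulField h 1 * tmulField 1 x := by
  rw [tmulField_mul, mul_one, one_mul]

theorem parity_generator (v : ℂ × V) :
    parity (tmulField (1 : Hol U) (ExteriorAlgebra.ι ℂ v))
      = -tmulField 1 (ExteriorAlgebra.ι ℂ v) := by
  rw [parity_tmulField, ← tmulField_neg]
  exact congrArg _ (CliffordAlgebra.involute_ι v)

/-- Superfields are generated by the holomorphic functions and the odd generators. -/
theorem superfield_generator_induction {C : Superfield U V → Prop} (f : Superfield U V)
    (h0 : ∀ h, C (tmulField h 1)) (hι : ∀ v, C (tmulField 1 (ExteriorAlgebra.ι ℂ v)))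
    (hadd : ∀ f g, C f → C g → C (f + g)) (hmul : ∀ f g, C f → C g → C (f * g)) : C f := by
  induction f using superfield_induction with
  | h0 => rw [← zero_tmulField 1]; exact h0 0
  | hadd f f' hf hf' => exact hadd _ _ hf hf'
  | htmul h x =>
    rw [tmulField_eq_mul]
    refine hmul _ _ (h0 h) ?_
    induction x using ExteriorAlgebra.induction with
    | algebraMap r =>
      have : tmulField (1 : Hol U) (algebraMap ℂ (ExteriorAlgebra ℂ (ℂ × V)) r)
          = tmulField (r • 1) 1 := by
        rw [Algebra.algebraMap_eq_smul_one]
        exact (TensorProduct.smul_tmul r (1 : Hol U) (1 : ExteriorAlgebra ℂ (ℂ × V))).symm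
      rw [this]
      exact h0 _
    | ι v => exact hι v
    | mul a b ha hb =>
      rw [← one_mul (1 : Hol U), ← tmulField_mul]
      exact hmul _ _ ha hb
    | add a b ha hb =>
      rw [tmulField_add]
      exact hadd _ _ ha hb

/-- The elements that commute with `f` are closed under sums and products, so generators suffice: a
holomorphic function is central, and an odd generator passes `f` at the cost of `parity f`, which is
`f`. -/
theorem even_mul_comm {f : Superfield U V} (hf : parity f = f) (g : Superfield U V) :
    f * g = g * f := by
  induction g using superfield_generator_induction with
  | h0 h => rw [tmulField_one_mul]
  | hι v => rw [odd_generator_mul, hf]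
  | hadd a b ha hb => rw [mul_add, add_mul, ha, hb]
  | hmul a b ha hb => rw [← mul_assoc, ha, mul_assoc, hb, mul_assoc]

/-- Stated for arbitrary `g`, because in this form the relation passes to sums and products and can
be checked on generators. Anticommutation of two odd fields is a special case. -/
theorem odd_mul_eq_parity_mul {f : Superfield U V} (hf : parity f = -f) (g : Superfield U V) :
    f * g = parity g * f := by
  induction g using superfield_generator_induction with
  | h0 h => rw [← tmulField_one_mul, parity_tmulField, map_one]
  | hι v => rw [parity_generator, neg_mul, odd_generator_mul, hf, neg_mul, neg_neg]
  | hadd a b ha hb => rw [mul_add, map_add, add_mul, ha, hb]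
  | hmul a b ha hb => rw [← mul_assoc, ha, mul_assoc, hb, parity_mul, mul_assoc]

theorem parity_parity (f : Superfield U V) : parity (parity f) = f := by
  induction f using superfield_induction with
  | h0 => simp
  | hadd f f' hf hf' => simp only [map_add, hf, hf']
  | htmul h x => rw [parity_tmulField, parity_tmulField, CliffordAlgebra.involute_involute]

theorem dX_parity (f : Superfield U V) : dX (parity f) = parity (dX f) := by
  induction f using superfield_induction with
  | h0 => simp
  | hadd f f' hf hf' => simp only [map_add, hf, hf']
  | htmul h x => rfl

theorem dT_parity (f : Superfield U V) : dT (parity f) = parity (dT f) := by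
  induction f using superfield_induction with
  | h0 => simp
  | hadd f f' hf hf' => simp only [map_add, hf, hf']
  | htmul h x => rfl

theorem dVartheta_dX (f : Superfield U V) : dVartheta (dX f) = dX (dVartheta f) := by
  induction f using superfield_induction with
  | h0 => simp
  | hadd f f' hf hf' => simp only [map_add, hf, hf']
  | htmul h x => rfl

theorem dVartheta_dT (f : Superfield U V) : dVartheta (dT f) = dT (dVartheta f) := by
  induction f using superfield_induction with
  | h0 => simp
  | hadd f f' hf hf' => simp only [map_add, hf, hf']
  | htmul h x => rfl

theorem dT_dX (f : Superfield U V) : dT (dX f) = dX (dT f) := by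
  induction f using superfield_induction with
  | h0 => simp
  | hadd f f' hf hf' => simp only [map_add, hf, hf']
  | htmul h x => rw [dX_tmulField, dT_tmulField, dirDeriv_comm]; rfl

theorem dVartheta_parity (f : Superfield U V) : dVartheta (parity f) = -parity (dVartheta f) := by
  induction f using superfield_induction with
  | h0 => simp
  | hadd f f' hf hf' => simp only [map_add, hf, hf']; abel
  | htmul h x =>
    simp only [parity_tmulField, dVartheta_tmulField, contractLeft_involute, tmulField_neg]

theorem dVartheta_dVartheta (f : Superfield U V) : dVartheta (dVartheta f) = 0 := by
  induction f using superfield_induction with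
  | h0 => simp
  | hadd f f' hf hf' => simp only [map_add, hf, hf', add_zero]
  | htmul h x =>
    rw [dVartheta_tmulField, dVartheta_tmulField, CliffordAlgebra.contractLeft_contractLeft,
      tmulField_zero]

theorem dirDeriv_one (v : ℂ × ℂ) : dirDeriv U v (1 : Hol U) = 0 := by
  simpa using dirDeriv_mul v (1 : Hol U) 1

theorem dX_vartheta : dX (vartheta : Superfield U V) = 0 := by
  rw [vartheta_eq, dX_tmulField, dirDeriv_one, zero_tmulField]

theorem dT_vartheta : dT (vartheta : Superfield U V) = 0 := by
  rw [vartheta_eq, dT_tmulField, dirDeriv_one, zero_tmulField]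

theorem dVartheta_vartheta : dVartheta (vartheta : Superfield U V) = 1 := by
  rw [vartheta_eq, dVartheta_tmulField, one_eq_tmulField]
  refine congrArg _ ((CliffordAlgebra.contractLeft_ι (Q := (0 : QuadraticForm ℂ (ℂ × V)))
    (LinearMap.fst ℂ ℂ V) (1, 0)).trans ?_)
  simp

theorem parity_vartheta : parity (vartheta : Superfield U V) = -vartheta :=
  parity_generator _

theorem vartheta_mul (f : Superfield U V) : vartheta * f = parity f * vartheta :=
  odd_generator_mul _ f

theorem vartheta_mul_vartheta : (vartheta : Superfield U V) * vartheta = 0 := by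
  rw [vartheta_eq, tmulField_mul, ExteriorAlgebra.ι_sq_zero, tmulField_zero]

theorem superD_apply (f : Superfield U V) : superD f = dVartheta f + vartheta * dX f := rfl

/-- The squares of `∂/∂ϑ` and of `ϑ` vanish, and the mixed terms leave `(∂ϑ/∂ϑ)∂ = ∂`. -/
theorem superD_superD (f : Superfield U V) : superD (superD f) = dX f := by
  simp only [superD_apply, map_add, dVartheta_dVartheta, dVartheta_mul, dVartheta_vartheta,
    parity_vartheta, dX_mul, dX_vartheta, dVartheta_dX, mul_add, ← mul_assoc,
    vartheta_mul_vartheta, zero_mul, mul_zero]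
  simp

theorem superD_mul (f g : Superfield U V) :
    superD (f * g) = superD f * g + parity f * superD g := by
  simp only [superD_apply, dVartheta_mul, dX_mul, mul_add, add_mul, ← mul_assoc, ← vartheta_mul]
  abel

theorem superD_parity (f : Superfield U V) : superD (parity f) = -parity (superD f) := by
  simp only [superD_apply, dVartheta_parity, dX_parity, map_add, parity_mul, parity_vartheta]
  simp only [neg_mul, neg_add, neg_neg]

theorem dT_superD (f : Superfield U V) : dT (superD f) = superD (dT f) := by
  simp only [superD_apply, map_add, dT_mul, dT_vartheta, zero_mul, zero_add, dT_dX, dVartheta_dT]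

instance : SuperDiffAlgebra (Superfield U V) where
  par := AlgHom.ofLinearMap parity parity_one parity_mul
  D := superD
  dt := dT
  par_par := parity_parity
  D_mul := superD_mul
  D_par := superD_parity
  dt_mul := dT_mul
  dt_par := dT_parity
  dt_D := dT_superD
  even_comm _ b ha := even_mul_comm ha b
  odd_anticomm a b ha hb := by
    have := odd_mul_eq_parity_mul ha b
    rwa [show parity b = -b from hb, neg_mul] at this

end Instance

/-! ### Differential operators in `D` and their orders -/

section Operators

variable {A : Type*} [Ring A] [Algebra ℂ A] [SuperDiffAlgebra A]

open SuperDiffAlgebra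

/-- The even derivation `D ^ 2`. -/
def dx : A →ₗ[ℂ] A := D ∘ₗ D

theorem dx_apply (a : A) : dx a = D (D a) := rfl

theorem par_D (a : A) : par (D a) = -D (par a) := by rw [D_par, neg_neg]

theorem dx_mul (a b : A) : dx (a * b) = dx a * b + a * dx b := by
  simp only [dx_apply, D_mul, map_add, par_D, par_par, neg_mul]
  abel

theorem par_dx (a : A) : par (dx a) = dx (par a) := by
  rw [dx_apply, par_D, par_D, map_neg, neg_neg, dx_apply]

theorem D_one : D (1 : A) = 0 := by
  have := D_mul (1 : A) 1
  simpa using this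

theorem dx_one : dx (1 : A) = 0 := by rw [dx_apply, D_one, map_zero]

variable (A) in
/-- The ring in which differential operators are composed. An operator is recorded by its action
on formal symbols `∑ fᵢ Dⁱ`, which determines its coefficients, and by its action on `A`. -/
def Op : Type _ := Module.End ℂ (ℕ → A) × Module.End ℂ A

instance : Ring (Op A) := inferInstanceAs (Ring (Module.End ℂ (ℕ → A) × Module.End ℂ A))

/-- Multiplication by `a`. -/
def mulOp : A →+* Op A where
  toFun a := (LinearMap.pi fun i => LinearMap.mulLeft ℂ a ∘ₗ LinearMap.proj i,
    LinearMap.mulLeft ℂ a)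
  map_one' := Prod.ext (LinearMap.ext fun f => funext fun i => one_mul (f i))
    (LinearMap.ext fun f => one_mul f)
  map_mul' a b := Prod.ext (LinearMap.ext fun f => funext fun i => mul_assoc a b (f i))
    (LinearMap.ext fun f => mul_assoc a b f)
  map_zero' := Prod.ext (LinearMap.ext fun f => funext fun i => zero_mul (f i))
    (LinearMap.ext fun f => zero_mul f)
  map_add' a b := Prod.ext (LinearMap.ext fun f => funext fun i => add_mul a b (f i))
    (LinearMap.ext fun f => add_mul a b f)

theorem mulOp_fst (a : A) (f : ℕ → A) (i : ℕ) : (mulOp a).1 f i = a * f i := rfl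

variable (A) in
/-- The operator `D`. -/
def dOp : Op A :=
  -- Since `D ∘ f Dⁱ = (D f) Dⁱ + par(f) Dⁱ⁺¹`, the new coefficient at `i` also receives the parity
  -- image of the old one at `i - 1`.
  ({ toFun := fun f i => D (f i) + Nat.casesOn i 0 fun j => par (f j)
     map_add' := fun f g => by
      funext i
      cases i with
      | zero => simp
      | succ i => simp only [Pi.add_apply, map_add]; abel
     map_smul' := fun c f => by
      funext i
      cases i <;> simp }, D)

theorem dOp_fst_zero (f : ℕ → A) : (dOp A).1 f 0 = D (f 0) := add_zero _

theorem dOp_fst_succ (f : ℕ → A) (i : ℕ) : (dOp A).1 f (i + 1) = D (f (i + 1)) + par (f i) := rfl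

variable (A) in
/-- The operator `∂ₜ`. -/
def dtOp : Op A := (LinearMap.pi fun i => dt ∘ₗ LinearMap.proj i, dt)

theorem dtOp_fst (f : ℕ → A) (i : ℕ) : (dtOp A).1 f i = dt (f i) := rfl

theorem dOp_mul_mulOp (a : A) : dOp A * mulOp a = mulOp (D a) + mulOp (par a) * dOp A := by
  refine Prod.ext (LinearMap.ext fun f => funext fun i => ?_) (LinearMap.ext fun f => D_mul a f)
  change (dOp A).1 ((mulOp a).1 f) i = D a * f i + par a * (dOp A).1 f i
  cases i with
  | zero => rw [dOp_fst_zero, dOp_fst_zero, mulOp_fst, D_mul]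
  | succ i => rw [dOp_fst_succ, dOp_fst_succ, mulOp_fst, mulOp_fst, D_mul, map_mul, mul_add,
      add_assoc]

theorem dtOp_mul_mulOp (a : A) : dtOp A * mulOp a = mulOp (dt a) + mulOp a * dtOp A :=
  Prod.ext (LinearMap.ext fun f => funext fun i => dt_mul a (f i))
    (LinearMap.ext fun f => dt_mul a f)

theorem dtOp_mul_dOp : dtOp A * dOp A = dOp A * dtOp A := by
  refine Prod.ext (LinearMap.ext fun f => funext fun i => ?_) (LinearMap.ext fun f => dt_D f)
  change dt ((dOp A).1 f i) = (dOp A).1 ((dtOp A).1 f) i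
  cases i with
  | zero => rw [dOp_fst_zero, dOp_fst_zero, dtOp_fst, dt_D]
  | succ i => rw [dOp_fst_succ, dOp_fst_succ, dtOp_fst, dtOp_fst, map_add, dt_D, dt_par]

/-- The coefficient of `Dⁱ`. -/
def coef (i : ℕ) : Op A →+ A where
  -- `Pi.single 0 1` is the symbol of the identity, so a differential operator applied to it returns
  -- its own symbol.
  toFun P := P.1 (Pi.single 0 1) i
  map_zero' := rfl
  map_add' _ _ := rfl

theorem coef_mulOp_mul (i : ℕ) (a : A) (P : Op A) : coef i (mulOp a * P) = a * coef i P := rfl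

theorem dOp_fst_single (j : ℕ) :
    (dOp A).1 (Pi.single j 1 : ℕ → A) = Pi.single (j + 1) 1 := by
  funext i
  cases i with
  | zero =>
    rw [dOp_fst_zero, Pi.single_apply, Pi.single_apply]
    split_ifs <;> simp_all [D_one]
  | succ i =>
    rw [dOp_fst_succ, Pi.single_apply, Pi.single_apply, Pi.single_apply]
    split_ifs <;> simp_all [D_one]

theorem coef_dOp_pow (i j : ℕ) : coef i (dOp A ^ j) = if i = j then 1 else 0 := by
  have h : (dOp A ^ j).1 (Pi.single 0 1 : ℕ → A) = Pi.single j 1 := by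
    induction j with
    | zero => rfl
    | succ j ih =>
      rw [pow_succ']
      change (dOp A).1 ((dOp A ^ j).1 (Pi.single 0 1)) = _
      rw [ih, dOp_fst_single]
  change (dOp A ^ j).1 (Pi.single 0 1) i = _
  rw [h, Pi.single_apply]

theorem coef_monomial (i j : ℕ) (a : A) :
    coef i (mulOp a * dOp A ^ j) = if i = j then a else 0 := by
  rw [coef_mulOp_mul, coef_dOp_pow]
  split_ifs <;> simp

variable (A) in
/-- The differential operators of order less than `n`. -/
def orderLT (n : ℕ) : AddSubgroup (Op A) :=
  AddSubgroup.closure {P | ∃ a : A, ∃ i < n, P = mulOp a * dOp A ^ i}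

theorem monomial_mem {n i : ℕ} (a : A) (h : i < n) : mulOp a * dOp A ^ i ∈ orderLT A n :=
  AddSubgroup.subset_closure ⟨a, i, h, rfl⟩

theorem mulOp_mem {n : ℕ} (a : A) (h : 0 < n) : mulOp a ∈ orderLT A n := by
  simpa using monomial_mem a h

theorem dOp_pow_mem {n i : ℕ} (h : i < n) : dOp A ^ i ∈ orderLT A n := by
  simpa using monomial_mem (1 : A) h

theorem orderLT_induction {n : ℕ} {C : (P : Op A) → P ∈ orderLT A n → Prop}
    (monomial : ∀ (a : A) (i : ℕ) (hi : i < n), C (mulOp a * dOp A ^ i) (monomial_mem a hi))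
    (zero : C 0 (zero_mem _))
    (add : ∀ P Q hP hQ, C P hP → C Q hQ → C (P + Q) (add_mem hP hQ))
    {P : Op A} (hP : P ∈ orderLT A n) : C P hP := by
  refine AddSubgroup.closure_induction'' (p := C) ?_ ?_ zero
    (fun P Q hP hQ => add P Q hP hQ) hP
  · rintro _ ⟨a, i, hi, rfl⟩
    exact monomial a i hi
  · rintro _ ⟨a, i, hi, rfl⟩
    -- The negative of a monomial is again a monomial. The predicate depends on the membership
    -- proof, hence the detour through a general `Q`.
    have key : ∀ Q (hQ : Q ∈ orderLT A n), Q = mulOp (-a) * dOp A ^ i → C Q hQ := by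
      rintro _ _ rfl
      exact monomial (-a) i hi
    exact key _ _ (by rw [map_neg, neg_mul])

theorem orderLT_mono {m n : ℕ} (h : m ≤ n) : orderLT A m ≤ orderLT A n :=
  AddSubgroup.closure_mono fun _ ⟨a, i, hi, hP⟩ => ⟨a, i, hi.trans_le h, hP⟩

theorem mem_orderLT_zero {P : Op A} (h : P ∈ orderLT A 0) : P = 0 := by
  induction h using orderLT_induction with
  | monomial a i hi => exact absurd hi (Nat.not_lt_zero i)
  | zero => rfl
  | add P Q hP hQ h1 h2 => rw [h1, h2, add_zero]

theorem mulOp_mul_mem {n : ℕ} (a : A) {P : Op A} (h : P ∈ orderLT A n) :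
    mulOp a * P ∈ orderLT A n := by
  induction h using orderLT_induction with
  | monomial b i hi =>
    rw [← mul_assoc, ← map_mul]
    exact monomial_mem _ hi
  | zero => rw [mul_zero]; exact zero_mem _
  | add P Q hP hQ h1 h2 => rw [mul_add]; exact add_mem h1 h2

theorem dOp_mul_mem {n : ℕ} {P : Op A} (h : P ∈ orderLT A n) : dOp A * P ∈ orderLT A (n + 1) := by
  induction h using orderLT_induction with
  | monomial b i hi =>
    rw [← mul_assoc, dOp_mul_mulOp, add_mul, mul_assoc, ← pow_succ']
    exact add_mem (monomial_mem _ (by omega)) (monomial_mem _ (by omega))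
  | zero => rw [mul_zero]; exact zero_mem _
  | add P Q hP hQ h1 h2 => rw [mul_add]; exact add_mem h1 h2

theorem dOp_pow_mul_mem {n : ℕ} (k : ℕ) {P : Op A} (h : P ∈ orderLT A n) :
    dOp A ^ k * P ∈ orderLT A (n + k) := by
  induction k with
  | zero => simpa using h
  | succ k ih => rw [pow_succ', mul_assoc]; exact dOp_mul_mem ih

theorem mul_dOp_pow_mem {n : ℕ} (k : ℕ) {P : Op A} (h : P ∈ orderLT A n) :
    P * dOp A ^ k ∈ orderLT A (n + k) := by
  induction h using orderLT_induction with
  | monomial b i hi =>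
    rw [mul_assoc, ← pow_add]
    exact monomial_mem _ (by omega)
  | zero => rw [zero_mul]; exact zero_mem _
  | add P Q hP hQ h1 h2 => rw [add_mul]; exact add_mem h1 h2

/-- The orders of operators add up under composition. -/
theorem mul_mem_orderLT {m n l : ℕ} (hl : m + n ≤ l + 1) {P Q : Op A} (hP : P ∈ orderLT A m)
    (hQ : Q ∈ orderLT A n) : P * Q ∈ orderLT A l := by
  induction hP using orderLT_induction with
  | monomial a i hi =>
    rw [mul_assoc]
    exact orderLT_mono (by omega) (mulOp_mul_mem a (dOp_pow_mul_mem i hQ))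
  | zero => rw [zero_mul]; exact zero_mem _
  | add P Q hP hQ h1 h2 => rw [add_mul]; exact add_mem h1 h2

theorem coef_eq_zero {n i : ℕ} (h : n ≤ i) {P : Op A} (hP : P ∈ orderLT A n) : coef i P = 0 := by
  induction hP using orderLT_induction with
  | monomial a j hj => rw [coef_monomial, if_neg (by omega)]
  | zero => rw [map_zero]
  | add P Q hP hQ h1 h2 => rw [map_add, h1, h2, add_zero]

theorem sub_leading_mem {n : ℕ} {P : Op A} (hP : P ∈ orderLT A (n + 1)) :
    P - mulOp (coef n P) * dOp A ^ n ∈ orderLT A n := by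
  induction hP using orderLT_induction with
  | monomial a i hi =>
    rw [coef_monomial]
    split_ifs with h
    · rw [h, sub_self]; exact zero_mem _
    · rw [map_zero, zero_mul, sub_zero]
      exact monomial_mem _ (by omega)
  | zero => rw [map_zero, map_zero, zero_mul, sub_zero]; exact zero_mem _
  | add P Q hP hQ h1 h2 =>
    have := add_mem h1 h2
    rwa [sub_add_sub_comm, ← add_mul, ← map_add, ← map_add] at this

theorem eq_sum_coef {n : ℕ} {P : Op A} (hP : P ∈ orderLT A n) :
    P = ∑ i ∈ Finset.range n, mulOp (coef i P) * dOp A ^ i := by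
  induction hP using orderLT_induction with
  | monomial a i hi =>
    rw [Finset.sum_eq_single i]
    · rw [coef_monomial, if_pos rfl]
    · intro j _ hj
      rw [coef_monomial, if_neg hj, map_zero, zero_mul]
    · intro h
      exact absurd (Finset.mem_range.2 hi) h
  | zero => simp
  | add P Q hP hQ h1 h2 =>
    simp only [map_add, add_mul, Finset.sum_add_distrib]
    rw [← h1, ← h2]

theorem mem_of_leading_eq_zero {n : ℕ} {P : Op A} (hP : P ∈ orderLT A (n + 1))
    (h : coef n P = 0) : P ∈ orderLT A n := by
  simpa [h] using sub_leading_mem hP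

theorem eq_zero_of_monomial_mem {n : ℕ} {a : A} (h : mulOp a * dOp A ^ n ∈ orderLT A n) :
    a = 0 := by
  simpa [coef_monomial] using coef_eq_zero le_rfl h

theorem mem_of_monic {n : ℕ} {T : Op A} (hT : T - dOp A ^ n ∈ orderLT A n) :
    T ∈ orderLT A (n + 1) := by
  simpa using add_mem (orderLT_mono n.le_succ hT) (dOp_pow_mem n.lt_succ_self)

/-- Monic operators may be cancelled on the right. -/
theorem eq_zero_of_mul_monic {m n : ℕ} {P T : Op A} (hT : T - dOp A ^ n ∈ orderLT A n)
    (hP : P ∈ orderLT A m) (h : P * T = 0) : P = 0 := by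
  induction m with
  | zero => exact mem_orderLT_zero hP
  | succ m ih =>
    -- As `T` is monic, the leading coefficient of `P * T` is that of `P`. It vanishes, so the order
    -- of `P` can be lowered.
    refine ih (mem_of_leading_eq_zero hP (eq_zero_of_monomial_mem (n := m + n) ?_))
    have h1 := mul_mem_orderLT (l := m + n) (by omega) (sub_leading_mem hP) (mem_of_monic hT)
    have h2 := mulOp_mul_mem (coef m P) (dOp_pow_mul_mem m hT)
    rw [add_comm n m] at h2
    have h3 := neg_mem (add_mem h1 h2)
    rw [sub_mul, h, mul_sub, mul_sub, ← pow_add, ← mul_assoc] at h3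
    simpa using h3

theorem dx_mul_mulOp (a : A) : dOp A ^ 2 * mulOp a = mulOp (dx a) + mulOp a * dOp A ^ 2 := by
  rw [pow_two, mul_assoc, dOp_mul_mulOp, mul_add, dOp_mul_mulOp, ← mul_assoc, dOp_mul_mulOp,
    par_D, par_par, add_mul, mul_assoc, dx_apply, map_neg]
  noncomm_ring

/-- `∂` is an even derivation that commutes with `D`, so the bracket merely differentiates the
coefficients and does not raise the order. -/
theorem dx_comm_mem {n : ℕ} {P : Op A} (hP : P ∈ orderLT A n) :
    dOp A ^ 2 * P - P * dOp A ^ 2 ∈ orderLT A n := by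
  induction hP using orderLT_induction with
  | monomial a i hi =>
    rw [← mul_assoc, dx_mul_mulOp, add_mul, mul_assoc, mul_assoc, ← pow_add, ← pow_add,
      add_comm 2 i, add_sub_cancel_right]
    exact monomial_mem _ hi
  | zero => rw [mul_zero, zero_mul, sub_zero]; exact zero_mem _
  | add P Q hP hQ h1 h2 =>
    rw [mul_add, add_mul, add_sub_add_comm]
    exact add_mem h1 h2

end Operators

/-! ### The Lax pair and its dressing -/

section Lax

variable {A : Type*} [Ring A] [Algebra ℂ A] [SuperDiffAlgebra A]

open SuperDiffAlgebra

/-- The first order operator `a D + b`. -/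
def firstOrder (a b : A) : Op A := mulOp a * dOp A + mulOp b

/-- The Lax operator `L = ∂² + α D + u`. -/
def laxL (α u : A) : Op A := dOp A ^ 4 + firstOrder α u

/-- Four times the evolution operator `M = ∂³ + 3/2 K ∂ + 3/4 [∂, K]`, where `K = α D + u`. -/
def laxM (α u : A) : Op A :=
  4 * dOp A ^ 6 + 6 * (firstOrder α u * dOp A ^ 2)
    + 3 * (dOp A ^ 2 * firstOrder α u - firstOrder α u * dOp A ^ 2)

theorem firstOrder_mem (a b : A) : firstOrder a b ∈ orderLT A 2 :=
  add_mem (by simpa using monomial_mem (n := 2) (i := 1) a (by omega)) (mulOp_mem b (by omega))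

theorem firstOrder_inj {a b : A} (h : firstOrder a b = 0) : a = 0 ∧ b = 0 := by
  have h1 := congrArg (coef 1) h
  have h0 := congrArg (coef 0) h
  have e1 (i : ℕ) : coef i (mulOp a * dOp A) = if i = 1 then a else 0 := by
    simpa using coef_monomial i 1 a
  have e0 (i : ℕ) : coef i (mulOp b) = if i = 0 then b else 0 := by
    simpa using coef_monomial i 0 b
  simp only [firstOrder, map_add, e1, e0, map_zero] at h0 h1
  simpa using And.intro h1 h0

theorem dx_comm_firstOrder (a b : A) :
    dOp A ^ 2 * firstOrder a b - firstOrder a b * dOp A ^ 2 = firstOrder (dx a) (dx b) := by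
  have h : dOp A * dOp A ^ 2 = dOp A ^ 2 * dOp A := by rw [← pow_succ, ← pow_succ']
  rw [firstOrder, mul_add, ← mul_assoc, dx_mul_mulOp, dx_mul_mulOp, firstOrder]
  simp only [add_mul, mul_assoc, h]
  abel

theorem odd_mul_self {a : A} (ha : par a = -a) : a * a = 0 := by
  have h : a * a = -(a * a) := odd_anticomm a a ha ha
  have h2 : (2 : ℂ) • (a * a) = 0 := by rw [two_smul]; nth_rw 1 [h]; abel
  exact (smul_eq_zero.1 h2).resolve_left two_ne_zero

/-- The term of second order would be `-α² D²`, and `α² = 0` for odd `α`. That the square stays of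
first order is needed both for the Lax commutator and for the comparison of `M²` with `16 L³`. -/
theorem firstOrder_sq {α u : A} (hα : par α = -α) (hu : par u = u) :
    firstOrder α u * firstOrder α u
      = firstOrder (α * D α + 2 * (α * u)) (α * D u + u ^ 2) := by
  have h1 : mulOp u * mulOp α = mulOp α * mulOp u := by
    rw [← map_mul, even_comm u α hu, map_mul]
  have h2 : mulOp α * mulOp α = 0 := by rw [← map_mul, odd_mul_self hα, map_zero]
  have e1 : mulOp α * dOp A * (mulOp α * dOp A) = mulOp α * mulOp (D α) * dOp A := by
    rw [mul_assoc, ← mul_assoc (dOp A), dOp_mul_mulOp, hα, map_neg, ← mul_assoc, mul_add, neg_mul,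
      mul_neg, ← mul_assoc (mulOp α) (mulOp α), h2, zero_mul, neg_zero, add_zero]
  have e2 : mulOp α * dOp A * mulOp u
      = mulOp α * mulOp (D u) + mulOp α * mulOp u * dOp A := by
    rw [mul_assoc, dOp_mul_mulOp, hu, mul_add, mul_assoc]
  have e3 : mulOp u * (mulOp α * dOp A) = mulOp α * mulOp u * dOp A := by
    rw [← mul_assoc, h1]
  simp only [firstOrder, mul_add, add_mul, map_add, map_mul, e1, e2, e3,
    pow_two, two_mul]
  abel

/-- The computation for the KdV equation works verbatim with an operator-valued potential: for any
`X` and `K`, the commutator of `4X³ + 6KX + 3[X, K]` with `X² + K` is `[X, [X, [X, K]]] + 3[X, K²]`.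
For `X = ∂` the outer brackets differentiate coefficients, and `K²` is of first order by
`firstOrder_sq`. -/
theorem laxM_comm_laxL (α u : A) (hα : par α = -α) (hu : par u = u) :
    laxM α u * laxL α u - laxL α u * laxM α u
      = firstOrder (dx (dx (dx α) + 3 * (α * D α + 2 * (α * u))))
          (dx (dx (dx u) + 3 * (α * D u + u ^ 2))) := by
  have key (X K : Op A) : (4 * X ^ 3 + 6 * (K * X) + 3 * (X * K - K * X)) * (X ^ 2 + K)
      - (X ^ 2 + K) * (4 * X ^ 3 + 6 * (K * X) + 3 * (X * K - K * X))
      = (X * (X * (X * K - K * X) - (X * K - K * X) * X)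
          - (X * (X * K - K * X) - (X * K - K * X) * X) * X)
        + 3 * (X * (K * K) - (K * K) * X) := by
    noncomm_ring
  have h := key (dOp A ^ 2) (firstOrder α u)
  rw [← pow_mul, ← pow_mul, dx_comm_firstOrder, dx_comm_firstOrder, dx_comm_firstOrder,
    firstOrder_sq hα hu, dx_comm_firstOrder] at h
  rw [laxM, laxL, dx_comm_firstOrder]
  refine h.trans ?_
  have h3 (a b : A) : 3 * firstOrder a b = firstOrder (3 * a) (3 * b) := by
    simp only [firstOrder, map_mul, map_ofNat, mul_add, mul_assoc]
  have hd (a : A) : dx (3 * a) = 3 * dx a := by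
    rw [show (3 : A) * a = a + a + a by noncomm_ring, map_add, map_add]; noncomm_ring
  have hd' (a b : A) : dx (a + 3 * b) = dx a + 3 * dx b := by rw [map_add, hd]
  rw [h3, hd', hd']
  simp only [firstOrder, map_add, add_mul]
  abel

theorem dtOp_comm_firstOrder (a b : A) :
    dtOp A * firstOrder a b - firstOrder a b * dtOp A = firstOrder (dt a) (dt b) := by
  rw [firstOrder, mul_add, ← mul_assoc, dtOp_mul_mulOp, dtOp_mul_mulOp, firstOrder]
  simp only [add_mul, mul_assoc, dtOp_mul_dOp]
  abel

theorem dtOp_mul_dOp_pow (n : ℕ) : dtOp A * dOp A ^ n = dOp A ^ n * dtOp A :=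
  Commute.pow_right (dtOp_mul_dOp (A := A)) n

theorem dtOp_comm_laxL (α u : A) :
    dtOp A * laxL α u - laxL α u * dtOp A = firstOrder (dt α) (dt u) := by
  rw [laxL, mul_add, add_mul, dtOp_mul_dOp_pow, add_sub_add_left_eq_sub, dtOp_comm_firstOrder]

theorem lax_commutator (α u : A) (hα : par α = -α) (hu : par u = u) :
    (4 * dtOp A - laxM α u) * laxL α u - laxL α u * (4 * dtOp A - laxM α u)
      = firstOrder (4 * dt α - dx (dx (dx α) + 3 * (α * D α + 2 * (α * u))))
          (4 * dt u - dx (dx (dx u) + 3 * (α * D u + u ^ 2))) := by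
  have h1 := dtOp_comm_laxL α u
  have h2 := laxM_comm_laxL α u hα hu
  calc _ = 4 * (dtOp A * laxL α u - laxL α u * dtOp A)
      - (laxM α u * laxL α u - laxL α u * laxM α u) := by noncomm_ring
    _ = _ := by
      rw [h1, h2]
      simp only [firstOrder, map_sub, map_mul, map_ofNat, mul_add, sub_mul, mul_assoc]
      abel

/-- The Lax representation of the Manin-Radul system. -/
theorem lax_eq_zero_iff {α u : A} (hα : par α = -α) (hu : par u = u) :
    (4 * dtOp A - laxM α u) * laxL α u - laxL α u * (4 * dtOp A - laxM α u) = 0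
      ↔ 4 * dt α = dx (dx (dx α) + 3 * (α * D α + 2 * (α * u)))
        ∧ 4 * dt u = dx (dx (dx u) + 3 * (α * D u + u ^ 2)) := by
  rw [lax_commutator α u hα hu]
  refine ⟨fun h => ?_, fun ⟨h1, h2⟩ => ?_⟩
  · obtain ⟨h1, h2⟩ := firstOrder_inj h
    exact ⟨sub_eq_zero.1 h1, sub_eq_zero.1 h2⟩
  · rw [h1, h2, sub_self, sub_self, firstOrder, map_zero, zero_mul, add_zero]

theorem nat_mul_mem {n : ℕ} (m : ℕ) {P : Op A} (h : P ∈ orderLT A n) :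
    (m : Op A) * P ∈ orderLT A n := by
  rw [← nsmul_eq_mul]
  exact nsmul_mem h m

theorem ofNat_mul_mem {n : ℕ} (m : ℕ) [m.AtLeastTwo] {P : Op A} (h : P ∈ orderLT A n) :
    (OfNat.ofNat m : Op A) * P ∈ orderLT A n := nat_mul_mem m h

/-- `M` is a square root of `L³` up to lower order terms. -/
theorem laxM_sq_sub_mem (α u : A) (hα : par α = -α) (hu : par u = u) :
    laxM α u * laxM α u - 16 * laxL α u ^ 3 ∈ orderLT A 6 := by
  -- In `M² - 16 L³` the `X⁶` terms cancel, and the surviving terms linear in `K` contain at least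
  -- two brackets with `X` and at most the factor `X²`. The others have at least two factors of
  -- first order and at most two factors `X`, and `K²` has itself first order. Hence every term has
  -- order less than 6 in `D`.
  have key (X K K1 K2 K3 K4 : Op A) (h1 : X * K - K * X = K1) (h2 : X * K1 - K1 * X = K2)
      (h3 : X * K2 - K2 * X = K3) (h4 : X * K3 - K3 * X = K4) :
      (4 * X ^ 3 + 6 * (K * X) + 3 * K1) * (4 * X ^ 3 + 6 * (K * X) + 3 * K1)
        - 16 * (X ^ 2 + K) ^ 3
      = 4 * (-(K2 * X ^ 2)) + 4 * (-(K3 * X)) + 4 * (-K4)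
        + 4 * ((K * K) * X ^ 2) + 22 * ((K * K1) * X) + 2 * (K * K2) + 18 * ((K1 * K) * X)
        + 9 * (K1 * K1) + 16 * (-(X ^ 2 * (K * K))) + 16 * (-((K * K) * K)) := by
    subst h1 h2 h3 h4
    noncomm_ring
  have h := key (dOp A ^ 2) (firstOrder α u) _ _ _ _ (dx_comm_firstOrder _ _)
    (dx_comm_firstOrder _ _) (dx_comm_firstOrder _ _) (dx_comm_firstOrder _ _)
  rw [← pow_mul, ← pow_mul] at h
  rw [laxM, laxL, dx_comm_firstOrder, h, firstOrder_sq hα hu]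
  have hf (a b : A) := firstOrder_mem a b
  have hff (a b a' b' : A) : firstOrder a b * firstOrder a' b' ∈ orderLT A 3 :=
    mul_mem_orderLT (by omega) (hf a b) (hf a' b')
  refine add_mem (add_mem (add_mem (add_mem (add_mem (add_mem (add_mem (add_mem (add_mem
    ?_ ?_) ?_) ?_) ?_) ?_) ?_) ?_) ?_) ?_ <;> refine ofNat_mul_mem _ ?_
  · exact neg_mem (mul_dOp_pow_mem 4 (hf _ _))
  · exact neg_mem (orderLT_mono (by omega) (mul_dOp_pow_mem 2 (hf _ _)))
  · exact neg_mem (orderLT_mono (by omega) (hf _ _))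
  · exact mul_dOp_pow_mem 4 (hf _ _)
  · exact orderLT_mono (by omega) (mul_dOp_pow_mem 2 (hff _ _ _ _))
  · exact orderLT_mono (by omega) (hff _ _ _ _)
  · exact orderLT_mono (by omega) (mul_dOp_pow_mem 2 (hff _ _ _ _))
  · exact orderLT_mono (by omega) (hff _ _ _ _)
  · exact neg_mem (dOp_pow_mul_mem 4 (hf _ _))
  · exact neg_mem (orderLT_mono (by omega) (hff _ _ _ _))

theorem laxM_sub_mem (α u : A) : laxM α u - 4 * dOp A ^ 6 ∈ orderLT A 4 := by
  rw [laxM, dx_comm_firstOrder, add_assoc, add_sub_cancel_left]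
  exact add_mem (ofNat_mul_mem _ (mul_dOp_pow_mem 2 (firstOrder_mem _ _)))
    (ofNat_mul_mem _ (orderLT_mono (by omega) (firstOrder_mem _ _)))

theorem laxM_mem (α u : A) : laxM α u ∈ orderLT A 7 := by
  have h : 4 * dOp A ^ 6 ∈ orderLT A 7 := ofNat_mul_mem _ (dOp_pow_mem (by omega))
  simpa using add_mem (orderLT_mono (by omega) (laxM_sub_mem α u)) h

/-- Both `M` and `M'` begin with `4D⁶`, and `D⁶` commutes with `Y` up to lower order. If `y` is the
leading coefficient of `Y`, that of `M'Y + YM` is therefore `8y`; with the plus sign nothing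
cancels. A bound on the order of this sum thus bounds that of `Y`, by induction on the excess `j`.
-/
theorem mem_of_laxM_add_mem {α u α' u' : A} {n : ℕ} (j : ℕ) {Y : Op A}
    (hY : Y ∈ orderLT A (n + j)) (h : laxM α' u' * Y + Y * laxM α u ∈ orderLT A (n + 6)) :
    Y ∈ orderLT A n := by
  induction j with
  | zero => exact hY
  | succ j ih =>
    refine ih (mem_of_leading_eq_zero hY ?_)
    set y := coef (n + j) Y
    have h1 : (laxM α' u' - 4 * dOp A ^ 6) * Y ∈ orderLT A (n + j + 6) :=
      mul_mem_orderLT (by omega) (laxM_sub_mem α' u') hY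
    have h2 : Y * (laxM α u - 4 * dOp A ^ 6) ∈ orderLT A (n + j + 6) :=
      mul_mem_orderLT (by omega) hY (laxM_sub_mem α u)
    have h3 : dOp A ^ 6 * Y - Y * dOp A ^ 6 ∈ orderLT A (n + j + 6) := by
      have hc := dx_comm_mem hY
      have key (X Y : Op A) : X ^ 3 * Y - Y * X ^ 3 = (X * Y - Y * X) * X ^ 2
          + X * ((X * Y - Y * X) * X) + X ^ 2 * (X * Y - Y * X) := by noncomm_ring
      have h' := key (dOp A ^ 2) Y
      rw [← pow_mul, ← pow_mul] at h'
      rw [h']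
      refine add_mem (add_mem ?_ ?_) ?_
      · exact orderLT_mono (by omega) (mul_dOp_pow_mem 4 hc)
      · exact orderLT_mono (by omega) (dOp_pow_mul_mem 2 (mul_dOp_pow_mem 2 hc))
      · exact orderLT_mono (by omega) (dOp_pow_mul_mem 4 hc)
    have h4 : (Y - mulOp y * dOp A ^ (n + j)) * dOp A ^ 6 ∈ orderLT A (n + j + 6) :=
      mul_dOp_pow_mem 6 (sub_leading_mem hY)
    rw [sub_mul, mul_assoc, ← pow_add] at h4
    have h5 : mulOp (8 * y) * dOp A ^ (n + j + 6) ∈ orderLT A (n + j + 6) := by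
      have h6 := orderLT_mono (show n + 6 ≤ n + j + 6 by omega) h
      have e : mulOp (8 * y) * dOp A ^ (n + j + 6) = (laxM α' u' * Y + Y * laxM α u)
          - (laxM α' u' - 4 * dOp A ^ 6) * Y - Y * (laxM α u - 4 * dOp A ^ 6)
          - 4 * (dOp A ^ 6 * Y - Y * dOp A ^ 6)
          - 8 * (Y * dOp A ^ 6 - mulOp y * dOp A ^ (n + j + 6)) := by
        rw [map_mul, map_ofNat]
        noncomm_ring
      rw [e]
      exact sub_mem (sub_mem (sub_mem (sub_mem h6 h1) h2) (ofNat_mul_mem _ h3))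
        (ofNat_mul_mem _ h4)
    have h7 := eq_zero_of_monomial_mem h5
    have h8 : (8 : ℂ) • y = 0 := by
      rw [← h7, Algebra.smul_def, map_ofNat]
    exact (smul_eq_zero.1 h8).resolve_left (by norm_num)

/-- Counting orders places `Y = M'T - TM` only in `orderLT A (n + 7)`. But `M'Y + YM = M'²T - TM²`,
and since `TL³ = L'³T` this equals `(M'² - 16L'³)T - T(M² - 16L³)`, of order less than `n + 6`. Then
`mem_of_laxM_add_mem`, with excess 7, brings `Y` below order `n`. -/
theorem laxM_intertwine_mem {α u α' u' : A} (hα : par α = -α) (hu : par u = u)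
    (hα' : par α' = -α') (hu' : par u' = u') {n : ℕ} {T : Op A}
    (hT : T - dOp A ^ n ∈ orderLT A n) (h : T * laxL α u = laxL α' u' * T) :
    laxM α' u' * T - T * laxM α u ∈ orderLT A n := by
  have hT' := mem_of_monic hT
  refine mem_of_laxM_add_mem (α := α) (u := u) (α' := α') (u' := u') 7
    (sub_mem (mul_mem_orderLT (by omega) (laxM_mem α' u') hT')
      (mul_mem_orderLT (by omega) hT' (laxM_mem α u))) ?_
  have h3 : T * laxL α u ^ 3 = laxL α' u' ^ 3 * T := by
    rw [pow_succ, pow_two, ← mul_assoc, ← mul_assoc, h, mul_assoc (laxL α' u'), h, mul_assoc,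
      mul_assoc, h]
    noncomm_ring
  have e : laxM α' u' * (laxM α' u' * T - T * laxM α u) + (laxM α' u' * T - T * laxM α u) * laxM α u
      = (laxM α' u' * laxM α' u' - 16 * laxL α' u' ^ 3) * T
        - T * (laxM α u * laxM α u - 16 * laxL α u ^ 3) := by
    have e16 : T * (16 * laxL α u ^ 3) = 16 * (laxL α' u' ^ 3 * T) := by
      rw [← h3]; noncomm_ring
    rw [mul_sub T, e16]
    noncomm_ring
  rw [e]
  exact sub_mem (mul_mem_orderLT (by omega) (laxM_sq_sub_mem α' u' hα' hu') hT')
    (mul_mem_orderLT (by omega) hT' (laxM_sq_sub_mem α u hα hu))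

variable (A) in
/-- The action of operators on `A`. -/
def act : Op A →+* Module.End ℂ A := RingHom.snd _ _

theorem act_mulOp (a f : A) : act A (mulOp a) f = a * f := rfl

theorem act_dtOp (f : A) : act A (dtOp A) f = dt f := rfl

theorem act_mul (P Q : Op A) (f : A) : act A (P * Q) f = act A P (act A Q f) := by
  rw [map_mul]; rfl

theorem dt_comm_mem {n : ℕ} {P : Op A} (hP : P ∈ orderLT A n) :
    dtOp A * P - P * dtOp A ∈ orderLT A n := by
  induction hP using orderLT_induction with
  | monomial a i hi =>
    rw [← mul_assoc, dtOp_mul_mulOp, add_mul, mul_assoc, mul_assoc, dtOp_mul_dOp_pow,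
      add_sub_cancel_right]
    exact monomial_mem _ hi
  | zero => rw [mul_zero, zero_mul, sub_zero]; exact zero_mem _
  | add P Q hP hQ h1 h2 =>
    rw [mul_add, add_mul, add_sub_add_comm]
    exact add_mem h1 h2

/-- Dressing: a monic operator of order `n` whose kernel contains enough solutions of the linear
system maps the Lax pair to a Lax pair. -/
theorem dressing {α u α' u' : A} (hα : par α = -α) (hu : par u = u)
    (hα' : par α' = -α') (hu' : par u' = u') {n : ℕ} {T : Op A}
    (hT : T - dOp A ^ n ∈ orderLT A n)
    (hlax : (4 * dtOp A - laxM α u) * laxL α u - laxL α u * (4 * dtOp A - laxM α u) = 0)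
    (θ : ℕ → A) (lam : ℕ → ℂ)
    (huniq : ∀ P ∈ orderLT A n, (∀ j < n, act A P (θ j) = 0) → P = 0)
    (hTθ : ∀ j < n, act A T (θ j) = 0)
    (hL : ∀ j < n, act A (laxL α u) (θ j) = lam j • θ j)
    (hM : ∀ j < n, act A (laxM α u) (θ j) = act A (4 * dtOp A) (θ j))
    (h : T * laxL α u - laxL α' u' * T ∈ orderLT A n) :
    (4 * dtOp A - laxM α' u') * laxL α' u' - laxL α' u' * (4 * dtOp A - laxM α' u') = 0 := by
  -- The difference kills each `θⱼ`, since `L` multiplies `θⱼ` by a constant and `T` kills it.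
  -- Having order less than `n`, it is zero.
  have hL' : T * laxL α u = laxL α' u' * T := by
    refine sub_eq_zero.1 (huniq _ h fun j hj => ?_)
    rw [map_sub, LinearMap.sub_apply, act_mul, act_mul, hL j hj, map_smul, hTθ j hj, map_zero,
      smul_zero, sub_zero]
  have hY := laxM_intertwine_mem hα hu hα' hu' hT hL'
  -- On `θⱼ` the operator reduces to `-T(M - 4∂ₜ)θⱼ = 0`. Its order is less than `n`: the bracket
  -- with `∂ₜ` does not see the leading term `Dⁿ` of `T`, which has constant coefficient.
  have hM' : laxM α' u' * T - T * laxM α u - 4 * (dtOp A * T - T * dtOp A) = 0 := by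
    refine huniq _ (sub_mem hY (ofNat_mul_mem _ ?_)) fun j hj => ?_
    · have e : dtOp A * T - T * dtOp A
          = dtOp A * (T - dOp A ^ n) - (T - dOp A ^ n) * dtOp A := by
        rw [mul_sub, sub_mul, dtOp_mul_dOp_pow]; abel
      rw [e]
      exact dt_comm_mem hT
    · have e : laxM α' u' * T - T * laxM α u - 4 * (dtOp A * T - T * dtOp A)
          = laxM α' u' * T - 4 * dtOp A * T - T * (laxM α u - 4 * dtOp A) := by noncomm_ring
      rw [e, map_sub, map_sub, LinearMap.sub_apply, LinearMap.sub_apply, act_mul _ T,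
        act_mul _ T, act_mul T, hTθ j hj, map_sub, LinearMap.sub_apply, hM j hj]
      simp
  have hB : (4 * dtOp A - laxM α' u') * T = T * (4 * dtOp A - laxM α u) := by
    rw [← sub_eq_zero, ← neg_eq_zero, ← hM']
    noncomm_ring
  -- By `hL'` and `hB` the new commutator times `T` is `T` times the old one, which vanishes.
  refine eq_zero_of_mul_monic (m := 2) hT ?_ ?_
  · rw [lax_commutator α' u' hα' hu']
    exact firstOrder_mem _ _
  · calc _ = (4 * dtOp A - laxM α' u') * (laxL α' u' * T)
          - laxL α' u' * ((4 * dtOp A - laxM α' u') * T) := by noncomm_ring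
      _ = ((4 * dtOp A - laxM α' u') * T) * laxL α u
          - (laxL α' u' * T) * (4 * dtOp A - laxM α u) := by
        rw [← hL', hB, mul_assoc, ← mul_assoc (laxL α' u'), ← hL', ← mul_assoc, hB, mul_assoc]
      _ = T * ((4 * dtOp A - laxM α u) * laxL α u - laxL α u * (4 * dtOp A - laxM α u)) := by
        rw [← hL', hB, mul_assoc T, mul_assoc T, mul_sub T]
      _ = 0 := by rw [hlax, mul_zero]

end Lax

/-! ### The two leading coefficients of `TL - L'T` -/

section Dressing

variable {A : Type*} [Ring A] [Algebra ℂ A] [SuperDiffAlgebra A]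

open SuperDiffAlgebra

/-- Even powers of `D` are powers of the even derivation `∂`, so the commutator with a function
loses two orders in `D`, not just one. -/
theorem dOp_pow_even_mul_mulOp (k : ℕ) (f : A) :
    dOp A ^ (2 * k + 2) * mulOp f - mulOp f * dOp A ^ (2 * k + 2) ∈ orderLT A (2 * k + 1) := by
  induction k with
  | zero =>
    rw [mul_zero, zero_add, dx_mul_mulOp, add_sub_cancel_right]
    exact mulOp_mem _ (by omega)
  | succ k ih =>
    have e : dOp A ^ (2 * (k + 1) + 2) * mulOp f - mulOp f * dOp A ^ (2 * (k + 1) + 2)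
        = dOp A ^ 2 * (dOp A ^ (2 * k + 2) * mulOp f - mulOp f * dOp A ^ (2 * k + 2))
          + mulOp (dx f) * dOp A ^ (2 * k + 2) := by
      rw [mul_sub, ← mul_assoc _ (mulOp f), dx_mul_mulOp, add_mul, mul_assoc (mulOp f), ← pow_add,
        ← mul_assoc, ← pow_add, show 2 + (2 * k + 2) = 2 * (k + 1) + 2 by ring]
      abel
    rw [e]
    exact add_mem (orderLT_mono (by omega) (dOp_pow_mul_mem 2 ih)) (monomial_mem _ (by omega))

/-- An odd power is a power of `∂` times `D`: the factor `D` produces the two terms of the super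
Leibniz rule, and the power of `∂` passes them up to lower order. -/
theorem dOp_pow_odd_mul_mulOp (k : ℕ) (f : A) :
    dOp A ^ (2 * k + 1) * mulOp f - mulOp (D f) * dOp A ^ (2 * k)
      - mulOp (par f) * dOp A ^ (2 * k + 1) ∈ orderLT A (2 * k) := by
  cases k with
  | zero =>
    rw [mul_zero, zero_add, pow_one, dOp_mul_mulOp, pow_zero, mul_one, add_sub_cancel_left,
      sub_self]
    exact zero_mem _
  | succ k =>
    have e : dOp A ^ (2 * (k + 1) + 1) * mulOp f - mulOp (D f) * dOp A ^ (2 * (k + 1))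
        - mulOp (par f) * dOp A ^ (2 * (k + 1) + 1)
        = (dOp A ^ (2 * k + 2) * mulOp (D f) - mulOp (D f) * dOp A ^ (2 * k + 2))
          + (dOp A ^ (2 * k + 2) * mulOp (par f) - mulOp (par f) * dOp A ^ (2 * k + 2))
            * dOp A ^ 1 := by
      rw [sub_mul, mul_assoc, mul_assoc (mulOp (par f)), ← pow_add, pow_succ (dOp A), mul_assoc,
        dOp_mul_mulOp, pow_one]
      simp only [mul_add, ← pow_succ, mul_one]
      abel
    rw [e]
    exact add_mem (orderLT_mono (by omega) (dOp_pow_even_mul_mulOp k _))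
      (mul_dOp_pow_mem 1 (dOp_pow_even_mul_mulOp k _))

/-- The terms of `L' T - T L` that come from `∂²`. -/
theorem dx_sq_comm_mem {m : ℕ} {a c : A} {B : Op A} (hB : B ∈ orderLT A m)
    (hc : (dOp A ^ 2 * B - B * dOp A ^ 2) * dOp A ^ 2 - mulOp c * dOp A ^ (m + 1)
      ∈ orderLT A (m + 1)) :
    dOp A ^ 4 * (dOp A ^ (m + 1) + mulOp a * dOp A ^ m + B)
      - (dOp A ^ (m + 1) + mulOp a * dOp A ^ m + B) * dOp A ^ 4
      - mulOp (2 * dx a) * dOp A ^ (m + 2) - mulOp (2 * c) * dOp A ^ (m + 1)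
      ∈ orderLT A (m + 1) := by
  have h1 := dx_comm_mem (dx_comm_mem hB)
  -- This is `[X², P] = [X, [X, P]] + 2[X, P]X` for `P = Q` and `P = B`, while `S` commutes with
  -- `X`. The double brackets are negligible, so only `2[X, Q]X` and `2[X, B]X` reach the orders in
  -- question; `c` is the leading coefficient of the bracket with `B`.
  have key (X S Q B : Op A) (hS : X * S = S * X) : X ^ 2 * (S + Q + B) - (S + Q + B) * X ^ 2
      = (X * (X * Q - Q * X) - (X * Q - Q * X) * X) + 2 * ((X * Q - Q * X) * X)
        + (X * (X * B - B * X) - (X * B - B * X) * X) + 2 * ((X * B - B * X) * X) := by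
    have : X ^ 2 * S = S * X ^ 2 := by rw [pow_two, mul_assoc, hS, ← mul_assoc, hS, mul_assoc]
    rw [mul_add, mul_add, this]
    noncomm_ring
  have hcomm (b : A) : dOp A ^ 2 * (mulOp b * dOp A ^ m) - mulOp b * dOp A ^ m * dOp A ^ 2
      = mulOp (dx b) * dOp A ^ m := by
    rw [← mul_assoc, dx_mul_mulOp, add_mul, mul_assoc (mulOp b), mul_assoc (mulOp b), ← pow_add,
      ← pow_add, add_comm 2 m, add_sub_cancel_right]
  have h := key (dOp A ^ 2) (dOp A ^ (m + 1)) (mulOp a * dOp A ^ m) B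
    (by rw [← pow_add, ← pow_add, add_comm])
  rw [hcomm, hcomm, ← pow_mul, mul_assoc (mulOp (dx a)), ← pow_add] at h
  have e : dOp A ^ 4 * (dOp A ^ (m + 1) + mulOp a * dOp A ^ m + B)
      - (dOp A ^ (m + 1) + mulOp a * dOp A ^ m + B) * dOp A ^ 4
      - mulOp (2 * dx a) * dOp A ^ (m + 2) - mulOp (2 * c) * dOp A ^ (m + 1)
      = mulOp (dx (dx a)) * dOp A ^ m
        + (dOp A ^ 2 * (dOp A ^ 2 * B - B * dOp A ^ 2)
          - (dOp A ^ 2 * B - B * dOp A ^ 2) * dOp A ^ 2)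
        + 2 * ((dOp A ^ 2 * B - B * dOp A ^ 2) * dOp A ^ 2 - mulOp c * dOp A ^ (m + 1)) := by
    rw [h, map_mul, map_mul, map_ofNat, mul_sub (2 : Op A), mul_assoc 2 (mulOp c),
      mul_assoc 2 (mulOp (dx a))]
    abel
  rw [e]
  exact add_mem (add_mem (monomial_mem _ (by omega)) (orderLT_mono (by omega) h1))
    (ofNat_mul_mem _ hc)

theorem firstOrder_mul_monic_mem {m : ℕ} (a α u : A) {B : Op A} (hB : B ∈ orderLT A m) :
    firstOrder α u * (dOp A ^ (m + 1) + mulOp a * dOp A ^ m + B)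
      - mulOp α * dOp A ^ (m + 2) - mulOp (α * par a + u) * dOp A ^ (m + 1)
      ∈ orderLT A (m + 1) := by
  have e : firstOrder α u * (dOp A ^ (m + 1) + mulOp a * dOp A ^ m + B)
      - mulOp α * dOp A ^ (m + 2) - mulOp (α * par a + u) * dOp A ^ (m + 1)
      = mulOp (α * D a + u * a) * dOp A ^ m + firstOrder α u * B := by
    have e1 : dOp A * (mulOp a * dOp A ^ m)
        = mulOp (D a) * dOp A ^ m + mulOp (par a) * dOp A ^ (m + 1) := by
      rw [← mul_assoc, dOp_mul_mulOp, add_mul, mul_assoc, ← pow_succ']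
    simp only [firstOrder, add_mul, mul_add, map_add, map_mul, mul_assoc, e1, ← pow_succ']
    abel
  rw [e]
  exact add_mem (monomial_mem _ (by omega))
    (mul_mem_orderLT (by omega) (firstOrder_mem _ _) hB)

/-- The potentials of the dressed Lax operator for an operator `T` of even order. -/
theorem dressed_laxL_even {k : ℕ} {α u α' u' a c : A} {B : Op A} (ha : par a = -a)
    (hα : par α = -α) (hB : B ∈ orderLT A (2 * k + 1))
    (hc : (dOp A ^ 2 * B - B * dOp A ^ 2) * dOp A ^ 2 - mulOp c * dOp A ^ (2 * k + 2)
      ∈ orderLT A (2 * k + 2))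
    (hα' : α' = α - 2 * dx a) (hu' : u' = u - 2 * c + (α + α') * a) :
    (dOp A ^ (2 * k + 2) + mulOp a * dOp A ^ (2 * k + 1) + B) * laxL α u
      - laxL α' u' * (dOp A ^ (2 * k + 2) + mulOp a * dOp A ^ (2 * k + 1) + B)
      ∈ orderLT A (2 * k + 2) := by
  have h1 := dx_sq_comm_mem (m := 2 * k + 1) (a := a) hB hc
  have h2 := firstOrder_mul_monic_mem a α' u' hB
  have h3 := mul_dOp_pow_mem 1 (dOp_pow_even_mul_mulOp k α)
  have h4 := dOp_pow_even_mul_mulOp k u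
  have h5 := mulOp_mul_mem a (mul_dOp_pow_mem 1 (dOp_pow_odd_mul_mulOp k α))
  have h5' : mulOp (a * D α) * dOp A ^ (2 * k + 1) ∈ orderLT A (2 * k + 2) :=
    monomial_mem _ (by omega)
  have h6 : mulOp a * dOp A ^ (2 * k + 1) * mulOp u ∈ orderLT A (2 * k + 2) :=
    mul_mem_orderLT (m := 2 * k + 2) (n := 1) (by omega) (monomial_mem _ (by omega))
      (mulOp_mem _ (by omega))
  have h7 : B * firstOrder α u ∈ orderLT A (2 * k + 2) :=
    mul_mem_orderLT (by omega) hB (firstOrder_mem _ _)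
  have haα : a * α = -(α * a) := odd_anticomm a α ha hα
  set d := dOp A
  -- With `n = 2k + 2`, the coefficients of `Dⁿ⁺¹` and `Dⁿ` in `TL - L'T` are `α - α' - 2∂a` and `u
  -- - u' - 2c + (α + α')a`. Both vanish by the choice of `α'` and `u'`, which leaves exactly the
  -- remainders summed here.
  have hsum := sub_mem (add_mem (add_mem (add_mem (add_mem (add_mem (add_mem h3
    (orderLT_mono (by omega) h4)) (orderLT_mono (by omega) h5)) h5') h6) h7)
    (neg_mem h1)) h2
  convert hsum using 1
  rw [laxL, laxL, hα, ha]
  have c1 : mulOp α' = mulOp α - mulOp (2 * dx a) := by rw [hα', map_sub]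
  have c2 : mulOp (α' * -a + u')
      = mulOp u - mulOp (2 * c) - mulOp a * mulOp α := by
    rw [← map_mul, haα, ← map_sub, ← map_sub]
    congr 1
    rw [hu']
    noncomm_ring
  rw [c2]
  have p1 : d ^ (2 * k + 1) * d = d ^ (2 * k + 2) := by rw [← pow_succ]
  have p2 : d ^ (2 * k + 2) * d = d ^ (2 * k + 3) := by rw [← pow_succ]
  have p3 : d ^ (2 * k) * d = d ^ (2 * k + 1) := by rw [← pow_succ]
  have q : firstOrder α u = mulOp α * d + mulOp u := rfl
  rw [q]
  simp only [mul_add, add_mul, mul_sub, sub_mul, pow_one, mul_assoc, p1, p2, p3, map_neg, neg_mul,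
    mul_neg, c1, map_mul]
  abel

/-- The potentials of the dressed Lax operator for an operator `T` of odd order. -/
theorem dressed_laxL_odd {k : ℕ} {α u α' u' a c : A} {B : Op A} (ha : par a = -a)
    (hα : par α = -α) (hu : par u = u) (hB : B ∈ orderLT A (2 * k))
    (hc : (dOp A ^ 2 * B - B * dOp A ^ 2) * dOp A ^ 2 - mulOp c * dOp A ^ (2 * k + 1)
      ∈ orderLT A (2 * k + 1))
    (hα' : α' = -α - 2 * dx a) (hu' : u' = u - 2 * c + D α - (α - α') * a) :
    (dOp A ^ (2 * k + 1) + mulOp a * dOp A ^ (2 * k) + B) * laxL α u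
      - laxL α' u' * (dOp A ^ (2 * k + 1) + mulOp a * dOp A ^ (2 * k) + B)
      ∈ orderLT A (2 * k + 1) := by
  have h1 := dx_sq_comm_mem (m := 2 * k) (a := a) hB hc
  have h2 := firstOrder_mul_monic_mem a α' u' hB
  have h3 := mul_dOp_pow_mem 1 (dOp_pow_odd_mul_mulOp k α)
  have h4 := dOp_pow_odd_mul_mulOp k u
  have h4' : mulOp (D u) * dOp A ^ (2 * k) ∈ orderLT A (2 * k + 1) := monomial_mem _ (by omega)
  have h5 : dOp A ^ (2 * k) * mulOp α - mulOp α * dOp A ^ (2 * k) ∈ orderLT A (2 * k) := by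
    cases k with
    | zero => simp [zero_mem]
    | succ k => exact orderLT_mono (by omega) (dOp_pow_even_mul_mulOp k α)
  have h5' := mulOp_mul_mem a (mul_dOp_pow_mem 1 h5)
  have h6 : mulOp a * dOp A ^ (2 * k) * mulOp u ∈ orderLT A (2 * k + 1) :=
    mul_mem_orderLT (m := 2 * k + 1) (n := 1) (by omega) (monomial_mem _ (by omega))
      (mulOp_mem _ (by omega))
  have h7 : B * firstOrder α u ∈ orderLT A (2 * k + 1) :=
    mul_mem_orderLT (by omega) hB (firstOrder_mem _ _)
  have haα : a * α = -(α * a) := odd_anticomm a α ha hα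
  set d := dOp A
  -- With `n = 2k + 1`, moving `Dⁿ` past `α` yields `-α` and the extra term `Dα`. The coefficients
  -- of `Dⁿ⁺¹` and `Dⁿ` are `-α - α' - 2∂a` and `u - u' - 2c + Dα - (α - α')a`; both vanish.
  have hsum := sub_mem (add_mem (add_mem (add_mem (add_mem (add_mem (add_mem h3
    (orderLT_mono (by omega) h4)) h4') h5') h6) h7) (neg_mem h1)) h2
  convert hsum using 1
  rw [laxL, laxL, hα, hu, ha]
  have c1 : mulOp α' = -mulOp α - mulOp (2 * dx a) := by rw [hα', map_sub, map_neg]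
  have c2 : mulOp (α' * -a + u')
      = mulOp u - mulOp (2 * c) + mulOp (D α) + mulOp a * mulOp α := by
    rw [← map_mul, haα, ← map_sub, ← map_add, ← map_add]
    congr 1
    rw [hu']
    noncomm_ring
  rw [c2]
  have p1 : d ^ (2 * k + 1) * d = d ^ (2 * k + 2) := by rw [← pow_succ]
  have p3 : d ^ (2 * k) * d = d ^ (2 * k + 1) := by rw [← pow_succ]
  have q : firstOrder α u = mulOp α * d + mulOp u := rfl
  rw [q]
  simp only [mul_add, add_mul, mul_sub, sub_mul, pow_one, mul_assoc, p1, p3, map_neg, neg_mul,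
    mul_neg, c1]
  abel

end Dressing

/-! ### Darboux transformations from the kernel of a monic operator -/

section Kernel

variable {A : Type*} [Ring A] [Algebra ℂ A] [SuperDiffAlgebra A]

open SuperDiffAlgebra

/-- The operator `Dⁿ + ∑ aᵢ Dⁱ`. -/
def monicOp (n : ℕ) (a : ℕ → A) : Op A :=
  dOp A ^ n + ∑ i ∈ Finset.range n, mulOp (a i) * dOp A ^ i

theorem sum_monomial_mem (n : ℕ) (a : ℕ → A) :
    ∑ i ∈ Finset.range n, mulOp (a i) * dOp A ^ i ∈ orderLT A n :=
  sum_mem fun i hi => monomial_mem _ (Finset.mem_range.1 hi)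

theorem monicOp_sub_mem (n : ℕ) (a : ℕ → A) : monicOp n a - dOp A ^ n ∈ orderLT A n := by
  rw [monicOp, add_sub_cancel_left]
  exact sum_monomial_mem n a

theorem act_dOp_pow (i : ℕ) (f : A) : act A (dOp A ^ i) f = (D ^ i : A →ₗ[ℂ] A) f := by
  rw [map_pow]; rfl

theorem act_sum_monomial (n : ℕ) (a : ℕ → A) (f : A) :
    act A (∑ i ∈ Finset.range n, mulOp (a i) * dOp A ^ i) f
      = ∑ i ∈ Finset.range n, a i * (D ^ i : A →ₗ[ℂ] A) f := by
  rw [map_sum, LinearMap.sum_apply]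
  exact Finset.sum_congr rfl fun i _ => by rw [act_mul, act_dOp_pow, act_mulOp]

theorem dx_comm_sum (n : ℕ) (a : ℕ → A) :
    (dOp A ^ 2 * (∑ i ∈ Finset.range n, mulOp (a i) * dOp A ^ i)
      - (∑ i ∈ Finset.range n, mulOp (a i) * dOp A ^ i) * dOp A ^ 2) * dOp A ^ 2
      = ∑ i ∈ Finset.range n, mulOp (dx (a i)) * dOp A ^ (i + 2) := by
  rw [Finset.mul_sum, Finset.sum_mul, ← Finset.sum_sub_distrib, Finset.sum_mul]
  refine Finset.sum_congr rfl fun i _ => ?_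
  rw [← mul_assoc, dx_mul_mulOp, add_mul, mul_assoc (mulOp (a i)), mul_assoc (mulOp (a i)),
    ← pow_add, ← pow_add, add_comm 2 i, add_sub_cancel_right, mul_assoc, ← pow_add]

theorem dx_comm_sum_succ_mem (n : ℕ) (a : ℕ → A) :
    (dOp A ^ 2 * (∑ i ∈ Finset.range (n + 1), mulOp (a i) * dOp A ^ i)
      - (∑ i ∈ Finset.range (n + 1), mulOp (a i) * dOp A ^ i) * dOp A ^ 2) * dOp A ^ 2
      - mulOp (dx (a n)) * dOp A ^ (n + 2) ∈ orderLT A (n + 2) := by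
  rw [dx_comm_sum, Finset.sum_range_succ, add_sub_cancel_right]
  exact sum_mem fun i hi => monomial_mem _ (by have := Finset.mem_range.1 hi; omega)

theorem par_D_pow (i : ℕ) (f : A) :
    par ((D ^ i : A →ₗ[ℂ] A) f) = (-1 : ℂ) ^ i • (D ^ i : A →ₗ[ℂ] A) (par f) := by
  induction i generalizing f with
  | zero => simp
  | succ i ih =>
    rw [pow_succ, Module.End.mul_apply, ih, par_D, map_neg, Module.End.mul_apply, pow_succ, mul_smul,
      neg_one_smul ℂ, smul_neg]

/-- The functions `θ₀, …, θₙ₋₁` are not annihilated by an operator of order less than `n`. -/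
def Nondegenerate (n : ℕ) (θ : ℕ → A) : Prop :=
  ∀ b : ℕ → A, (∀ j < n, ∑ i ∈ Finset.range n, b i * (D ^ i : A →ₗ[ℂ] A) (θ j) = 0) →
    ∀ i < n, b i = 0

/-- The functions `θ₀, …, θₙ₋₁` are annihilated by `Dⁿ + ∑ aᵢ Dⁱ`. -/
def IsKernel (n : ℕ) (a θ : ℕ → A) : Prop :=
  ∀ j < n, (D ^ n : A →ₗ[ℂ] A) (θ j) + ∑ i ∈ Finset.range n, a i * (D ^ i : A →ₗ[ℂ] A) (θ j) = 0

/-- Applying parity to the kernel relations shows that the coefficients `(-1)ⁿ⁺ⁱ par(aᵢ)` solve the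
same linear system, whose solution is unique by nondegeneracy. -/
theorem par_coeff {n : ℕ} {θ a : ℕ → A} (hpar : ∀ j < n, par (θ j) = (-1 : ℂ) ^ j • θ j)
    (hnd : Nondegenerate n θ) (hker : IsKernel n a θ) {i : ℕ} (hi : i < n) :
    par (a i) = (-1 : ℂ) ^ (n + i) • a i := by
  have key := hnd (fun i => (-1 : ℂ) ^ (n + i) • par (a i) - a i) (fun j hj => ?_) i hi
  · have h := sub_eq_zero.1 key
    have h' := congrArg (fun x => (-1 : ℂ) ^ (n + i) • x) h
    simp only [smul_smul, ← mul_pow] at h'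
    simpa using h'
  · have hD (i : ℕ) : par ((D ^ i : A →ₗ[ℂ] A) (θ j))
        = ((-1 : ℂ) ^ i * (-1) ^ j) • (D ^ i : A →ₗ[ℂ] A) (θ j) := by
      rw [par_D_pow, hpar j hj, map_smul, smul_smul]
    have h1 := hker j hj
    have h2 := congrArg (fun x => ((-1 : ℂ) ^ n * (-1) ^ j) • par x) h1
    have hsq (m : ℕ) : (-1 : ℂ) ^ m * (-1) ^ m = 1 := by rw [← mul_pow]; simp
    simp only [map_add, map_sum, map_mul, hD, map_zero, smul_zero, smul_add, smul_smul,
      Finset.smul_sum, mul_smul_comm] at h2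
    have hc (i : ℕ) : (-1 : ℂ) ^ n * (-1) ^ j * ((-1) ^ i * (-1) ^ j) = (-1) ^ (n + i) := by
      rw [pow_add]; linear_combination (-1 : ℂ) ^ n * (-1) ^ i * hsq j
    simp only [hc] at h2
    rw [show (-1 : ℂ) ^ (n + n) = 1 by rw [pow_add, hsq], one_smul] at h2
    simp only [sub_mul, Finset.sum_sub_distrib, smul_mul_assoc]
    rw [sub_eq_zero]
    exact add_left_cancel (h2.trans h1.symm)

theorem act_laxL (α u f : A) : act A (laxL α u) f = dx (dx f) + α * D f + u * f := by
  rw [laxL, firstOrder, map_add, map_add, LinearMap.add_apply, LinearMap.add_apply, act_mul,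
    ← add_assoc]
  rfl

/-- The `t`-equation of the linear system is `4∂ₜψ = Mψ` with `∂³ψ` eliminated: four times the
`∂`-derivative of `Lψ = λψ` accounts for the difference. -/
theorem act_laxM {α u f : A} {lam : ℂ} (hL : dx (dx f) + α * D f + u * f = lam • f)
    (hM : dt f = (1 / 2 : ℂ) • (α * dx (D f)) + lam • dx f + (1 / 2 : ℂ) • (u * dx f)
      - (1 / 4 : ℂ) • (dx α * D f) - (1 / 4 : ℂ) • (dx u * f)) :
    act A (laxM α u) f = act A (4 * dtOp A) f := by
  have h4 (P : Op A) : act A (4 * P) f = (4 : ℂ) • act A P f := by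
    rw [show (4 : Op A) * P = P + P + P + P by noncomm_ring]
    simp only [map_add, LinearMap.add_apply]
    module
  have h6 (P : Op A) : act A (6 * P) f = (6 : ℂ) • act A P f := by
    rw [show (6 : Op A) * P = P + P + P + P + P + P by noncomm_ring]
    simp only [map_add, LinearMap.add_apply]
    module
  have h3 (P : Op A) : act A (3 * P) f = (3 : ℂ) • act A P f := by
    rw [show (3 : Op A) * P = P + P + P by noncomm_ring]
    simp only [map_add, LinearMap.add_apply]
    module
  have hx := congrArg dx hL
  simp only [map_add, map_smul, dx_mul] at hx
  have e6 : act A (dOp A ^ 6) f = dx (dx (dx f)) := rfl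
  have eK : act A (firstOrder α u * dOp A ^ 2) f = α * dx (D f) + u * dx f := by
    rw [act_mul, firstOrder, map_add, LinearMap.add_apply, act_mul]
    rfl
  have eK' : act A (firstOrder (dx α) (dx u)) f = dx α * D f + dx u * f := by
    rw [firstOrder, map_add, LinearMap.add_apply, act_mul]
    rfl
  rw [laxM, dx_comm_firstOrder, map_add, map_add, LinearMap.add_apply, LinearMap.add_apply, h4, h6,
    h3, h4, act_dtOp, hM, e6, eK, eK', ← hx]
  module

theorem Nondegenerate.eq_zero {n : ℕ} {θ : ℕ → A} (hnd : Nondegenerate n θ) {P : Op A}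
    (hP : P ∈ orderLT A n) (h : ∀ j < n, act A P (θ j) = 0) : P = 0 := by
  rw [eq_sum_coef hP]
  refine Finset.sum_eq_zero fun i hi => ?_
  rw [hnd (fun i => coef i P) (fun j hj => ?_) i (Finset.mem_range.1 hi), map_zero, zero_mul]
  rw [← act_sum_monomial, ← eq_sum_coef hP, h j hj]

theorem IsKernel.act_monicOp {n : ℕ} {θ a : ℕ → A} (hker : IsKernel n a θ) {j : ℕ} (hj : j < n) :
    act A (monicOp n a) (θ j) = 0 := by
  rw [monicOp, map_add, LinearMap.add_apply, act_sum_monomial, act_dOp_pow, hker j hj]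

/-- The odd field `α` and the even field `u` satisfy the Manin-Radul equations. -/
structure SolvesMR (α u : A) : Prop where
  odd : par α = -α
  even : par u = u
  lax : (4 * dtOp A - laxM α u) * laxL α u - laxL α u * (4 * dtOp A - laxM α u) = 0

/-- `ψ` solves the linear system with potentials `α, u`. -/
structure SolvesLinear (α u : A) (lam : ℂ) (ψ : A) : Prop where
  eq_L : act A (laxL α u) ψ = lam • ψ
  eq_M : act A (laxM α u) ψ = act A (4 * dtOp A) ψ

/-- The Darboux transformation of even order. -/
theorem darboux_even {k : ℕ} {α u α' u' : A} (h : SolvesMR α u) {θ a : ℕ → A} {lam : ℕ → ℂ}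
    (hθ : ∀ j < 2 * k + 2, SolvesLinear α u (lam j) (θ j))
    (hpar : ∀ j < 2 * k + 2, par (θ j) = (-1 : ℂ) ^ j • θ j)
    (hnd : Nondegenerate (2 * k + 2) θ) (hker : IsKernel (2 * k + 2) a θ)
    (hα' : α' = α - 2 * dx (a (2 * k + 1)))
    (hu' : u' = u - 2 * dx (a (2 * k)) + (α + α') * a (2 * k + 1)) : SolvesMR α' u' := by
  have ha : par (a (2 * k + 1)) = -a (2 * k + 1) := by
    rw [par_coeff hpar hnd hker (by omega), Odd.neg_one_pow ⟨2 * k + 1, by ring⟩, neg_one_smul]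
  have hb : par (a (2 * k)) = a (2 * k) := by
    rw [par_coeff hpar hnd hker (by omega), Even.neg_one_pow ⟨2 * k + 1, by ring⟩, one_smul]
  have odd : par α' = -α' := by
    rw [hα', map_sub, map_mul, map_ofNat, par_dx, ha, h.odd, map_neg]; noncomm_ring
  have even : par u' = u' := by
    rw [hu', map_add, map_sub, map_mul, map_mul, map_ofNat, par_dx, hb, h.even, map_add, odd, h.odd,
      ha]
    noncomm_ring
  refine ⟨odd, even, dressing h.odd h.even odd even (monicOp_sub_mem _ a) h.lax θ lam
    (fun P hP => hnd.eq_zero hP) (fun j hj => hker.act_monicOp hj) (fun j hj => (hθ j hj).eq_L)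
    (fun j hj => (hθ j hj).eq_M) ?_⟩
  have e : monicOp (2 * k + 2) a = dOp A ^ (2 * k + 2) + mulOp (a (2 * k + 1)) * dOp A ^ (2 * k + 1)
      + ∑ i ∈ Finset.range (2 * k + 1), mulOp (a i) * dOp A ^ i := by
    rw [monicOp, Finset.sum_range_succ]; abel
  rw [e]
  exact dressed_laxL_even ha h.odd (sum_monomial_mem _ a) (dx_comm_sum_succ_mem _ a) hα' hu'

/-- The Darboux transformation of odd order. -/
theorem darboux_odd {k : ℕ} {α u α' u' c : A} (h : SolvesMR α u) {θ a : ℕ → A} {lam : ℕ → ℂ}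
    (hθ : ∀ j < 2 * k + 1, SolvesLinear α u (lam j) (θ j))
    (hpar : ∀ j < 2 * k + 1, par (θ j) = (-1 : ℂ) ^ j • θ j)
    (hnd : Nondegenerate (2 * k + 1) θ) (hker : IsKernel (2 * k + 1) a θ)
    (hc0 : k = 0 → c = 0) (hc : ∀ l, k = l + 1 → c = dx (a (2 * l + 1)))
    (hα' : α' = -α - 2 * dx (a (2 * k)))
    (hu' : u' = u - 2 * c + D α - (α - α') * a (2 * k)) : SolvesMR α' u' := by
  have ha : par (a (2 * k)) = -a (2 * k) := by
    rw [par_coeff hpar hnd hker (by omega), Odd.neg_one_pow ⟨2 * k, by ring⟩, neg_one_smul]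
  -- `c` stands for `∂a₂ₖ₋₁`; for `k = 0` this coefficient does not exist, as `T = D + a₀`, and `c`
  -- is zero.
  have hb : par c = c := by
    cases k with
    | zero => rw [hc0 rfl, map_zero]
    | succ l =>
      rw [hc l rfl, par_dx, par_coeff hpar hnd hker (by omega),
        Even.neg_one_pow ⟨2 * l + 2, by ring⟩, one_smul]
  have odd : par α' = -α' := by
    rw [hα', map_sub, map_mul, map_ofNat, par_dx, ha, map_neg, h.odd, map_neg]; noncomm_ring
  have even : par u' = u' := by
    rw [hu', map_sub, map_add, map_sub, map_mul, map_mul, map_ofNat, hb, h.even, map_sub, odd,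
      h.odd, ha, par_D, h.odd, map_neg]
    noncomm_ring
  refine ⟨odd, even, dressing h.odd h.even odd even (monicOp_sub_mem _ a) h.lax θ lam
    (fun P hP => hnd.eq_zero hP) (fun j hj => hker.act_monicOp hj) (fun j hj => (hθ j hj).eq_L)
    (fun j hj => (hθ j hj).eq_M) ?_⟩
  have e : monicOp (2 * k + 1) a = dOp A ^ (2 * k + 1) + mulOp (a (2 * k)) * dOp A ^ (2 * k)
      + ∑ i ∈ Finset.range (2 * k), mulOp (a i) * dOp A ^ i := by
    rw [monicOp, Finset.sum_range_succ]; abel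
  rw [e]
  refine dressed_laxL_odd ha h.odd h.even (sum_monomial_mem _ a) ?_ hα' hu'
  cases k with
  | zero => simp [hc0 rfl, zero_mem]
  | succ l => rw [hc l rfl]; exact dx_comm_sum_succ_mem (2 * l + 1) a

end Kernel

/-! ### Determinants over a commutative ring -/

section CommutativeDeterminants

variable {R : Type*} [CommRing R]

/-- Modulo the nilradical both determinants agree, and a unit plus a nilpotent is a unit. -/
theorem isUnit_det_sub_of_nilpotent {n : Type*} [Fintype n] [DecidableEq n] {M N : Matrix n n R}
    (hM : IsUnit M.det) (hN : ∀ i j, IsNilpotent (N i j)) : IsUnit (M - N).det := by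
  have h : (M - N).det - M.det ∈ nilradical R := by
    rw [← Ideal.Quotient.eq, RingHom.map_det, RingHom.map_det]
    congr 1
    ext i j
    simp only [RingHom.mapMatrix_apply, Matrix.map_apply, Matrix.sub_apply, map_sub]
    rw [Ideal.Quotient.eq_zero_iff_mem.2 (mem_nilradical.2 (hN i j)), sub_zero]
  have h' := (mem_nilradical.1 h).isUnit_add_left_of_commute hM (Commute.all _ _)
  rwa [add_sub_cancel] at h'

theorem det_one_updateRow {n : Type*} [Fintype n] [DecidableEq n] (i : n) (c : n → R) :
    ((1 : Matrix n n R).updateRow i c).det = c i := by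
  have h := Matrix.cramer_transpose_apply (1 : Matrix n n R) c i
  rw [← h, Matrix.transpose_one, Matrix.cramer_one]
  rfl

/-- The determinant of `1 + Q`, where `Q = x ⊗ b` with odd vectors `x, b`. -/
theorem det_one_add_odd_rank_one [Algebra ℂ R] {n : ℕ} (Q : Matrix (Fin n) (Fin n) R)
    (hQ : ∀ i j k l, Q i j * Q k l = -(Q i l * Q k j)) :
    (1 + Q).det * (1 - Q.trace) = 1 := by
  induction n with
  | zero => simp
  | succ n ih =>
    -- For even vectors the determinant would be `1 + tr Q`; oddness inverts it to `1 / (1 - tr Q)`.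
    -- The relation `hQ` with equal column indices makes products of entries of one column vanish,
    -- as 2 is invertible.
    have hz (i j k : Fin (n + 1)) : Q i j * Q k j = 0 := by
      have h := hQ i j k j
      have h2 : (2 : ℂ) • (Q i j * Q k j) = 0 := by rw [two_smul]; nth_rw 1 [h]; ring
      exact (smul_eq_zero.1 h2).resolve_left two_ne_zero
    set q := Q 0 0 with hq
    -- Subtracting `Qᵢ₀` times row 0 from row `i` clears the first column, because `Qᵢ₀ q = 0`. It
    -- turns `Qᵢⱼ` into `Qᵢⱼ - Qᵢ₀Q₀ⱼ`, which is `(1 + q)Qᵢⱼ` by `hQ`. So the minor has the same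
    -- shape, and the induction hypothesis applies to it.
    set Q' : Matrix (Fin n) (Fin n) R := Matrix.of fun i j => (1 + q) * Q i.succ j.succ with hQ'
    have hdet : (1 + Q).det = (1 + q) * (1 + Q').det := by
      have h1 : (1 + Q).det = (Matrix.of fun i j => (1 + Q) i j
          - (if i = 0 then 0 else Q i 0) * (1 + Q) 0 j).det := by
        refine Matrix.det_eq_of_forall_row_eq_smul_add_const (fun i => if i = 0 then 0 else Q i 0)
          0 (by simp) fun i j => ?_
        simp only [Matrix.of_apply]
        simp
      rw [h1, Matrix.det_succ_column_zero, Finset.sum_eq_single 0]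
      · have : (Matrix.of fun i j => (1 + Q) i j
            - (if i = 0 then 0 else Q i 0) * (1 + Q) 0 j).submatrix (Fin.succAbove 0) Fin.succ
            = 1 + Q' := by
          ext i j
          have h01 : (1 : Matrix (Fin (n + 1)) (Fin (n + 1)) R) 0 j.succ = 0 :=
            Matrix.one_apply_ne (Fin.succ_ne_zero j).symm
          have h11 : (1 : Matrix (Fin (n + 1)) (Fin (n + 1)) R) i.succ j.succ
              = (1 : Matrix (Fin n) (Fin n) R) i j := by
            simp [Matrix.one_apply]
          simp only [Matrix.submatrix_apply, Matrix.of_apply, Fin.zero_succAbove, Matrix.add_apply,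
            h01, h11, hQ', if_neg (Fin.succ_ne_zero i)]
          linear_combination -hQ i.succ 0 0 j.succ
        rw [this]
        simp [hq]
      · intro i _ hi
        have : (1 : Matrix (Fin (n + 1)) (Fin (n + 1)) R) i 0 = 0 := Matrix.one_apply_ne hi
        have h0 : (Matrix.of fun i j => (1 + Q) i j
            - (if i = 0 then 0 else Q i 0) * (1 + Q) 0 j) i 0 = 0 := by
          simp only [Matrix.of_apply, if_neg hi, Matrix.add_apply, this, Matrix.one_apply_eq]
          linear_combination -hz i 0 0
        rw [h0, mul_zero, zero_mul]
      · intro h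
        exact absurd (Finset.mem_univ _) h
    have htr : Q'.trace = (1 + q) * (Q.trace - q) := by
      simp only [Matrix.trace, Fin.sum_univ_succ, Matrix.diag_apply, hQ', Matrix.of_apply,
        ← Finset.mul_sum]
      ring
    have h := ih Q' fun i j k l => by
      simp only [hQ', Matrix.of_apply]
      linear_combination (1 + q) ^ 2 * hQ i.succ j.succ k.succ l.succ
    rw [htr] at h
    rw [hdet]
    have hqq : q * q = 0 := hz 0 0 0
    have h2 : (1 + q) * (1 - Q.trace) = (1 - (1 + q) * (Q.trace - q)) := by
      linear_combination -hqq
    linear_combination h + (1 + Q').det * h2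

end CommutativeDeterminants

/-! ### The even part and determinants over it -/

section EvenPart

variable (A : Type*) [Ring A] [Algebra ℂ A] [SuperDiffAlgebra A]

open SuperDiffAlgebra

/-- The commutative algebra of even elements. -/
def evenPart : Subalgebra ℂ A := AlgHom.equalizer par (AlgHom.id ℂ A)

variable {A}

instance : CommRing (evenPart A) :=
  { (inferInstance : Ring (evenPart A)) with
    mul_comm := fun a b => Subtype.ext (even_comm (a : A) b a.2) }

theorem par_coe (r : evenPart A) : par (r : A) = r := r.2

theorem coe_comm (r : evenPart A) (a : A) : (r : A) * a = a * r := even_comm _ _ r.2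

theorem isUnit_coe_inverse {r : evenPart A} (hr : IsUnit r) :
    Ring.inverse (r : A) = ((Ring.inverse r : evenPart A) : A) := by
  obtain ⟨w, rfl⟩ := hr
  rw [Ring.inverse_unit]
  exact Ring.inverse_unit (Units.map (evenPart A).val.toMonoidHom w)

section Embedding

variable {l m n : Type*} [Fintype l] [Fintype m] [Fintype n]

/-- A matrix with even entries as a matrix over the whole algebra. -/
def emb (M : Matrix m n (evenPart A)) : Matrix m n A := Matrix.of fun i j => (M i j : A)

theorem emb_apply (M : Matrix m n (evenPart A)) (i : m) (j : n) : emb M i j = M i j := rfl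

theorem emb_injective : Function.Injective (emb : Matrix m n (evenPart A) → Matrix m n A) :=
  fun _ _ h => Matrix.ext fun i j => Subtype.ext (congrFun (congrFun h i) j)

theorem emb_mul (M : Matrix l m (evenPart A)) (N : Matrix m n (evenPart A)) :
    emb (M * N) = emb M * emb N := by
  ext i j
  simp [emb, Matrix.mul_apply]

theorem emb_one [DecidableEq m] : emb (1 : Matrix m m (evenPart A)) = 1 := by
  ext i j
  simp only [emb_apply, Matrix.one_apply]
  split_ifs <;> rfl

theorem emb_add (M N : Matrix m n (evenPart A)) : emb (M + N) = emb M + emb N := rfl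

theorem emb_sub (M N : Matrix m n (evenPart A)) : emb (M - N) = emb M - emb N := rfl

theorem exists_emb {M : Matrix m n A} (h : ∀ i j, par (M i j) = M i j) :
    ∃ N : Matrix m n (evenPart A), emb N = M :=
  ⟨Matrix.of fun i j => ⟨M i j, h i j⟩, rfl⟩

variable [DecidableEq m]

/-- An inverse over the whole algebra already has even entries: its parity image is an inverse of
the same matrix, so the two coincide. -/
theorem isUnit_det_of_isUnit_emb {M : Matrix m m (evenPart A)} (h : IsUnit (emb M)) :
    IsUnit M.det := by
  obtain ⟨w, hw⟩ := h
  have h1 : emb M * w⁻¹.1 = 1 := by rw [← hw]; exact w.mul_inv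
  have h2 : w⁻¹.1 * emb M = 1 := by rw [← hw]; exact w.inv_mul
  have h3 : emb M * (par : A →ₐ[ℂ] A).mapMatrix w⁻¹.1 = 1 := by
    have := congrArg (par : A →ₐ[ℂ] A).mapMatrix h1
    rw [map_mul, map_one] at this
    have e : (par : A →ₐ[ℂ] A).mapMatrix (emb M) = emb M :=
      Matrix.ext fun i j => par_coe (M i j)
    rwa [e] at this
  have h4 : (par : A →ₐ[ℂ] A).mapMatrix w⁻¹.1 = w⁻¹.1 := (left_inv_eq_right_inv h2 h3).symm
  obtain ⟨N, hN⟩ := exists_emb (fun i j => congrFun (congrFun h4 i) j)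
  refine Matrix.isUnit_det_of_right_inverse (B := N) (emb_injective ?_)
  rw [emb_mul, hN, h1, emb_one]

theorem emb_mul_inv {M : Matrix m m (evenPart A)} (h : IsUnit M.det) : emb M * emb M⁻¹ = 1 := by
  rw [← emb_mul, Matrix.mul_nonsing_inv _ h, emb_one]

theorem emb_inv_mul {M : Matrix m m (evenPart A)} (h : IsUnit M.det) : emb M⁻¹ * emb M = 1 := by
  rw [← emb_mul, Matrix.nonsing_inv_mul _ h, emb_one]

theorem inverse_emb {M : Matrix m m (evenPart A)} (h : IsUnit M.det) :
    Ring.inverse (emb M) = emb M⁻¹ :=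
  Ring.inverse_unit ⟨emb M, emb M⁻¹, emb_mul_inv h, emb_inv_mul h⟩

end Embedding

theorem rowDet_emb {n : ℕ} (M : Matrix (Fin n) (Fin n) (evenPart A)) :
    rowDet (emb M) = (M.det : A) := by
  rw [← Matrix.det_transpose, Matrix.det_apply, rowDet, AddSubmonoidClass.coe_finsetSum]
  refine Finset.sum_congr rfl fun σ _ => ?_
  have h : (List.ofFn fun i => emb M i (σ i)).prod
      = ((∏ i, M i (σ i) : evenPart A) : A) := by
    rw [← List.prod_ofFn]
    have := map_list_prod (evenPart A).val (List.ofFn fun i => M i (σ i))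
    rw [List.map_ofFn] at this
    exact this.symm
  rw [h]
  simp [Matrix.transpose_apply, Units.smul_def]

/-- In `rowDet` the last row supplies the last factor of each product, so the even cofactors stand
on the left and the entries of `y` may have any parity. -/
theorem rowDet_updateRow_last {n : ℕ} (M : Matrix (Fin (n + 1)) (Fin (n + 1)) (evenPart A))
    (y : Fin (n + 1) → A) :
    rowDet ((emb M).updateRow (Fin.last n) y)
      = ∑ j, (M.adjugate j (Fin.last n) : A) * y j := by
  have h (j) : (M.adjugate j (Fin.last n) : A)
      = rowDet ((emb M).updateRow (Fin.last n) (Pi.single j 1)) := by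
    rw [Matrix.adjugate_apply, ← rowDet_emb]
    congr 1
    ext i l
    rw [emb_apply]
    by_cases hi : i = Fin.last n
    · subst hi
      rw [Matrix.updateRow_self, Matrix.updateRow_self, Pi.single_apply, Pi.single_apply]
      split_ifs <;> rfl
    · rw [Matrix.updateRow_ne hi, Matrix.updateRow_ne hi, emb_apply]
  simp only [h, rowDet, Finset.sum_mul]
  rw [Finset.sum_comm]
  refine Finset.sum_congr rfl fun σ _ => ?_
  simp only [List.ofFn_succ', List.concat_eq_append, List.prod_append, List.prod_singleton,
    Matrix.updateRow_self, Matrix.updateRow_ne (Fin.castSucc_lt_last _).ne, smul_mul_assoc,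
    ← Finset.smul_sum, mul_assoc, ← Finset.mul_sum]
  congr 2
  rw [Finset.sum_eq_single (σ (Fin.last n))]
  · simp
  · intro j _ hj
    rw [Pi.single_eq_of_ne' hj, zero_mul]
  · intro h'
    exact absurd (Finset.mem_univ _) h'

/-- Cramer's rule for a row of arbitrary elements. -/
theorem rowDet_updateRow_vecMul {n : ℕ} (M : Matrix (Fin (n + 1)) (Fin (n + 1)) (evenPart A))
    (x : Fin (n + 1) → A) :
    rowDet ((emb M).updateRow (Fin.last n) (Matrix.vecMul x (emb M)))
      = x (Fin.last n) * (M.det : A) := by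
  rw [rowDet_updateRow_last]
  simp only [Matrix.vecMul, dotProduct, Finset.mul_sum]
  rw [Finset.sum_comm]
  have h (i) : ∑ j, (M.adjugate j (Fin.last n) : A) * (x i * emb M i j)
      = x i * ((M * M.adjugate) i (Fin.last n) : A) := by
    rw [Matrix.mul_apply, AddSubmonoidClass.coe_finsetSum, Finset.mul_sum]
    refine Finset.sum_congr rfl fun j _ => ?_
    rw [coe_comm, mul_assoc]
    rfl
  simp only [h, Matrix.mul_adjugate]
  rw [Finset.sum_eq_single (Fin.last n)]
  · simp
  · intro i _ hi
    simp [Matrix.one_apply_ne hi]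
  · intro h'
    exact absurd (Finset.mem_univ _) h'

end EvenPart

/-! ### Derivative of the superdeterminant -/

section SuperMatrices

variable {A : Type*} [Ring A] [Algebra ℂ A] [SuperDiffAlgebra A]

open SuperDiffAlgebra

theorem D_coe_mul (r s : evenPart A) : D ((r * s : evenPart A) : A) = D (r : A) * s + r * D (s : A) := by
  rw [Subalgebra.coe_mul, D_mul, par_coe]

theorem D_coe_prod {ι : Type*} [DecidableEq ι] (s : Finset ι) (f : ι → evenPart A) :
    D ((∏ i ∈ s, f i : evenPart A) : A)
      = ∑ i ∈ s, ((∏ j ∈ s.erase i, f j : evenPart A) : A) * D (f i : A) := by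
  induction s using Finset.induction_on with
  | empty => simp [D_one]
  | insert a s ha ih =>
    rw [Finset.prod_insert ha, D_coe_mul, ih, Finset.sum_insert ha, Finset.erase_insert ha,
      ← coe_comm, Finset.mul_sum]
    congr 1
    refine Finset.sum_congr rfl fun i hi => ?_
    have hne : a ≠ i := fun h => ha (h ▸ hi)
    rw [Finset.erase_insert_of_ne hne, Finset.prod_insert (fun h => ha (Finset.mem_of_mem_erase h)),
      Subalgebra.coe_mul, mul_assoc]

/-- Jacobi's formula. -/
theorem D_det {n : ℕ} (M : Matrix (Fin n) (Fin n) (evenPart A)) :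
    D (M.det : A) = (emb M.adjugate * (emb M).map D).trace := by
  have hadj (i j) : (M.adjugate i j : A) = ∑ σ : Equiv.Perm (Fin n),
      (Equiv.Perm.sign σ : ℤ) • (((∏ l ∈ Finset.univ.erase j, M l (σ l) : evenPart A) : A)
        * (if σ j = i then 1 else 0)) := by
    rw [Matrix.adjugate_apply, ← Matrix.det_transpose, Matrix.det_apply,
      AddSubmonoidClass.coe_finsetSum]
    refine Finset.sum_congr rfl fun σ _ => ?_
    rw [← Finset.prod_erase_mul _ _ (Finset.mem_univ j)]
    have h1 : ∏ l ∈ Finset.univ.erase j, (M.updateRow j (Pi.single i 1)).transpose (σ l) l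
        = ∏ l ∈ Finset.univ.erase j, M l (σ l) := by
      refine Finset.prod_congr rfl fun l hl => ?_
      rw [Matrix.transpose_apply, Matrix.updateRow_ne (Finset.ne_of_mem_erase hl)]
    rw [h1, Matrix.transpose_apply, Matrix.updateRow_self, Pi.single_apply]
    split_ifs <;> simp [Units.smul_def]
  have hdet : D (M.det : A) = ∑ σ : Equiv.Perm (Fin n), ∑ j,
      (Equiv.Perm.sign σ : ℤ) • (((∏ l ∈ Finset.univ.erase j, M l (σ l) : evenPart A) : A)
        * D (M j (σ j) : A)) := by
    rw [← Matrix.det_transpose, Matrix.det_apply, AddSubmonoidClass.coe_finsetSum, map_sum]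
    refine Finset.sum_congr rfl fun σ _ => ?_
    rw [← Finset.smul_sum, ← D_coe_prod]
    simp [Units.smul_def, Matrix.transpose_apply]
    rw [← zsmul_eq_mul, ← zsmul_eq_mul, map_zsmul]
  rw [hdet, Finset.sum_comm]
  simp only [Matrix.trace, Matrix.diag_apply, Matrix.mul_apply, emb_apply, hadj, Matrix.map_apply,
    Finset.sum_mul]
  rw [Finset.sum_comm (s := Finset.univ (α := Fin n)) (t := Finset.univ (α := Fin n))]
  refine Finset.sum_congr rfl fun j _ => ?_
  rw [Finset.sum_comm]
  refine Finset.sum_congr rfl fun σ _ => ?_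
  simp only [smul_mul_assoc, mul_assoc, ← Finset.smul_sum]
  congr 1
  rw [Finset.sum_eq_single (σ j)]
  · simp
  · intro i _ hi
    simp [hi.symm]
  · intro h
    exact absurd (Finset.mem_univ _) h

section Rectangular

variable {l m n : Type*} [Fintype l] [Fintype m] [Fintype n]

theorem map_D_mul (X : Matrix l m A) (Y : Matrix m n A) :
    (X * Y).map D = X.map D * Y + X.map par * Y.map D := by
  ext i j
  simp [Matrix.mul_apply, D_mul, Finset.sum_add_distrib]

theorem map_par_mul (X : Matrix l m A) (Y : Matrix m n A) :
    (X * Y).map par = X.map par * Y.map par := by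
  ext i j
  simp [Matrix.mul_apply]

theorem map_par_emb (X : Matrix m n (evenPart A)) : (emb X).map par = emb X :=
  Matrix.ext fun i j => par_coe (X i j)

theorem map_D_one [DecidableEq m] : (1 : Matrix m m A).map D = 0 := by
  ext i j
  rw [Matrix.map_apply, Matrix.one_apply]
  split_ifs <;> simp [D_one]

theorem trace_emb_mul (X : Matrix m n (evenPart A)) (Y : Matrix n m A) :
    (emb X * Y).trace = (Y * emb X).trace := by
  simp only [Matrix.trace, Matrix.diag_apply, Matrix.mul_apply]
  rw [Finset.sum_comm]
  exact Finset.sum_congr rfl fun i _ => Finset.sum_congr rfl fun j _ => coe_comm _ _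

theorem map_D_emb_inv [DecidableEq m] {E : Matrix m m (evenPart A)} (hE : IsUnit E.det) :
    (emb E⁻¹).map D = -(emb E⁻¹ * (emb E).map D * emb E⁻¹) := by
  have h := congrArg (fun X => Matrix.map X (D : A →ₗ[ℂ] A)) (emb_mul_inv hE)
  simp only [map_D_mul, map_par_emb, map_D_one] at h
  have h2 := congrArg (fun X => emb E⁻¹ * X) h
  simp only [mul_add, ← mul_assoc, emb_inv_mul hE, one_mul, mul_zero] at h2
  exact eq_neg_of_add_eq_zero_right h2

theorem D_det_of_isUnit {n : ℕ} {M : Matrix (Fin n) (Fin n) (evenPart A)} (hM : IsUnit M.det) :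
    D (M.det : A) = (M.det : A) * (emb M⁻¹ * (emb M).map D).trace := by
  have h : M.adjugate = M.det • M⁻¹ := by
    rw [Matrix.inv_def, smul_smul, Ring.mul_inverse_cancel _ hM, one_smul]
  have h' : emb (M.det • M⁻¹) = (M.det : A) • emb M⁻¹ := rfl
  rw [D_det, h, h', Matrix.smul_mul, Matrix.trace_smul, smul_eq_mul]

theorem map_par_of_odd {X : Matrix m n A} (hX : ∀ i j, par (X i j) = -X i j) :
    X.map par = -X :=
  Matrix.ext hX

/-- The Schur complement of an even supermatrix has even entries, and it is invertible. -/
theorem exists_schur [DecidableEq m] [DecidableEq n] {a : Matrix m m (evenPart A)}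
    {B : Matrix m n A} {C : Matrix n m A} (E : Matrix n n (evenPart A)) (ha : IsUnit a.det)
    (hB : ∀ i j, par (B i j) = -B i j) (hC : ∀ i j, par (C i j) = -C i j) :
    ∃ S : Matrix m m (evenPart A), emb S = emb a - B * emb E⁻¹ * C ∧ IsUnit S.det := by
  have hX : ∀ i j, par ((B * emb E⁻¹) i j) = -(B * emb E⁻¹) i j := by
    have h : (B * emb E⁻¹).map par = -(B * emb E⁻¹) := by
      rw [map_par_mul, map_par_emb, map_par_of_odd hB, Matrix.neg_mul]
    exact fun i j => congrFun (congrFun h i) j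
  set X := B * emb E⁻¹
  have hp (i : m) (j : n) (l : m) : par (X i j * C j l) = X i j * C j l := by
    rw [map_mul, hX, hC, neg_mul_neg]
  set N : Matrix m m (evenPart A) :=
    Matrix.of fun i l => ∑ j, ⟨X i j * C j l, hp i j l⟩ with hN
  have hN' : emb N = X * C := by
    ext i l
    simp [hN, emb_apply, Matrix.mul_apply]
  refine ⟨a - N, by rw [emb_sub, hN'], isUnit_det_sub_of_nilpotent ha fun i l => ?_⟩
  rw [hN, Matrix.of_apply]
  -- Every summand is a product of two odd elements, hence has square zero.
  refine mem_nilradical.1 (sum_mem fun j _ => mem_nilradical.2 ⟨2, Subtype.ext ?_⟩)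
  change (X i j * C j l) ^ 2 = 0
  have h1 : C j l * X i j = -(X i j * C j l) := odd_anticomm _ _ (hC j l) (hX i j)
  rw [pow_two, mul_assoc, ← mul_assoc (C j l), h1, neg_mul, mul_assoc, odd_mul_self (hC j l)]
  simp

end Rectangular

/-- The logarithmic derivative of the superdeterminant of a super Wronski matrix. -/
theorem dlog_sdet {k : ℕ} {a E S Ω : Matrix (Fin k) (Fin k) (evenPart A)}
    {B C Γ : Matrix (Fin k) (Fin k) A} (hE : IsUnit E.det) (hS : IsUnit S.det)
    (hB : ∀ i j, par (B i j) = -B i j)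
    (hSdef : emb S = emb a - B * emb E⁻¹ * C)
    (hDa : (emb a).map D = C) (hDB : B.map D = emb E)
    (hDC : C.map D = emb Ω * emb a - Γ * C) (hDE : (emb E).map D = emb Ω * B - Γ * emb E) :
    Ring.inverse ((S.det * Ring.inverse E.det : evenPart A) : A)
      * D ((S.det * Ring.inverse E.det : evenPart A) : A) = Γ.trace := by
  have hEF := emb_mul_inv hE
  have hFE := emb_inv_mul hE
  -- The hypotheses say that `D` sends the upper rows to the lower ones, and the lower rows to `Ω`
  -- times the upper minus `Γ` times the lower. In `D S` the `Γ` terms cancel and the rest factors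
  -- through `S`.
  have hDS : (emb S).map D = B * emb E⁻¹ * emb Ω * emb S := by
    have h : (emb S).map D = (emb a).map D - (B * emb E⁻¹ * C).map D := by
      rw [hSdef]
      ext i j
      simp
    rw [h, map_D_mul, map_D_mul, map_par_mul, map_par_emb, map_par_of_odd hB, map_D_emb_inv hE, hDa,
      hDB, hDC, hDE, hSdef]
    have e1 : B * (emb E⁻¹ * (emb Ω * B - Γ * emb E) * emb E⁻¹)
        = B * emb E⁻¹ * emb Ω * B * emb E⁻¹ - B * emb E⁻¹ * Γ := by
      rw [mul_sub, sub_mul, mul_sub, ← mul_assoc (emb E⁻¹) Γ, mul_assoc _ (emb E), hEF]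
      noncomm_ring
    rw [hEF, neg_mul_neg, e1]
    noncomm_ring
  -- The logarithmic derivatives of `det S` and `det E` are the traces in `ht1` and `ht2`; their
  -- difference is the trace of `Γ`. Cyclicity of the trace is legitimate because one of the factors
  -- always has even entries.
  have ht1 : (emb S⁻¹ * (emb S).map D).trace = (B * emb E⁻¹ * emb Ω).trace := by
    rw [hDS, trace_emb_mul, mul_assoc, emb_mul_inv hS, mul_one]
  have ht2 : (emb E⁻¹ * (emb E).map D).trace = (B * emb E⁻¹ * emb Ω).trace - Γ.trace := by
    rw [hDE, mul_sub, Matrix.trace_sub, trace_emb_mul E⁻¹ (Γ * emb E), mul_assoc, hEF, mul_one,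
      ← mul_assoc, ← emb_mul, trace_emb_mul, emb_mul, mul_assoc]
  have hDs := D_det_of_isUnit hS
  have hDe := D_det_of_isUnit hE
  rw [ht1] at hDs
  rw [ht2] at hDe
  generalize (B * emb E⁻¹ * emb Ω).trace = t at hDs hDe
  generalize S.det = s at hS hDs ⊢
  generalize E.det = e at hE hDe ⊢
  obtain ⟨e', rfl⟩ := hE
  obtain ⟨s', rfl⟩ := hS
  rw [Ring.inverse_unit]
  have hunit : Ring.inverse ((s' * (e'⁻¹ : (evenPart A)ˣ) : evenPart A) : A)
      = ((e' * (s'⁻¹ : (evenPart A)ˣ) : evenPart A) : A) := by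
    rw [← Units.val_mul, isUnit_coe_inverse (s' * e'⁻¹).isUnit, Ring.inverse_unit, mul_inv_rev,
      inv_inv, Units.val_mul]
  have hee : (e' : evenPart A) * (e'⁻¹ : (evenPart A)ˣ) = 1 := e'.mul_inv
  have hss : (s' : evenPart A) * (s'⁻¹ : (evenPart A)ˣ) = 1 := s'.mul_inv
  have hDinv : D (((e'⁻¹ : (evenPart A)ˣ) : evenPart A) : A)
      = -((((e'⁻¹ : (evenPart A)ˣ) : evenPart A) : A) * (t - Γ.trace)) := by
    have h := congrArg (fun r : evenPart A => D (r : A)) hee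
    simp only [D_coe_mul, hDe, OneMemClass.coe_one, D_one] at h
    have h2 := congrArg (fun x => (((e'⁻¹ : (evenPart A)ˣ) : evenPart A) : A) * x) h
    simp only [mul_add, ← mul_assoc, ← Subalgebra.coe_mul, e'.inv_mul, OneMemClass.coe_one, one_mul,
      mul_zero] at h2
    rw [← coe_comm] at h2
    exact eq_neg_of_add_eq_zero_right h2
  rw [hunit, D_coe_mul, hDs, hDinv, ← coe_comm]
  have e1 : ((e' * (s'⁻¹ : (evenPart A)ˣ) : evenPart A) : A)
      * ((((e'⁻¹ : (evenPart A)ˣ) : evenPart A) : A) * (((s' : evenPart A) : A) * t)) = t := by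
    rw [← mul_assoc, ← mul_assoc, ← Subalgebra.coe_mul, ← Subalgebra.coe_mul]
    have : (e' : evenPart A) * (s'⁻¹ : (evenPart A)ˣ) * (e'⁻¹ : (evenPart A)ˣ) * s' = 1 := by
      linear_combination hee * ((s' : evenPart A) * (s'⁻¹ : (evenPart A)ˣ)) + hss
    rw [this, OneMemClass.coe_one, one_mul]
  have e2 (x : A) : ((e' * (s'⁻¹ : (evenPart A)ˣ) : evenPart A) : A)
      * (((s' : evenPart A) : A) * (((e'⁻¹ : (evenPart A)ˣ) : evenPart A) : A) * x) = x := by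
    rw [← mul_assoc, ← Subalgebra.coe_mul, ← Subalgebra.coe_mul]
    have : (e' : evenPart A) * (s'⁻¹ : (evenPart A)ˣ) * (s' * (e'⁻¹ : (evenPart A)ˣ)) = 1 := by
      linear_combination hee * ((s' : evenPart A) * (s'⁻¹ : (evenPart A)ˣ)) + hss
    rw [this, OneMemClass.coe_one, one_mul]
  rw [mul_neg, mul_add, e1, mul_neg, ← mul_assoc (((s' : evenPart A) : A)), e2]
  abel

end SuperMatrices

/-! ### Block elimination, Cramer's rule and quotients of Berezinians -/

section Blocks

variable {A : Type*} [Ring A] [Algebra ℂ A] [SuperDiffAlgebra A]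

open SuperDiffAlgebra Matrix

theorem updateRow_mul_eq {l m n : Type*} [DecidableEq l] [Fintype m] (M : Matrix l m A) (i : l)
    (v : m → A) (N : Matrix m n A) : M.updateRow i v * N = (M * N).updateRow i (v ᵥ* N) := by
  ext r c
  by_cases h : r = i
  · subst h
    simp [Matrix.mul_apply, Matrix.vecMul, dotProduct]
  · simp [Matrix.mul_apply, Matrix.updateRow_ne h]

theorem updateRow_sub_updateRow {l m : Type*} [DecidableEq l] (M N : Matrix l m A) (i : l)
    (v w : m → A) : M.updateRow i v - N.updateRow i w = (M - N).updateRow i (v - w) := by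
  ext r c
  by_cases h : r = i
  · subst h
    simp
  · simp [Matrix.updateRow_ne h]

theorem emb_updateRow {m n : Type*} [Fintype m] [Fintype n] [DecidableEq m]
    (M : Matrix m n (evenPart A)) (i : m) (v : n → evenPart A) :
    emb (M.updateRow i v) = (emb M).updateRow i (fun j => (v j : A)) := by
  ext r c
  by_cases h : r = i
  · subst h
    simp [emb_apply]
  · simp [emb_apply, Matrix.updateRow_ne h]

section Solve

variable {m n : Type*} [Fintype m] [Fintype n] [DecidableEq m] [DecidableEq n]
  {a S : Matrix m m (evenPart A)} {B : Matrix m n A} {C : Matrix n m A}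
  {E : Matrix n n (evenPart A)}

/-- Block elimination: the second equation, multiplied by `E⁻¹C` from the right and subtracted from
the first, removes `c`. -/
theorem vecMul_schur (hE : IsUnit E.det) (hS : emb S = emb a - B * emb E⁻¹ * C)
    {b v₀ : m → A} {c v₁ : n → A} (h₀ : b ᵥ* emb a + c ᵥ* C = v₀) (h₁ : b ᵥ* B + c ᵥ* emb E = v₁) :
    b ᵥ* emb S = v₀ - v₁ ᵥ* (emb E⁻¹ * C) := by
  rw [hS, ← h₀, ← h₁, Matrix.vecMul_sub, Matrix.add_vecMul, Matrix.vecMul_vecMul,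
    Matrix.vecMul_vecMul, ← Matrix.mul_assoc, ← Matrix.mul_assoc, emb_mul_inv hE, Matrix.one_mul]
  abel

theorem block_solve_unique (hE : IsUnit E.det) (hSu : IsUnit S.det)
    (hS : emb S = emb a - B * emb E⁻¹ * C) {b : m → A} {c : n → A}
    (h₀ : b ᵥ* emb a + c ᵥ* C = 0) (h₁ : b ᵥ* B + c ᵥ* emb E = 0) : b = 0 ∧ c = 0 := by
  have h := congrArg (fun v => v ᵥ* emb S⁻¹) (vecMul_schur hE hS h₀ h₁)
  simp only [Matrix.vecMul_vecMul, emb_mul_inv hSu, Matrix.vecMul_one, Matrix.zero_vecMul,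
    sub_zero] at h
  subst h
  rw [Matrix.zero_vecMul, zero_add] at h₁
  have h := congrArg (fun v => v ᵥ* emb E⁻¹) h₁
  simp only [Matrix.vecMul_vecMul, emb_mul_inv hE, Matrix.vecMul_one, Matrix.zero_vecMul] at h
  exact ⟨rfl, h⟩

theorem block_solve_exists (hE : IsUnit E.det) (hSu : IsUnit S.det)
    (hS : emb S = emb a - B * emb E⁻¹ * C) (v₀ : m → A) (v₁ : n → A) :
    ∃ (b : m → A) (c : n → A), b ᵥ* emb a + c ᵥ* C = v₀ ∧ b ᵥ* B + c ᵥ* emb E = v₁ := by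
  obtain ⟨b, hb⟩ : ∃ b : m → A, b ᵥ* emb S = v₀ - v₁ ᵥ* (emb E⁻¹ * C) :=
    ⟨(v₀ - v₁ ᵥ* (emb E⁻¹ * C)) ᵥ* emb S⁻¹, by
      rw [Matrix.vecMul_vecMul, emb_inv_mul hSu, Matrix.vecMul_one]⟩
  refine ⟨b, (v₁ - b ᵥ* B) ᵥ* emb E⁻¹, ?_, ?_⟩
  · rw [hS, Matrix.vecMul_sub, sub_eq_iff_eq_add] at hb
    rw [hb, Matrix.vecMul_vecMul, Matrix.sub_vecMul, Matrix.vecMul_vecMul, Matrix.mul_assoc]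
    abel
  · rw [Matrix.vecMul_vecMul, emb_inv_mul hE, Matrix.vecMul_one]
    abel

end Solve

/-- By elimination the new last row of the Schur complement is `-b S`, so Cramer's rule isolates the
last entry of `b`. That entry may be even or odd, which covers `𝒲̂` for even `n` and the numerator
of `R` for odd `n`. -/
theorem rowDet_schur_updateRow {p q : ℕ} {a S : Matrix (Fin (p + 1)) (Fin (p + 1)) (evenPart A)}
    {B : Matrix (Fin (p + 1)) (Fin q) A} {C : Matrix (Fin q) (Fin (p + 1)) A}
    {E : Matrix (Fin q) (Fin q) (evenPart A)} (hE : IsUnit E.det)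
    (hS : emb S = emb a - B * emb E⁻¹ * C) {b v₀ : Fin (p + 1) → A} {c v₁ : Fin q → A}
    (h₀ : b ᵥ* emb a + c ᵥ* C = -v₀) (h₁ : b ᵥ* B + c ᵥ* emb E = -v₁) :
    rowDet ((emb a).updateRow (Fin.last p) v₀ - B.updateRow (Fin.last p) v₁ * emb E⁻¹ * C)
      = -(b (Fin.last p) * (S.det : A)) := by
  have h := vecMul_schur hE hS h₀ h₁
  have h' : (-b) ᵥ* emb S = v₀ - v₁ ᵥ* (emb E⁻¹ * C) := by
    rw [Matrix.neg_vecMul, h, Matrix.neg_vecMul]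
    abel
  rw [Matrix.mul_assoc, updateRow_mul_eq, updateRow_sub_updateRow, ← h', ← Matrix.mul_assoc, ← hS,
    rowDet_updateRow_vecMul, Pi.neg_apply, neg_mul]

theorem inverse_eq_of_mul_eq_one {R : Type*} [CommRing R] {x y : R} (h : x * y = 1) :
    Ring.inverse x = y :=
  Ring.inverse_unit ⟨x, y, h, by rw [mul_comm, h]⟩

/-- The last lower row is replaced by the combination `-(b, c)` of all rows. On `E` this acts as `E'
= G E` with `det G = γ`, and on the Schur complement as `S' = (1 + Q) S`, where `Q` is an odd
rank-one matrix. By `det_one_add_odd_rank_one` the quotient of Berezinians is `γ (1 - tr Q)`, in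
which the contributions of `b` cancel and only the last entry of `-c` survives. -/
theorem lower_coefficient {p q : ℕ} {a S S' : Matrix (Fin p) (Fin p) (evenPart A)}
    {B : Matrix (Fin p) (Fin (q + 1)) A} {C : Matrix (Fin (q + 1)) (Fin p) A}
    {E E' : Matrix (Fin (q + 1)) (Fin (q + 1)) (evenPart A)}
    (hE : IsUnit E.det) (hE' : IsUnit E'.det) (hSu : IsUnit S.det)
    (hS : emb S = emb a - B * emb E⁻¹ * C) {b v₀ : Fin p → A} {c : Fin (q + 1) → evenPart A}
    {v₁ : Fin (q + 1) → A}
    (hS' : emb S' = emb a - B * emb E'⁻¹ * C.updateRow (Fin.last q) v₀)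
    (hEE' : emb E' = (emb E).updateRow (Fin.last q) v₁)
    (hB : ∀ i j, par (B i j) = -B i j) (hb : ∀ i, par (b i) = -b i)
    (h₀ : b ᵥ* emb a + (fun i => (c i : A)) ᵥ* C = -v₀)
    (h₁ : b ᵥ* B + (fun i => (c i : A)) ᵥ* emb E = -v₁) :
    S.det * Ring.inverse E.det * Ring.inverse (S'.det * Ring.inverse E'.det)
      = -c (Fin.last q) := by
  set X := B * emb E⁻¹ with hX
  have hXodd : ∀ i j, par (X i j) = -X i j := by
    have h : X.map par = -X := by
      rw [hX, map_par_mul, map_par_emb, map_par_of_odd hB, Matrix.neg_mul]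
    exact fun i j => congrFun (congrFun h i) j
  have hbX (i : Fin p) (j) : par (b i * X i j) = b i * X i j := by
    rw [map_mul, hb, hXodd, neg_mul_neg]
  obtain ⟨w, hw⟩ : ∃ w : Fin (q + 1) → evenPart A, (fun j => (w j : A)) = b ᵥ* X := by
    refine ⟨fun j => ∑ i, ⟨b i * X i j, hbX i j⟩, ?_⟩
    ext j
    simp [Matrix.vecMul, dotProduct]
  -- `w = b B E⁻¹` rewrites the upper rows of the right blocks in terms of `E`, so the replaced row
  -- of `E` is `(-c - w) E`.
  set G : Matrix (Fin (q + 1)) (Fin (q + 1)) (evenPart A) :=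
    (1 : Matrix _ _ (evenPart A)).updateRow (Fin.last q) (fun j => -c j - w j) with hG
  set γ := -c (Fin.last q) - w (Fin.last q) with hγ
  have hGdet : G.det = γ := det_one_updateRow _ _
  have hbB : (b ᵥ* X) ᵥ* emb E = b ᵥ* B := by
    rw [Matrix.vecMul_vecMul, hX, Matrix.mul_assoc, emb_inv_mul hE, Matrix.mul_one]
  have hrow : (fun j => ((-c j - w j : evenPart A) : A)) = -(fun j => (c j : A)) - b ᵥ* X := by
    rw [← hw]
    rfl
  have hembG (n : ℕ) (M : Matrix (Fin (q + 1)) (Fin n) A) : emb G * M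
      = M.updateRow (Fin.last q) ((-(fun j => (c j : A)) - b ᵥ* X) ᵥ* M) := by
    rw [hG, emb_updateRow, emb_one, updateRow_mul_eq, Matrix.one_mul, hrow]
  have hGE : G * E = E' := by
    refine emb_injective ?_
    rw [emb_mul, hembG, hEE', Matrix.sub_vecMul, Matrix.neg_vecMul, hbB, ← neg_eq_iff_eq_neg.2 h₁]
    congr 1
    abel
  have hE'det : E'.det = γ * E.det := by rw [← hGE, Matrix.det_mul, hGdet]
  have hγu : IsUnit γ := isUnit_of_mul_isUnit_left (hE'det ▸ hE')
  have hGu : IsUnit G.det := hGdet ▸ hγu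
  obtain ⟨γ', hγ'⟩ := hγu.exists_right_inv
  have hxb (i j : Fin p) : par (X i (Fin.last q) * γ' * b j) = X i (Fin.last q) * γ' * b j := by
    rw [map_mul, map_mul, hXodd, hb, par_coe, neg_mul, neg_mul_neg]
  set Q : Matrix (Fin p) (Fin p) (evenPart A) :=
    Matrix.of fun i j => ⟨X i (Fin.last q) * γ' * b j, hxb i j⟩ with hQ
  -- `H'` is `G⁻¹` applied to the matrix with single nonzero row `b` in last place; `γ'` is the
  -- inverse of `γ`, which is a unit because `det E'` is.
  set H' : Matrix (Fin (q + 1)) (Fin p) A :=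
    (0 : Matrix _ _ A).updateRow (Fin.last q) (fun j => (γ' : A) * b j) with hH'
  have hXH : X * H' = emb Q := by
    ext i j
    rw [Matrix.mul_apply, Finset.sum_eq_single (Fin.last q)]
    · rw [hH', Matrix.updateRow_self, ← mul_assoc]
      rfl
    · intro l _ hl
      rw [hH', Matrix.updateRow_ne hl, Matrix.zero_apply, mul_zero]
    · intro h
      exact absurd (Finset.mem_univ _) h
  have hGH : emb G * H' = (0 : Matrix _ _ A).updateRow (Fin.last q) b := by
    rw [hembG, hH']
    ext i j
    by_cases hi : i = Fin.last q
    · subst hi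
      rw [Matrix.updateRow_self, Matrix.updateRow_self, Matrix.vecMul, dotProduct,
        Finset.sum_eq_single (Fin.last q)]
      · rw [Matrix.updateRow_self, ← mul_assoc, ← hrow]
        change ((γ : A) * (γ' : A)) * b j = b j
        rw [← Subalgebra.coe_mul, hγ', OneMemClass.coe_one, one_mul]
      · intro l _ hl
        rw [Matrix.updateRow_ne hl, Matrix.zero_apply, mul_zero]
      · intro h
        exact absurd (Finset.mem_univ _) h
    · rw [Matrix.updateRow_ne hi, Matrix.updateRow_ne hi, Matrix.updateRow_ne hi]
  -- This form cancels the `G⁻¹` in `E'⁻¹ = E⁻¹G⁻¹`, so that `S' = S + X H' S = (1 + Q) S`.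
  have hC : C.updateRow (Fin.last q) v₀ = emb G * (C - H' * emb S) := by
    have hbS : b ᵥ* emb S = b ᵥ* emb a - (b ᵥ* X) ᵥ* C := by
      rw [hS, Matrix.vecMul_sub, Matrix.vecMul_vecMul]
    rw [Matrix.mul_sub, ← Matrix.mul_assoc, hGH, hembG, updateRow_mul_eq, Matrix.zero_mul,
      updateRow_sub_updateRow, sub_zero, hbS, Matrix.sub_vecMul, Matrix.neg_vecMul,
      ← neg_eq_iff_eq_neg.2 h₀]
    congr 1
    abel
  have hSS : S' = (1 + Q) * S := by
    refine emb_injective ?_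
    rw [hS', hC, ← hGE, Matrix.mul_inv_rev, emb_mul, emb_mul, emb_add, emb_one, ← Matrix.mul_assoc B,
      ← hX, Matrix.mul_assoc X, ← Matrix.mul_assoc (emb G⁻¹), emb_inv_mul hGu, Matrix.one_mul,
      Matrix.mul_sub, ← Matrix.mul_assoc, hXH, Matrix.add_mul, Matrix.one_mul]
    nth_rw 2 [hS]
    abel
  have hQrel : ∀ i j k l, Q i j * Q k l = -(Q i l * Q k j) := by
    intro i j k l
    refine Subtype.ext ?_
    change X i (Fin.last q) * γ' * b j * (X k (Fin.last q) * γ' * b l)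
      = -(X i (Fin.last q) * γ' * b l * (X k (Fin.last q) * γ' * b j))
    have h1 : b j * (X k (Fin.last q) * γ') = -(X k (Fin.last q) * γ' * b j) := by
      rw [← mul_assoc, odd_anticomm _ _ (hb j) (hXodd k _), neg_mul, mul_assoc, mul_assoc, ← coe_comm]
    have h2 : b l * (X k (Fin.last q) * γ') = -(X k (Fin.last q) * γ' * b l) := by
      rw [← mul_assoc, odd_anticomm _ _ (hb l) (hXodd k _), neg_mul, mul_assoc, mul_assoc, ← coe_comm]
    have h3 := odd_anticomm _ _ (hb j) (hb l)
    calc _ = X i (Fin.last q) * γ' * (b j * (X k (Fin.last q) * γ')) * b l := by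
          simp only [mul_assoc]
      _ = -(X i (Fin.last q) * γ' * (X k (Fin.last q) * γ') * (b j * b l)) := by
          rw [h1]; simp only [mul_assoc, mul_neg, neg_mul]
      _ = X i (Fin.last q) * γ' * (X k (Fin.last q) * γ' * b l) * b j := by
          rw [h3]; simp only [mul_assoc, mul_neg, neg_neg]
      _ = _ := by
          rw [← neg_eq_iff_eq_neg.2 h2]; simp only [mul_assoc, mul_neg, neg_mul]
  have hdetQ := det_one_add_odd_rank_one Q hQrel
  have htr : Q.trace = -(γ' * w (Fin.last q)) := by
    refine Subtype.ext ?_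
    have hwl : (w (Fin.last q) : A) = ∑ i, b i * X i (Fin.last q) := congrFun hw _
    change ((∑ i, Q i i : evenPart A) : A) = -((γ' : A) * (w (Fin.last q) : A))
    rw [AddSubmonoidClass.coe_finsetSum, hwl, Finset.mul_sum, ← Finset.sum_neg_distrib]
    refine Finset.sum_congr rfl fun i _ => ?_
    change X i (Fin.last q) * γ' * b i = _
    rw [← coe_comm, mul_assoc, odd_anticomm _ _ (hXodd i _) (hb i), mul_neg]
  -- Here `tr Q = -γ⁻¹w` and `γ = -c - w` in the last entry, so `γ(1 - tr Q) = γ + w = -c`.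
  have hfin : γ * (1 - Q.trace) = -c (Fin.last q) := by
    rw [htr]
    linear_combination hγ + w (Fin.last q) * hγ'
  have hS'det : S'.det = (1 + Q).det * S.det := by rw [hSS, Matrix.det_mul]
  have he := Ring.mul_inverse_cancel _ hE
  have hs := Ring.mul_inverse_cancel _ hSu
  have hee := Ring.mul_inverse_cancel _ hE'
  rw [hE'det] at hee ⊢
  rw [hS'det, inverse_eq_of_mul_eq_one (x := (1 + Q).det * S.det * Ring.inverse (γ * E.det))
    (y := (1 - Q.trace) * Ring.inverse S.det * (γ * E.det))]
  · rw [← hfin]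
    linear_combination (1 - Q.trace) * γ * (E.det * Ring.inverse E.det * hs + he)
  · linear_combination (S.det * Ring.inverse S.det) * (γ * E.det * Ring.inverse (γ * E.det)) * hdetQ
      + (γ * E.det * Ring.inverse (γ * E.det)) * hs + hee

end Blocks

/-! ### Super Wronski matrices and the kernel operator -/

section Wronskians

variable {A : Type*} [Ring A] [Algebra ℂ A] [SuperDiffAlgebra A]

open SuperDiffAlgebra Matrix

/-- The block with entries `D^(2r+s) θ_(2c+t)`. -/
def wronskiBlock (p q s t : ℕ) (θ : ℕ → A) : Matrix (Fin p) (Fin q) A :=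
  Matrix.of fun r c => (D ^ (2 * (r : ℕ) + s) : A →ₗ[ℂ] A) (θ (2 * c + t))

/-- The row with entries `Dᵐ θ_(2c+t)`. -/
def wronskiRow (m q t : ℕ) (θ : ℕ → A) : Fin q → A :=
  fun c => (D ^ m : A →ₗ[ℂ] A) (θ (2 * c + t))

theorem wronskiBlock_apply {p q s t : ℕ} (θ : ℕ → A) (r : Fin p) (c : Fin q) :
    wronskiBlock p q s t θ r c = (D ^ (2 * (r : ℕ) + s) : A →ₗ[ℂ] A) (θ (2 * c + t)) := rfl

theorem sum_range_two_mul {M : Type*} [AddCommMonoid M] (k : ℕ) (f : ℕ → M) :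
    ∑ i ∈ Finset.range (2 * k), f i
      = (∑ r : Fin k, f (2 * r)) + ∑ r : Fin k, f (2 * r + 1) := by
  induction k with
  | zero => simp
  | succ k ih =>
    rw [show 2 * (k + 1) = 2 * k + 1 + 1 by ring, Finset.sum_range_succ, Finset.sum_range_succ, ih,
      Fin.sum_univ_castSucc, Fin.sum_univ_castSucc]
    simp only [Fin.val_castSucc, Fin.val_last]
    abel

/-- The numbers of even and of odd indices among `0, …, n - 1` are `p` and `q`. -/
def Splits (n p q : ℕ) : Prop := n = p + q ∧ (p = q ∨ p = q + 1)

theorem Splits.sum {n p q : ℕ} (h : Splits n p q) {M : Type*} [AddCommMonoid M] (f : ℕ → M) :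
    ∑ i ∈ Finset.range n, f i = (∑ r : Fin p, f (2 * r)) + ∑ r : Fin q, f (2 * r + 1) := by
  obtain ⟨rfl, rfl | rfl⟩ := h
  · rw [← two_mul, sum_range_two_mul]
  · rw [show q + 1 + q = 2 * q + 1 by ring, Finset.sum_range_succ, sum_range_two_mul,
      Fin.sum_univ_castSucc]
    simp only [Fin.val_castSucc, Fin.val_last]
    abel

theorem Splits.even_lt {n p q : ℕ} (h : Splits n p q) (c : Fin p) : 2 * (c : ℕ) < n := by
  obtain ⟨rfl, rfl | rfl⟩ := h <;> omega

theorem Splits.odd_lt {n p q : ℕ} (h : Splits n p q) (c : Fin q) : 2 * (c : ℕ) + 1 < n := by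
  obtain ⟨rfl, rfl | rfl⟩ := h <;> omega

theorem Splits.forall_lt {n p q : ℕ} (h : Splits n p q) {C : ℕ → Prop}
    (h₀ : ∀ c : Fin p, C (2 * c)) (h₁ : ∀ c : Fin q, C (2 * c + 1)) : ∀ j < n, C j := by
  intro j hj
  rcases Nat.even_or_odd' j with ⟨c, rfl | rfl⟩
  · exact h₀ ⟨c, by obtain ⟨rfl, rfl | rfl⟩ := h <;> omega⟩
  · exact h₁ ⟨c, by obtain ⟨rfl, rfl | rfl⟩ := h <;> omega⟩

theorem Splits.sum_eq_vecMul {n p q : ℕ} (h : Splits n p q) (θ b : ℕ → A) {m t : ℕ} (c : Fin m) :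
    ∑ i ∈ Finset.range n, b i * (D ^ i : A →ₗ[ℂ] A) (θ (2 * c + t))
      = ((fun r : Fin p => b (2 * r)) ᵥ* wronskiBlock p m 0 t θ
        + (fun r : Fin q => b (2 * r + 1)) ᵥ* wronskiBlock q m 1 t θ) c :=
  h.sum fun i => b i * (D ^ i : A →ₗ[ℂ] A) (θ (2 * c + t))

theorem IsKernel.vecMul_even {n p q : ℕ} (h : Splits n p q) {θ a : ℕ → A} (hker : IsKernel n a θ) :
    (fun r : Fin p => a (2 * r)) ᵥ* wronskiBlock p p 0 0 θ
      + (fun r : Fin q => a (2 * r + 1)) ᵥ* wronskiBlock q p 1 0 θ = -wronskiRow n p 0 θ :=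
  funext fun c => by
    rw [← h.sum_eq_vecMul]
    exact eq_neg_of_add_eq_zero_right (hker (2 * c) (h.even_lt c))

theorem IsKernel.vecMul_odd {n p q : ℕ} (h : Splits n p q) {θ a : ℕ → A} (hker : IsKernel n a θ) :
    (fun r : Fin p => a (2 * r)) ᵥ* wronskiBlock p q 0 1 θ
      + (fun r : Fin q => a (2 * r + 1)) ᵥ* wronskiBlock q q 1 1 θ = -wronskiRow n q 1 θ :=
  funext fun c => by
    rw [← h.sum_eq_vecMul]
    exact eq_neg_of_add_eq_zero_right (hker (2 * c + 1) (h.odd_lt c))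

/-- An entry differs in parity from `s + t` only by an even number, so the diagonal blocks are even
and the others odd. -/
theorem par_wronskiBlock {n p q s t : ℕ} {θ : ℕ → A} (hpar : ∀ j < n, par (θ j) = (-1 : ℂ) ^ j • θ j)
    (hq : ∀ c : Fin q, 2 * (c : ℕ) + t < n) (r : Fin p) (c : Fin q) :
    par (wronskiBlock p q s t θ r c) = (-1 : ℂ) ^ (s + t) • wronskiBlock p q s t θ r c := by
  rw [wronskiBlock_apply, par_D_pow, hpar _ (hq c), map_smul, smul_smul]
  congr 1
  rw [← pow_add, show 2 * (r : ℕ) + s + (2 * c + t) = 2 * (r + c) + (s + t) by ring, pow_add,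
    pow_mul]
  simp

/-- The data extracted from an invertible super Wronski matrix. -/
theorem wronski_data {n p q : ℕ} (h : Splits n p q) {θ : ℕ → A}
    (hpar : ∀ j < n, par (θ j) = (-1 : ℂ) ^ j • θ j)
    (ha : IsUnit (wronskiBlock p p 0 0 θ)) (hE : IsUnit (wronskiBlock q q 1 1 θ)) :
    ∃ (a S : Matrix (Fin p) (Fin p) (evenPart A)) (E : Matrix (Fin q) (Fin q) (evenPart A)),
      emb a = wronskiBlock p p 0 0 θ ∧ emb E = wronskiBlock q q 1 1 θ ∧ IsUnit a.det ∧
      IsUnit E.det ∧ IsUnit S.det ∧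
      emb S = emb a - wronskiBlock p q 0 1 θ * emb E⁻¹ * wronskiBlock q p 1 0 θ ∧
      Nondegenerate n θ ∧ ∃ coeff : ℕ → A, IsKernel n coeff θ := by
  obtain ⟨a, hae⟩ := exists_emb (M := wronskiBlock p p 0 0 θ) fun i j => by
    simpa using par_wronskiBlock (s := 0) (t := 0) hpar h.even_lt i j
  obtain ⟨E, hEe⟩ := exists_emb (M := wronskiBlock q q 1 1 θ) fun i j => by
    simpa using par_wronskiBlock (s := 1) (t := 1) hpar h.odd_lt i j
  have hau : IsUnit a.det := isUnit_det_of_isUnit_emb (hae ▸ ha)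
  have hEu : IsUnit E.det := isUnit_det_of_isUnit_emb (hEe ▸ hE)
  obtain ⟨S, hS, hSu⟩ := exists_schur (B := wronskiBlock p q 0 1 θ) (C := wronskiBlock q p 1 0 θ)
    E hau
    (fun i j => by simpa using par_wronskiBlock (s := 0) (t := 1) hpar h.odd_lt i j)
    (fun i j => by simpa using par_wronskiBlock (s := 1) (t := 0) hpar h.even_lt i j)
  refine ⟨a, S, E, hae, hEe, hau, hEu, hSu, hS, fun b hb => ?_, ?_⟩
  · obtain ⟨h₀, h₁⟩ := block_solve_unique hEu hSu hS (b := fun r : Fin p => b (2 * r))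
      (c := fun r : Fin q => b (2 * r + 1))
      (funext fun c => by
        rw [hae, ← h.sum_eq_vecMul]
        exact hb _ (h.even_lt c))
      (funext fun c => by
        rw [hEe, ← h.sum_eq_vecMul]
        exact hb _ (h.odd_lt c))
    exact h.forall_lt (congrFun h₀) (congrFun h₁)
  · obtain ⟨b, c, h₀, h₁⟩ := block_solve_exists hEu hSu hS (-wronskiRow n p 0 θ)
      (-wronskiRow n q 1 θ)
    -- The two block solutions are interleaved: `b` gives the coefficients of even index, `c` those
    -- of odd index; the value 0 elsewhere is never used.
    let coeff : ℕ → A := fun i =>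
      if i % 2 = 0 then (if hi : i / 2 < p then b ⟨i / 2, hi⟩ else 0)
        else (if hi : i / 2 < q then c ⟨i / 2, hi⟩ else 0)
    have hb : (fun r : Fin p => coeff (2 * r)) = b := by
      funext r
      simp [coeff]
    have hc : (fun r : Fin q => coeff (2 * r + 1)) = c := by
      funext r
      have h1 : (2 * (r : ℕ) + 1) % 2 = 1 := by omega
      have h2 : (2 * (r : ℕ) + 1) / 2 = r := by omega
      simp [coeff, h1, h2]
    refine ⟨coeff, h.forall_lt (fun i => ?_) (fun i => ?_)⟩
    · have := h.sum_eq_vecMul θ coeff (t := 0) i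
      rw [hb, hc, ← hae, h₀] at this
      rw [add_eq_zero_iff_neg_eq]
      exact this.symm
    · have := h.sum_eq_vecMul θ coeff (t := 1) i
      rw [hb, hc, ← hEe, h₁] at this
      rw [add_eq_zero_iff_neg_eq]
      exact this.symm

theorem wronskiBlock_map_D (p q t : ℕ) (θ : ℕ → A) :
    (wronskiBlock p q 0 t θ).map D = wronskiBlock p q 1 t θ := by
  ext r c
  rw [Matrix.map_apply, wronskiBlock_apply, wronskiBlock_apply, pow_succ']
  rfl

/-- The companion matrix with last row `-b`. -/
def companion {k : ℕ} (b : Fin (k + 1) → evenPart A) :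
    Matrix (Fin (k + 1)) (Fin (k + 1)) (evenPart A) :=
  Matrix.of (Fin.snoc (α := fun _ => Fin (k + 1) → evenPart A)
    (fun i : Fin k => Pi.single i.succ 1) (-b))

/-- `D` takes the row `D²ʳ⁺¹θ` to `D²ʳ⁺²θ`, the next row of the upper block. Only the last row
leaves the matrix, and there the kernel relation brings it back. This supplies the `Ω` and `Γ` of
`dlog_sdet`. -/
theorem wronskiBlock_one_map_D {k q t : ℕ} {θ : ℕ → A} {b : Fin (k + 1) → evenPart A}
    {c : Fin (k + 1) → A}
    (h : (fun r => (b r : A)) ᵥ* wronskiBlock (k + 1) q 0 t θ + c ᵥ* wronskiBlock (k + 1) q 1 t θ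
      = -wronskiRow (2 * k + 2) q t θ) :
    (wronskiBlock (k + 1) q 1 t θ).map D
      = emb (companion b) * wronskiBlock (k + 1) q 0 t θ
        - (0 : Matrix (Fin (k + 1)) (Fin (k + 1)) A).updateRow (Fin.last k) c
          * wronskiBlock (k + 1) q 1 t θ := by
  have hD (r : Fin (k + 1)) (j : Fin q) : D (wronskiBlock (k + 1) q 1 t θ r j)
      = (D ^ (2 * (r : ℕ) + 2) : A →ₗ[ℂ] A) (θ (2 * j + t)) := by
    rw [wronskiBlock_apply, pow_succ' _ (2 * (r : ℕ) + 1)]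
    rfl
  ext i j
  rw [updateRow_mul_eq, Matrix.zero_mul, Matrix.map_apply, hD, Matrix.sub_apply, Matrix.mul_apply]
  induction i using Fin.lastCases with
  | last =>
    have hj := congrFun h j
    rw [Matrix.updateRow_self]
    have hs : ∑ l, emb (companion b) (Fin.last k) l * wronskiBlock (k + 1) q 0 t θ l j
        = -((fun r => (b r : A)) ᵥ* wronskiBlock (k + 1) q 0 t θ) j := by
      rw [Matrix.vecMul, dotProduct, ← Finset.sum_neg_distrib]
      refine Finset.sum_congr rfl fun l _ => ?_
      rw [emb_apply, companion, Matrix.of_apply, Fin.snoc_last]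
      change -(b l : A) * _ = _
      rw [neg_mul]
    rw [hs, ← neg_add', ← Pi.add_apply, h, Pi.neg_apply, neg_neg]
    rfl
  | cast i =>
    rw [Matrix.updateRow_ne (Fin.castSucc_lt_last i).ne, Finset.sum_eq_single i.succ]
    · rw [emb_apply, companion, Matrix.of_apply, Fin.snoc_castSucc, Pi.single_eq_same,
        wronskiBlock_apply]
      simp [mul_add]
    · intro l _ hl
      rw [emb_apply, companion, Matrix.of_apply, Fin.snoc_castSucc, Pi.single_eq_of_ne hl]
      simp
    · intro h'
      exact absurd (Finset.mem_univ _) h'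

theorem trace_updateRow_last {k : ℕ} (c : Fin (k + 1) → A) :
    ((0 : Matrix (Fin (k + 1)) (Fin (k + 1)) A).updateRow (Fin.last k) c).trace
      = c (Fin.last k) := by
  rw [Matrix.trace, Fin.sum_univ_castSucc, Finset.sum_eq_zero, zero_add, Matrix.diag_apply,
    Matrix.updateRow_self]
  intro i _
  rw [Matrix.diag_apply, Matrix.updateRow_ne (Fin.castSucc_lt_last i).ne, Matrix.zero_apply]

theorem schur_fromBlocks {p q : ℕ} {X : Matrix (Fin p) (Fin p) A} {B : Matrix (Fin p) (Fin q) A}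
    {C : Matrix (Fin q) (Fin p) A} {E : Matrix (Fin q) (Fin q) (evenPart A)} (hE : IsUnit E.det) :
    schur (Matrix.fromBlocks X B C (emb E)) = X - B * emb E⁻¹ * C := by
  rw [schur, Matrix.toBlocks_fromBlocks₁₁, Matrix.toBlocks_fromBlocks₁₂,
    Matrix.toBlocks_fromBlocks₂₁, Matrix.toBlocks_fromBlocks₂₂, inverse_emb hE]

theorem sdet_fromBlocks {p q : ℕ} {X : Matrix (Fin p) (Fin p) A} {B : Matrix (Fin p) (Fin q) A}
    {C : Matrix (Fin q) (Fin p) A} {E : Matrix (Fin q) (Fin q) (evenPart A)} (hE : IsUnit E.det) :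
    sdet (Matrix.fromBlocks X B C (emb E))
      = rowDet (X - B * emb E⁻¹ * C) * ((Ring.inverse E.det : evenPart A) : A) := by
  rw [sdet, schur_fromBlocks hE, Matrix.toBlocks_fromBlocks₂₂, rowDet_emb, isUnit_coe_inverse hE]

end Wronskians

/-! ### The Darboux transformations for superfields -/

section Superfields

variable {U : TopologicalSpace.Opens (ℂ × ℂ)} {V : Type*} [AddCommGroup V] [Module ℂ V]

open SuperDiffAlgebra

theorem dX_eq_dx (f : Superfield U V) : dX f = dx f := (superD_superD f).symm

theorem rowX_eq (r : ℕ) (f : Superfield U V) : rowX r f = (D ^ (2 * r) : _ →ₗ[ℂ] _) f := by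
  have h : (dX : Superfield U V →ₗ[ℂ] Superfield U V) = D ^ 2 := LinearMap.ext dX_eq_dx
  rw [rowX, h, pow_mul]

theorem rowDX_eq (r : ℕ) (f : Superfield U V) :
    rowDX r f = (D ^ (2 * r + 1) : _ →ₗ[ℂ] _) f := by
  rw [pow_succ']
  exact congrArg superD (rowX_eq r f)

theorem two_smul_eq_two_mul (f : Superfield U V) : (2 : ℂ) • f = 2 * f := by
  rw [two_smul, two_mul]

theorem isMRSolution_iff {α u : Superfield U V} : IsMRSolution α u ↔ SolvesMR α u := by
  have e2 (x : Superfield U V) : 2 * x = (2 : ℂ) • x := (two_smul_eq_two_mul x).symm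
  have e3 (x : Superfield U V) : 3 * x = (3 : ℂ) • x := by
    rw [show (3 : Superfield U V) * x = x + x + x by noncomm_ring]; module
  have e4 (x : Superfield U V) : 4 * x = (4 : ℂ) • x := by
    rw [show (4 : Superfield U V) * x = x + x + x + x by noncomm_ring]; module
  have hq (x y : Superfield U V) : x = (1 / 4 : ℂ) • y ↔ 4 * x = y := by
    rw [e4]
    constructor
    · rintro rfl; rw [smul_smul]; norm_num
    · rintro rfl; rw [smul_smul]; norm_num
  have h1 : dx (dx α) + 3 * (α * D α + 2 * (α * u))
      = dX (dX α) + (3 : ℂ) • (α * superD α) + (6 : ℂ) • (α * u) := by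
    rw [e2, e3, smul_add, smul_smul, dX_eq_dx, dX_eq_dx, ← add_assoc]
    norm_num
    rfl
  have h2 : dx (dx u) + 3 * (α * D u + u ^ 2)
      = dX (dX u) + (3 : ℂ) • u ^ 2 + (3 : ℂ) • (α * superD u) := by
    rw [e3, smul_add, dX_eq_dx, dX_eq_dx, add_comm ((3 : ℂ) • (α * D u)), ← add_assoc]
    rfl
  constructor
  · rintro ⟨hα, hu, ha, hb⟩
    refine ⟨hα, hu, (lax_eq_zero_iff hα hu).2 ⟨?_, ?_⟩⟩
    · rw [h1, ← dX_eq_dx]; exact (hq _ _).1 ha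
    · rw [h2, ← dX_eq_dx]; exact (hq _ _).1 hb
  · rintro ⟨hα, hu, hl⟩
    obtain ⟨ha, hb⟩ := (lax_eq_zero_iff hα hu).1 hl
    rw [h1, ← dX_eq_dx] at ha
    rw [h2, ← dX_eq_dx] at hb
    exact ⟨hα, hu, (hq _ _).2 ha, (hq _ _).2 hb⟩

theorem IsLinearSolution.solvesLinear {α u ψ : Superfield U V} {lam : ℂ}
    (h : IsLinearSolution α u lam ψ) : SolvesLinear α u lam ψ := by
  obtain ⟨hL, hM⟩ := h
  simp only [dX_eq_dx] at hL hM
  exact ⟨(act_laxL α u ψ).trans hL, act_laxM hL hM⟩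

theorem wronskiBlocks_eq {p q : ℕ} (R S : ℕ → Superfield U V → Superfield U V)
    (θ : ℕ → Superfield U V) {a B C E} (ha : ∀ (r : Fin p) (c : Fin p), R r (θ (2 * c)) = a r c)
    (hB : ∀ (r : Fin p) (c : Fin q), R r (θ (2 * c + 1)) = B r c)
    (hC : ∀ (r : Fin q) (c : Fin p), S r (θ (2 * c)) = C r c)
    (hE : ∀ (r : Fin q) (c : Fin q), S r (θ (2 * c + 1)) = E r c) :
    wronskiBlocks p q R S θ = Matrix.fromBlocks a B C E := by
  rw [wronskiBlocks]
  congr 1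
  exacts [Matrix.ext ha, Matrix.ext hB, Matrix.ext hC, Matrix.ext hE]

theorem wronskiBlocks_rowX (p q : ℕ) (θ : ℕ → Superfield U V) :
    wronskiBlocks p q rowX rowDX θ = Matrix.fromBlocks (wronskiBlock p p 0 0 θ)
      (wronskiBlock p q 0 1 θ) (wronskiBlock q p 1 0 θ) (wronskiBlock q q 1 1 θ) :=
  wronskiBlocks_eq _ _ θ (fun _ _ => rowX_eq _ _) (fun _ _ => rowX_eq _ _)
    (fun _ _ => rowDX_eq _ _) (fun _ _ => rowDX_eq _ _)

theorem wronskiBlocks_upper (p q m : ℕ) (R : ℕ → Superfield U V → Superfield U V)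
    (θ : ℕ → Superfield U V) (hlast : ∀ f, R p f = (D ^ m : _ →ₗ[ℂ] _) f)
    (hR : ∀ r < p, R r = rowX r) :
    wronskiBlocks (p + 1) q R rowDX θ = Matrix.fromBlocks
      ((wronskiBlock (p + 1) (p + 1) 0 0 θ).updateRow (Fin.last p) (wronskiRow m (p + 1) 0 θ))
      ((wronskiBlock (p + 1) q 0 1 θ).updateRow (Fin.last p) (wronskiRow m q 1 θ))
      (wronskiBlock q (p + 1) 1 0 θ) (wronskiBlock q q 1 1 θ) := by
  refine wronskiBlocks_eq _ _ θ (fun r c => ?_) (fun r c => ?_)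
    (fun _ _ => rowDX_eq _ _) (fun _ _ => rowDX_eq _ _) <;>
  · induction r using Fin.lastCases with
    | last => rw [Matrix.updateRow_self, Fin.val_last, hlast]; rfl
    | cast r =>
      rw [Matrix.updateRow_ne (Fin.castSucc_lt_last r).ne, Fin.val_castSucc, hR r r.2, rowX_eq]
      rfl

theorem wronskiBlocks_lower (p q m : ℕ) (R : ℕ → Superfield U V → Superfield U V)
    (θ : ℕ → Superfield U V) (hlast : ∀ f, R q f = (D ^ m : _ →ₗ[ℂ] _) f)
    (hR : ∀ r < q, R r = rowDX r) :
    wronskiBlocks p (q + 1) rowX R θ = Matrix.fromBlocks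
      (wronskiBlock p p 0 0 θ) (wronskiBlock p (q + 1) 0 1 θ)
      ((wronskiBlock (q + 1) p 1 0 θ).updateRow (Fin.last q) (wronskiRow m p 0 θ))
      ((wronskiBlock (q + 1) (q + 1) 1 1 θ).updateRow (Fin.last q)
        (wronskiRow m (q + 1) 1 θ)) := by
  refine wronskiBlocks_eq _ _ θ (fun _ _ => rowX_eq _ _) (fun _ _ => rowX_eq _ _)
    (fun r c => ?_) (fun r c => ?_) <;>
  · induction r using Fin.lastCases with
    | last => rw [Matrix.updateRow_self, Fin.val_last, hlast]; rfl
    | cast r =>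
      rw [Matrix.updateRow_ne (Fin.castSucc_lt_last r).ne, Fin.val_castSucc, hR r r.2, rowDX_eq]
      rfl

theorem sdet_zero {A : Type*} [Ring A] (M : Matrix (Fin 0 ⊕ Fin 0) (Fin 0 ⊕ Fin 0) A) :
    sdet M = 1 := by
  simp [sdet, rowDet]

theorem coe_mul_inverse {A : Type*} [Ring A] [Algebra ℂ A] [SuperDiffAlgebra A]
    {s e : evenPart A} (hs : IsUnit s) (he : IsUnit e) (x : A) :
    x * (s : A) * ((Ring.inverse e : evenPart A) : A)
      * Ring.inverse ((s * Ring.inverse e : evenPart A) : A) = x := by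
  have hu : IsUnit (s * Ring.inverse e) := hs.mul (isUnit_ringInverse.2 he)
  rw [isUnit_coe_inverse hu, mul_assoc x, ← Subalgebra.coe_mul, mul_assoc x, ← Subalgebra.coe_mul,
    Ring.mul_inverse_cancel _ hu, OneMemClass.coe_one, mul_one]

/-- Matches the formulas with `darboux_even`: for `n = 2k > 0`, `D ln sdet 𝒲` is the coefficient
`aₙ₋₁` of `T`, and `sdet 𝒲̂ / sdet 𝒲` is `-aₙ₋₂`. -/
theorem darboux_superfield_even {α u : Superfield U V} (hαu : IsMRSolution α u)
    {k : ℕ} {θ : ℕ → Superfield U V} {lam : ℕ → ℂ}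
    (hθ : ∀ j < 2 * k, IsLinearSolution α u (lam j) (θ j))
    (hpar : ∀ j < 2 * k, parity (θ j) = (-1 : ℂ) ^ j • θ j)
    (hW : IsSuperInvertible (evenW k θ)) {α' u' : Superfield U V}
    (hα' : α' = α - (2 : ℂ) • superD (superD (superDlog (sdet (evenW k θ)))))
    (hu' : u' = u + (2 : ℂ) • dX (sdet (evenWhat k θ) * Ring.inverse (sdet (evenW k θ)))
      + (α + α') * superDlog (sdet (evenW k θ))) : IsMRSolution α' u' := by
  cases k with
  | zero =>
    -- Without any `θ` both superdeterminants are 1, and the transformation is the identity.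
    have h1 : superDlog (1 : Superfield U V) = 0 := by
      rw [superDlog]
      exact (congrArg _ D_one).trans (mul_zero _)
    have h2 : dX (1 : Superfield U V) = 0 := (dX_eq_dx _).trans dx_one
    simp only [sdet_zero, h1, h2, Ring.inverse_one, mul_one, map_zero, smul_zero, sub_zero,
      mul_zero, add_zero] at hα' hu'
    rwa [hα', hu']
  | succ k =>
    have hsp : Splits (2 * k + 2) (k + 1) (k + 1) := ⟨by ring, Or.inl rfl⟩
    rw [evenW, wronskiBlocks_rowX] at hW hα' hu'
    obtain ⟨a, S, E, hae, hEe, hau, hEu, hSu, hS, hnd, coeff, hker⟩ :=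
      wronski_data hsp hpar hW.1 hW.2
    have h₀ := hker.vecMul_even hsp
    have h₁ := hker.vecMul_odd hsp
    have hWdet : sdet (Matrix.fromBlocks (wronskiBlock (k + 1) (k + 1) 0 0 θ)
        (wronskiBlock (k + 1) (k + 1) 0 1 θ) (wronskiBlock (k + 1) (k + 1) 1 0 θ)
        (wronskiBlock (k + 1) (k + 1) 1 1 θ)) = ((S.det * Ring.inverse E.det : evenPart _) : _) := by
      rw [← hEe, ← hae, sdet_fromBlocks hEu, ← hS, rowDet_emb, ← Subalgebra.coe_mul]
    have hhat : sdet (evenWhat (k + 1) θ)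
        = -(coeff (2 * k) * (S.det : Superfield U V)) * ((Ring.inverse E.det : evenPart _) : _) := by
      rw [evenWhat, wronskiBlocks_upper k (k + 1) (2 * k + 2) _ θ
        (fun f => by rw [if_pos rfl, rowX_eq]; rfl)
        (fun r hr => by rw [if_neg (by omega)]), ← hEe, ← hae, sdet_fromBlocks hEu,
        rowDet_schur_updateRow hEu hS (b := fun r : Fin (k + 1) => coeff (2 * r))
          (c := fun r : Fin (k + 1) => coeff (2 * r + 1)) (by rw [hae]; exact h₀)
          (by rw [hEe]; exact h₁)]
      rfl
    have hcoeff (r : Fin (k + 1)) : par (coeff (2 * r)) = coeff (2 * r) := by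
      rw [par_coeff hpar hnd hker (by omega), Even.neg_one_pow ⟨k + 1 + r, by ring⟩, one_smul]
    let b : Fin (k + 1) → evenPart (Superfield U V) := fun r => ⟨coeff (2 * r), hcoeff r⟩
    -- Here `Γ` has a single nonzero row, the last, formed by the coefficients of odd index; its
    -- trace is the topmost of them.
    have hlog : superDlog ((S.det * Ring.inverse E.det : evenPart (Superfield U V)) : Superfield U V)
        = coeff (2 * k + 1) := by
      refine (dlog_sdet (a := a) (Ω := companion b) (B := wronskiBlock (k + 1) (k + 1) 0 1 θ)
        (C := wronskiBlock (k + 1) (k + 1) 1 0 θ) hEu hSu (fun i j => ?_) hS ?_ ?_ ?_ ?_).trans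
        (trace_updateRow_last fun r : Fin (k + 1) => coeff (2 * r + 1))
      · simpa using par_wronskiBlock (s := 0) (t := 1) hpar hsp.odd_lt i j
      · rw [hae, wronskiBlock_map_D]
      · rw [hEe, wronskiBlock_map_D]
      · rw [hae]
        exact wronskiBlock_one_map_D h₀
      · rw [hEe]
        exact wronskiBlock_one_map_D h₁
    rw [hWdet, hlog] at hα' hu'
    rw [hhat, ← neg_mul, coe_mul_inverse hSu hEu, map_neg, smul_neg, ← sub_eq_add_neg] at hu'
    refine isMRSolution_iff.2 (darboux_even (isMRSolution_iff.1 hαu)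
      (fun j hj => (hθ j hj).solvesLinear) hpar hnd hker (hα'.trans ?_) (hu'.trans ?_))
    · rw [two_smul_eq_two_mul]
      rfl
    · rw [two_smul_eq_two_mul, dX_eq_dx]

/-- Matches the formulas with `darboux_odd`: `R = -a₂ₖ` by Cramer's rule, and `sdet 𝒲 / sdet 𝒲̌ =
-a₂ₖ₋₁` by `lower_coefficient` when `k > 0`. -/
theorem darboux_superfield_odd {α u : Superfield U V} (hαu : IsMRSolution α u)
    {k : ℕ} {θ : ℕ → Superfield U V} {lam : ℕ → ℂ}
    (hθ : ∀ j < 2 * k + 1, IsLinearSolution α u (lam j) (θ j))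
    (hpar : ∀ j < 2 * k + 1, parity (θ j) = (-1 : ℂ) ^ j • θ j)
    (hW : IsSuperInvertible (oddW k θ)) (hW' : IsSuperInvertible (oddWcheck k θ))
    {α' u' : Superfield U V} (hα' : α' = -α + (2 : ℂ) • dX (oddRatio k θ))
    (hu' : u' = u + (2 : ℂ) • dX (sdet (oddW k θ) * Ring.inverse (sdet (oddWcheck k θ)))
      + superD α + (α - α') * oddRatio k θ) : IsMRSolution α' u' := by
  have hsp : Splits (2 * k + 1) (k + 1) k := ⟨by ring, Or.inr rfl⟩
  have hWe := wronskiBlocks_rowX (k + 1) k θ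
  rw [oddW, hWe] at hW hu'
  obtain ⟨a, S, E, hae, hEe, hau, hEu, hSu, hS, hnd, coeff, hker⟩ :=
    wronski_data hsp hpar hW.1 hW.2
  have h₀ := hker.vecMul_even hsp
  have h₁ := hker.vecMul_odd hsp
  have hWdet : sdet (Matrix.fromBlocks (wronskiBlock (k + 1) (k + 1) 0 0 θ)
      (wronskiBlock (k + 1) k 0 1 θ) (wronskiBlock k (k + 1) 1 0 θ)
      (wronskiBlock k k 1 1 θ)) = ((S.det * Ring.inverse E.det : evenPart _) : _) := by
    rw [← hEe, ← hae, sdet_fromBlocks hEu, ← hS, rowDet_emb, ← Subalgebra.coe_mul]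
  have hratio : oddRatio k θ = -coeff (2 * k) := by
    have h1 : rowDet (schur (oddWhat k θ)) = -(coeff (2 * k) * (S.det : Superfield U V)) := by
      rw [oddWhat, wronskiBlocks_upper k k (2 * k + 1) _ θ
        (fun f => by rw [if_pos rfl]; rfl)
        (fun r hr => by rw [if_neg (by omega)]), ← hEe, ← hae, schur_fromBlocks hEu,
        rowDet_schur_updateRow hEu hS (b := fun r : Fin (k + 1) => coeff (2 * r))
          (c := fun r : Fin k => coeff (2 * r + 1)) (by rw [hae]; exact h₀)
          (by rw [hEe]; exact h₁)]
      rfl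
    have h2 : rowDet (schur (oddW k θ)) = (S.det : Superfield U V) := by
      rw [oddW, hWe, ← hEe, ← hae, schur_fromBlocks hEu, ← hS, rowDet_emb]
    rw [oddRatio, h1, h2, isUnit_coe_inverse hSu, neg_mul, mul_assoc, ← Subalgebra.coe_mul,
      Ring.mul_inverse_cancel _ hSu, OneMemClass.coe_one, mul_one]
  set ρ := sdet (Matrix.fromBlocks (wronskiBlock (k + 1) (k + 1) 0 0 θ)
    (wronskiBlock (k + 1) k 0 1 θ) (wronskiBlock k (k + 1) 1 0 θ) (wronskiBlock k k 1 1 θ))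
    * Ring.inverse (sdet (oddWcheck k θ)) with hρ
  rw [hratio] at hα' hu'
  refine isMRSolution_iff.2 (darboux_odd (c := -dx ρ) (isMRSolution_iff.1 hαu)
    (fun j hj => (hθ j hj).solvesLinear) hpar hnd hker ?_ ?_ (hα'.trans ?_) (hu'.trans ?_))
  -- For `k = 0` there are no lower rows, so `𝒲̌ = 𝒲` and the quotient is the constant 1, with
  -- derivative 0.
  · rintro rfl
    have h1 : oddWcheck 0 θ = oddW 0 θ := by
      rw [oddWcheck, oddW, wronskiBlocks, wronskiBlocks]
      congr 1
    have hu : IsUnit (S.det * Ring.inverse E.det) := hSu.mul (isUnit_ringInverse.2 hEu)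
    rw [hρ, h1, oddW, hWe, hWdet, isUnit_coe_inverse hu, ← Subalgebra.coe_mul,
      Ring.mul_inverse_cancel _ hu, OneMemClass.coe_one, dx_one, neg_zero]
  · rintro l rfl
    have hcoeff (r : Fin (l + 1)) : par (coeff (2 * r + 1)) = coeff (2 * r + 1) := by
      rw [par_coeff hpar hnd hker (by omega), Even.neg_one_pow ⟨l + 1 + r + 1, by ring⟩, one_smul]
    let c : Fin (l + 1) → evenPart (Superfield U V) := fun r => ⟨coeff (2 * r + 1), hcoeff r⟩
    have hchk := wronskiBlocks_lower (l + 1 + 1) l (2 * (l + 1) + 1)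
      (fun r => if r + 1 = l + 1 then rowDX (l + 1) else rowDX r) θ
      (fun f => by rw [if_pos rfl, rowDX_eq]) (fun r hr => by rw [if_neg (by omega)])
    change oddWcheck (l + 1) θ = _ at hchk
    have hv₁ (j : Fin (l + 1)) : par (wronskiRow (2 * (l + 1) + 1) (l + 1) 1 θ j)
        = wronskiRow (2 * (l + 1) + 1) (l + 1) 1 θ j := by
      rw [wronskiRow, par_D_pow]
      have h : par (θ (2 * j + 1)) = _ := hpar _ (hsp.odd_lt j)
      rw [h, map_smul, smul_smul, ← pow_add,
        Even.neg_one_pow ⟨l + 1 + j + 1, by ring⟩, one_smul]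
    obtain ⟨E', hE'⟩ := exists_emb (M := (wronskiBlock (l + 1) (l + 1) 1 1 θ).updateRow
        (Fin.last l) (wronskiRow (2 * (l + 1) + 1) (l + 1) 1 θ)) fun i j => by
      by_cases hi : i = Fin.last l
      · rw [hi, Matrix.updateRow_self, hv₁]
      · rw [Matrix.updateRow_ne hi]
        simpa using par_wronskiBlock (s := 1) (t := 1) hpar hsp.odd_lt i j
    have hv₀ (j : Fin (l + 2)) : par (wronskiRow (2 * (l + 1) + 1) (l + 2) 0 θ j)
        = -wronskiRow (2 * (l + 1) + 1) (l + 2) 0 θ j := by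
      rw [wronskiRow, par_D_pow]
      have h : par (θ (2 * j + 0)) = _ := hpar _ (hsp.even_lt j)
      rw [h, map_smul, smul_smul, ← pow_add,
        Odd.neg_one_pow ⟨l + 1 + j, by ring⟩, neg_one_smul]
    rw [hchk, ← hE', ← hae] at hW'
    have hE'u : IsUnit E'.det := isUnit_det_of_isUnit_emb hW'.2
    have hBodd (i : Fin (l + 2)) (j : Fin (l + 1)) : par (wronskiBlock (l + 2) (l + 1) 0 1 θ i j)
        = -wronskiBlock (l + 2) (l + 1) 0 1 θ i j := by
      simpa using par_wronskiBlock (s := 0) (t := 1) hpar hsp.odd_lt i j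
    obtain ⟨S', hS', hS'u⟩ := exists_schur (B := wronskiBlock (l + 2) (l + 1) 0 1 θ)
      (C := (wronskiBlock (l + 1) (l + 2) 1 0 θ).updateRow (Fin.last l)
        (wronskiRow (2 * (l + 1) + 1) (l + 2) 0 θ)) E' hau hBodd fun i j => by
      by_cases hi : i = Fin.last l
      · rw [hi, Matrix.updateRow_self, hv₀]
      · rw [Matrix.updateRow_ne hi]
        simpa using par_wronskiBlock (s := 1) (t := 0) hpar hsp.even_lt i j
    have hlow := lower_coefficient hEu hE'u hSu hS hS' (hE'.trans (by rw [hEe])) hBodd (c := c)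
      (b := fun r : Fin (l + 2) => coeff (2 * r))
      (fun r => by
        rw [par_coeff hpar hnd hker (by omega), Odd.neg_one_pow ⟨l + 1 + r, by ring⟩, neg_one_smul])
      (by rw [hae]; exact h₀) (by rw [hEe]; exact h₁)
    have hu : IsUnit (S'.det * Ring.inverse E'.det) := hS'u.mul (isUnit_ringInverse.2 hE'u)
    rw [hρ, hWdet, hchk, ← hE', ← hae, sdet_fromBlocks hE'u, ← hS', rowDet_emb,
      ← Subalgebra.coe_mul, isUnit_coe_inverse hu, ← Subalgebra.coe_mul, hlow]
    change -dx (-coeff (2 * l + 1)) = _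
    rw [map_neg, neg_neg]
  · rw [map_neg, smul_neg, ← sub_eq_add_neg, two_smul_eq_two_mul, dX_eq_dx]
  · rw [two_smul_eq_two_mul, dX_eq_dx, mul_neg, mul_neg, sub_neg_eq_add, ← sub_eq_add_neg]
    rfl

end Superfields

end SuperKdV

end

open SuperKdV in
theorem theorem1 {V : Type*} [AddCommGroup V] [Module ℂ V]
    (U : TopologicalSpace.Opens (ℂ × ℂ)) (α u : Superfield U V) (hαu : IsMRSolution α u)
    (n : ℕ) (θ : ℕ → Superfield U V) (lam : ℕ → ℂ)
    (hθ : ∀ j < n, IsLinearSolution α u (lam j) (θ j))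
    (hpar : ∀ j < n, parity (θ j) = (-1 : ℂ) ^ j • θ j) :
    (∀ k, n = 2 * k → IsSuperInvertible (evenW k θ) →
      ∀ α' u' : Superfield U V,
        α' = α - (2 : ℂ) • superD (superD (superDlog (sdet (evenW k θ)))) →
        u' = u + (2 : ℂ) • dX (sdet (evenWhat k θ) * Ring.inverse (sdet (evenW k θ)))
          + (α + α') * superDlog (sdet (evenW k θ)) →
        IsMRSolution α' u') ∧
    (∀ k, n = 2 * k + 1 → IsSuperInvertible (oddW k θ) → IsSuperInvertible (oddWcheck k θ) →
      ∀ α' u' : Superfield U V,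
        α' = -α + (2 : ℂ) • dX (oddRatio k θ) →
        u' = u + (2 : ℂ) • dX (sdet (oddW k θ) * Ring.inverse (sdet (oddWcheck k θ)))
          + superD α + (α - α') * oddRatio k θ →
        IsMRSolution α' u') := by
  constructor
  · rintro k rfl hW α' u' hα' hu'
    exact darboux_superfield_even hαu hθ hpar hW hα' hu'
  · rintro k rfl hW hW' α' u' hα' hu'
    exact darboux_superfield_odd hαu hθ hpar hW hW' hα' hu'
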